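/- Let $d,m\in\mathbb N$, $\mathbb T^d=[-\pi,\pi]^d$ with Lebesgue measure, and let $\Phi:\ell_2(\mathbb Z^d,\mathbb C^m)\to L_2(\mathbb T^d,\mathbb C^m)$ be the discrete Fourier transform $$(\Phi u)(x)=(2\pi)^{-d/2}\sum_{n\in\mathbb Z^d}e^{-i n\cdot x}u(n).$$ For a compact operator $A$ between Hilbert spaces let $n(s,A)$, $s>0$, be the number of singular numbers of $A$ (eigenvalues of $(A^*A)^{1/2}$, counted with multiplicity) greater than $s$. For $p>0$ let $\mathfrak S_{p,\infty}$ be the class of compact operators with $\sup_{s>0}s\,n(s,A)^{1/p}<\infty$, and $\mathfrak S^0_{p,\infty}=\{A\in\mathfrak S_{p,\infty}: n(s,A)=o(s^{-p}),\ s\to+0\}$. **Proposition.** Let $p\in(0,+\infty)$, and let $\mathbb W(n)$, $n\in\mathbb Z^d$, and $f(k)$, $k\in\mathbb T^d$, be complex $m\times m$ matrix-valued functions. Suppose that $$\mathbb W(n)=|n|^{-d/p}\Bigl(\omega\bigl(\tfrac{n}{|n|}\bigr)\mathbb 1+o(1)\Bigr),\qquad |n|\to+\infty,$$ where $|\cdot|$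 is the Euclidean norm, $\mathbb 1$ is the identity matrix and $\omega\in C(\mathbb S^{d-1})$ is a complex-valued scalar function. Let $f\in L_q(\mathbb T^d)$ (entrywise), where $q=p$ if $p>2$; $q=2$ if $p<2$; and $q>2$ ($q=\infty$ allowed) if $p=2$. Let $f$ and $\mathbb W$ also denote the operators of multiplication by these functions in $L_2(\mathbb T^d,\mathbb C^m)$ and $\ell_2(\mathbb Z^d,\mathbb C^m)$, with their natural maximal domains. Then $$f\,\Phi\mathbb W\Phi^*-\Phi\mathbb W\Phi^*f\in\mathfrak S^0_{p,\infty}$$ in the following sense: $f\,\Phi\mathbb W\Phi^*$ is defined on all of $L_2(\mathbb T^d,\mathbb C^m)$, $\Phi\mathbb W\Phi^*f$ is densely defined with its natural domain, and their difference is the restriction to that domain of a (necessarily unique) bounded operator on $L_2(\mathbb T^d,\mathbb C^m)$ that belongs to $\mathfrak S^0_{p,\infty}$. -/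

import Mathlib

open MeasureTheory Filter Topology Asymptotics
open scoped ENNReal InnerProductSpace

namespace DiscretePDO

/-! ### The spaces -/

/-- The torus `𝕋^d`, realised as the cube `[-π, π]^d`. -/
def torus (d : ℕ) : Set (Fin d → ℝ) :=
  Set.Icc (fun _ => -Real.pi) (fun _ => Real.pi)

/-- Lebesgue measure on the cube `[-π, π]^d`. -/
noncomputable def torusMeasure (d : ℕ) : Measure (Fin d → ℝ) :=
  volume.restrict (torus d)

/-- `L₂(𝕋^d, ℂ^m)`. -/
abbrev L2Torus (d m : ℕ) : Type :=
  Lp (EuclideanSpace ℂ (Fin m)) 2 (torusMeasure d)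

/-- `ℓ₂(ℤ^d, ℂ^m)`. -/
abbrev l2Lattice (d m : ℕ) : Type :=
  lp (fun _ : Fin d → ℤ => EuclideanSpace ℂ (Fin m)) 2

/-- A lattice point `n ∈ ℤ^d` as a vector of the Euclidean space `ℝ^d`. -/
noncomputable def latticeVec {d : ℕ} (n : Fin d → ℤ) : EuclideanSpace ℝ (Fin d) :=
  WithLp.toLp 2 fun i => (n i : ℝ)

/-! ### The discrete Fourier transform -/

/-- The normalised exponential `(2π)^{-d/2} e^{-i n·x}`. -/
noncomputable def fourierExp {d : ℕ} (n : Fin d → ℤ) (x : Fin d → ℝ) : ℂ :=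
  (((2 * Real.pi) ^ (-(d : ℝ) / 2) : ℝ) : ℂ) *
    Complex.exp (-Complex.I * ∑ i, ((n i : ℝ) * x i : ℝ))

theorem continuous_fourierExp {d : ℕ} (n : Fin d → ℤ) : Continuous (fourierExp n) := by
  unfold fourierExp
  fun_prop

instance isFiniteMeasure_torusMeasure (d : ℕ) : IsFiniteMeasure (torusMeasure d) := by
  unfold torusMeasure torus
  exact ⟨by rw [Measure.restrict_apply_univ]; exact isCompact_Icc.measure_lt_top⟩

theorem norm_fourierExp {d : ℕ} (n : Fin d → ℤ) (x : Fin d → ℝ) :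
    ‖fourierExp n x‖ = (2 * Real.pi) ^ (-(d : ℝ) / 2) := by
  have h : -Complex.I * ((∑ i, ((n i : ℝ) * x i : ℝ) : ℝ) : ℂ) =
      ((-∑ i, ((n i : ℝ) * x i : ℝ) : ℝ) : ℂ) * Complex.I := by
    push_cast; ring
  have h2 : (0 : ℝ) ≤ (2 * Real.pi) ^ (-(d : ℝ) / 2) := by positivity
  unfold fourierExp
  rw [h, norm_mul, Complex.norm_exp_ofReal_mul_I, Complex.norm_real,
    Real.norm_of_nonneg h2, mul_one]

theorem memLp_fourierExp_smul {d m : ℕ} (n : Fin d → ℤ) (c : EuclideanSpace ℂ (Fin m)) :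
    MemLp (fun x => fourierExp n x • c) 2 (torusMeasure d) := by
  refine MemLp.of_bound ?_ ((2 * Real.pi) ^ (-(d : ℝ) / 2) * ‖c‖) (ae_of_all _ fun x => ?_)
  · exact ((continuous_fourierExp n).smul continuous_const).aestronglyMeasurable
  · rw [norm_smul, norm_fourierExp]

theorem integral_exp_int (k : ℤ) :
    ∫ x in Set.Icc (-Real.pi) Real.pi, Complex.exp (Complex.I * (k * x : ℝ)) =
      if k = 0 then ((2 * Real.pi : ℝ) : ℂ) else 0 := by
  rw [integral_Icc_eq_integral_Ioc,
    ← intervalIntegral.integral_of_le (by linarith [Real.pi_pos])]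
  split_ifs with hk
  · subst hk
    simp
    ring
  · have hc : Complex.I * (k : ℂ) ≠ 0 := mul_ne_zero Complex.I_ne_zero (by exact_mod_cast hk)
    have h1 : ∀ x : ℝ, Complex.I * ((k * x : ℝ) : ℂ) = Complex.I * k * x := by
      intro x; push_cast; ring
    simp_rw [h1]
    rw [integral_exp_mul_complex hc]
    have h2 : Complex.exp (Complex.I * k * (Real.pi : ℝ)) =
        Complex.exp (Complex.I * k * ((-Real.pi : ℝ) : ℂ)) := by
      rw [Complex.exp_eq_exp_iff_exists_int]
      exact ⟨k, by push_cast; ring⟩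
    rw [h2, sub_self, zero_div]

theorem integral_conj_fourierExp_mul {d : ℕ} (n n' : Fin d → ℤ) :
    ∫ x, (starRingEnd ℂ) (fourierExp n x) * fourierExp n' x ∂(torusMeasure d) =
      if n = n' then 1 else 0 := by
  have hμ : torusMeasure d =
      Measure.pi fun _ : Fin d => (volume : Measure ℝ).restrict (Set.Icc (-Real.pi) Real.pi) := by
    unfold torusMeasure torus
    rw [← Set.pi_univ_Icc, volume_pi, Measure.restrict_pi_pi]
  have hf : ∀ x : Fin d → ℝ, (starRingEnd ℂ) (fourierExp n x) * fourierExp n' x =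
      (((2 * Real.pi) ^ (-(d : ℝ)) : ℝ) : ℂ) *
        ∏ i, Complex.exp (Complex.I * (((n i - n' i : ℤ) : ℝ) * x i : ℝ)) := by
    intro x
    have hs : ((2 * Real.pi) ^ (-(d : ℝ)) : ℝ) =
        (2 * Real.pi) ^ (-(d : ℝ) / 2) * (2 * Real.pi) ^ (-(d : ℝ) / 2) := by
      rw [← Real.rpow_add (by positivity)]; congr 1; ring
    rw [← Complex.exp_sum, hs]
    unfold fourierExp
    rw [map_mul, Complex.conj_ofReal, ← Complex.exp_conj, mul_mul_mul_comm, ← Complex.exp_add]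
    push_cast
    congr 2
    simp only [map_mul, map_neg, map_sum, Complex.conj_I, Complex.conj_ofReal, neg_neg, map_intCast]
    rw [Finset.mul_sum, Finset.mul_sum, ← Finset.sum_add_distrib]
    refine Finset.sum_congr rfl fun i _ => ?_
    ring
  simp_rw [hf]
  rw [integral_const_mul, hμ,
    integral_fintype_prod_eq_prod
      (f := fun i (t : ℝ) => Complex.exp (Complex.I * (((n i - n' i : ℤ) : ℝ) * t : ℝ)))]
  simp_rw [integral_exp_int]
  split_ifs with h
  · subst h
    have h2 : (2 * Real.pi) ^ (-(d : ℝ)) * (2 * Real.pi) ^ d = 1 := by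
      rw [Real.rpow_neg (by positivity), Real.rpow_natCast, inv_mul_cancel₀ (by positivity)]
    simp only [sub_self, if_true, Finset.prod_const, Finset.card_univ, Fintype.card_fin]
    exact_mod_cast h2
  · obtain ⟨i, hi⟩ := Function.ne_iff.mp h
    rw [Finset.prod_eq_zero (Finset.mem_univ i) (if_neg (sub_ne_zero.mpr hi)), mul_zero]

theorem inner_toLp_fourierExp {d m : ℕ} (n n' : Fin d → ℤ) (c c' : EuclideanSpace ℂ (Fin m)) :
    ⟪(memLp_fourierExp_smul n c).toLp, (memLp_fourierExp_smul n' c').toLp⟫_ℂ =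
      (if n = n' then 1 else 0) * ⟪c, c'⟫_ℂ := by
  rw [L2.inner_def, ← integral_conj_fourierExp_mul, ← integral_mul_const]
  refine integral_congr_ae ?_
  filter_upwards [(memLp_fourierExp_smul n c).coeFn_toLp,
    (memLp_fourierExp_smul n' c').coeFn_toLp] with x h1 h2
  rw [h1, h2, inner_smul_left, inner_smul_right]
  ring

/-- The isometric embedding `c ↦ (2π)^{-d/2} e^{-i n·x} c` of `ℂ^m` into `L₂(𝕋^d, ℂ^m)`. -/
noncomputable def fourierMode {d : ℕ} (m : ℕ) (n : Fin d → ℤ) :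
    EuclideanSpace ℂ (Fin m) →ₗᵢ[ℂ] L2Torus d m where
  toFun c := (memLp_fourierExp_smul n c).toLp
  map_add' c c' := by
    rw [← MemLp.toLp_add]
    exact MemLp.toLp_congr _ _ (ae_of_all _ fun x => smul_add _ _ _)
  map_smul' a c := by
    rw [RingHom.id_apply, ← MemLp.toLp_const_smul]
    exact MemLp.toLp_congr _ _ (ae_of_all _ fun x => smul_comm _ _ _)
  norm_map' c := by
    have h := inner_toLp_fourierExp n n c c
    rw [if_pos rfl, one_mul, inner_self_eq_norm_sq_to_K, inner_self_eq_norm_sq_to_K] at h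
    have h' : ‖(memLp_fourierExp_smul n c).toLp‖ ^ 2 = ‖c‖ ^ 2 := by exact_mod_cast h
    exact (sq_eq_sq₀ (norm_nonneg _) (norm_nonneg _)).mp h'

theorem orthogonalFamily_fourierMode (d m : ℕ) :
    OrthogonalFamily ℂ (fun _ : Fin d → ℤ => EuclideanSpace ℂ (Fin m))
      (fun n => fourierMode m n) := by
  intro n n' hn c c'
  refine (inner_toLp_fourierExp n n' c c').trans ?_
  rw [if_neg hn, zero_mul]

/-- The discrete Fourier transform `Φ : ℓ₂(ℤ^d, ℂ^m) → L₂(𝕋^d, ℂ^m)`,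
`(Φ u)(x) = (2π)^{-d/2} ∑_{n ∈ ℤ^d} e^{-i n·x} u(n)`, the series converging in `L₂`. -/
noncomputable def fourier (d m : ℕ) : l2Lattice d m →L[ℂ] L2Torus d m :=
  (orthogonalFamily_fourierMode d m).linearIsometry.toContinuousLinearMap

/-! ### Multiplication operators and products of partially defined operators -/

/-- The product `g f` of two partially defined operators, with its natural domain
`{x ∈ dom f | f x ∈ dom g}`. -/
def pcomp {E F G : Type*} [AddCommGroup E] [Module ℂ E] [AddCommGroup F] [Module ℂ F]
    [AddCommGroup G] [Module ℂ G] (g : F →ₗ.[ℂ] G) (f : E →ₗ.[ℂ] F) : E →ₗ.[ℂ] G where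
  domain :=
    { carrier := {x | ∃ h : x ∈ f.domain, f ⟨x, h⟩ ∈ g.domain}
      zero_mem' := ⟨f.domain.zero_mem, by
        have h : f ⟨0, f.domain.zero_mem⟩ = 0 := f.map_zero
        rw [h]; exact g.domain.zero_mem⟩
      add_mem' := by
        rintro x y ⟨hx, hx'⟩ ⟨hy, hy'⟩
        refine ⟨f.domain.add_mem hx hy, ?_⟩
        have h := f.map_add ⟨x, hx⟩ ⟨y, hy⟩
        exact h ▸ g.domain.add_mem hx' hy'
      smul_mem' := by
        rintro c x ⟨hx, hx'⟩
        refine ⟨f.domain.smul_mem c hx, ?_⟩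
        have h := f.map_smul c ⟨x, hx⟩
        exact h ▸ g.domain.smul_mem c hx' }
  toFun :=
    { toFun := fun x => g ⟨f ⟨x, x.2.choose⟩, x.2.choose_spec⟩
      map_add' := by
        rintro ⟨x, hx, hx'⟩ ⟨y, hy, hy'⟩
        rw [← g.map_add]
        congr 1
        exact Subtype.ext (f.map_add ⟨x, hx⟩ ⟨y, hy⟩)
      map_smul' := by
        rintro c ⟨x, hx, hx'⟩
        rw [RingHom.id_apply, ← g.map_smul]
        congr 1
        exact Subtype.ext (f.map_smul c ⟨x, hx⟩) }

/-- The natural domain `{u ∈ L₂ | f u ∈ L₂}` of the multiplication by `f` in `L₂(𝕋^d, ℂ^m)`. -/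
noncomputable def mulTorusDomain {d m : ℕ} (f : (Fin d → ℝ) → Matrix (Fin m) (Fin m) ℂ) :
    Submodule ℂ (L2Torus d m) where
  carrier := {u | MemLp (fun k => (f k).toEuclideanLin (u k)) 2 (torusMeasure d)}
  zero_mem' := by
    refine (memLp_congr_ae ?_).mpr (MemLp.zero (p := 2) (μ := torusMeasure d))
    filter_upwards [Lp.coeFn_zero (EuclideanSpace ℂ (Fin m)) 2 (torusMeasure d)] with k hk
    rw [hk]; simp
  add_mem' := by
    intro u v hu hv
    refine (memLp_congr_ae ?_).mpr (MemLp.add hu hv)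
    filter_upwards [Lp.coeFn_add u v] with k hk
    exact (congrArg _ hk).trans (map_add _ _ _)
  smul_mem' := by
    intro c u hu
    refine (memLp_congr_ae ?_).mpr (MemLp.const_smul hu c)
    filter_upwards [Lp.coeFn_smul c u] with k hk
    exact (congrArg _ hk).trans (map_smul (f k).toEuclideanLin c (u k))

theorem memLp_of_mem_mulTorusDomain {d m : ℕ} {f : (Fin d → ℝ) → Matrix (Fin m) (Fin m) ℂ}
    {u : L2Torus d m} (hu : u ∈ mulTorusDomain f) :
    MemLp (fun k => (f k).toEuclideanLin (u k)) 2 (torusMeasure d) := hu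

/-- The operator `[f(k)]` of multiplication by a matrix-valued function `f` in `L₂(𝕋^d, ℂ^m)`,
with its natural domain. -/
noncomputable def mulTorus {d m : ℕ} (f : (Fin d → ℝ) → Matrix (Fin m) (Fin m) ℂ) :
    L2Torus d m →ₗ.[ℂ] L2Torus d m where
  domain := mulTorusDomain f
  toFun :=
    { toFun := fun u => (memLp_of_mem_mulTorusDomain u.2).toLp
      map_add' := by
        intro u v
        rw [← MemLp.toLp_add]
        refine MemLp.toLp_congr _ _ ?_
        filter_upwards [Lp.coeFn_add (u : L2Torus d m) (v : L2Torus d m)] with k hk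
        exact (congrArg _ hk).trans (map_add _ _ _)
      map_smul' := by
        intro c u
        rw [RingHom.id_apply, ← MemLp.toLp_const_smul]
        refine MemLp.toLp_congr _ _ ?_
        filter_upwards [Lp.coeFn_smul c (u : L2Torus d m)] with k hk
        exact (congrArg _ hk).trans (map_smul (f k).toEuclideanLin c ((u : L2Torus d m) k)) }

/-- The operator `[W(n)]` of multiplication by a matrix-valued function `W` in `ℓ₂(ℤ^d, ℂ^m)`,
with its natural domain `{u ∈ ℓ₂ | W u ∈ ℓ₂}`. -/
noncomputable def mulLattice {d m : ℕ} (W : (Fin d → ℤ) → Matrix (Fin m) (Fin m) ℂ) :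
    l2Lattice d m →ₗ.[ℂ] l2Lattice d m where
  domain :=
    { carrier := {u | Memℓp (fun n => (W n).toEuclideanLin (u n)) 2}
      zero_mem' := by
        have h : (fun n => (W n).toEuclideanLin ((0 : l2Lattice d m) n)) = 0 := by
          funext n; simp
        rw [Set.mem_ofPred_eq, h]; exact zero_memℓp
      add_mem' := by
        intro u v hu hv
        have h : (fun n => (W n).toEuclideanLin ((u + v) n)) =
            (fun n => (W n).toEuclideanLin (u n)) + fun n => (W n).toEuclideanLin (v n) := by
          funext n; simp
        rw [Set.mem_ofPred_eq, h]; exact Memℓp.add hu hv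
      smul_mem' := by
        intro c u hu
        have h : (fun n => (W n).toEuclideanLin ((c • u) n)) =
            c • fun n => (W n).toEuclideanLin (u n) := by
          funext n; simp
        rw [Set.mem_ofPred_eq, h]; exact Memℓp.const_smul hu c }
  toFun :=
    { toFun := fun u => ⟨fun n => (W n).toEuclideanLin ((u : l2Lattice d m) n), u.2⟩
      map_add' := by
        rintro ⟨u, hu⟩ ⟨v, hv⟩
        apply lp.ext
        funext n
        exact map_add (W n).toEuclideanLin (u n) (v n)
      map_smul' := by
        rintro c ⟨u, hu⟩
        apply lp.ext
        funext n
        exact map_smul (W n).toEuclideanLin c (u n) }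

/-- An everywhere defined bounded operator, as a partially defined operator. -/
def everywhere {E F : Type*} [NormedAddCommGroup E] [NormedSpace ℂ E] [NormedAddCommGroup F]
    [NormedSpace ℂ F] (T : E →L[ℂ] F) : E →ₗ.[ℂ] F :=
  (T : E →ₗ[ℂ] F).toPMap ⊤

/-- The operator `Φ W Φ*` in `L₂(𝕋^d, ℂ^m)`. -/
noncomputable def conjFourier {d m : ℕ} (W : (Fin d → ℤ) → Matrix (Fin m) (Fin m) ℂ) :
    L2Torus d m →ₗ.[ℂ] L2Torus d m :=
  pcomp (everywhere (fourier d m))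
    (pcomp (mulLattice W) (everywhere (ContinuousLinearMap.adjoint (fourier d m))))

/-- The commutator `f Φ W Φ* - Φ W Φ* f` in `L₂(𝕋^d, ℂ^m)`, with its natural domain. -/
noncomputable def commutator {d m : ℕ} (f : (Fin d → ℝ) → Matrix (Fin m) (Fin m) ℂ)
    (W : (Fin d → ℤ) → Matrix (Fin m) (Fin m) ℂ) : L2Torus d m →ₗ.[ℂ] L2Torus d m :=
  pcomp (mulTorus f) (conjFourier W) - pcomp (conjFourier W) (mulTorus f)

/-! ### Singular numbers and the classes `𝔖_{p,∞}`, `𝔖⁰_{p,∞}` -/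

section Schatten

variable {H₁ H₂ : Type*} [NormedAddCommGroup H₁] [InnerProductSpace ℂ H₁] [CompleteSpace H₁]
  [NormedAddCommGroup H₂] [InnerProductSpace ℂ H₂] [CompleteSpace H₂]

/-- The multiplicity of `σ > 0` as a singular number of `A`, i.e. as an eigenvalue of
`|A| = (A* A)^{1/2}`: the dimension of the eigenspace of `A* A` with eigenvalue `σ²`. -/
noncomputable def singularMultiplicity (A : H₁ →L[ℂ] H₂) (σ : ℝ) : ℕ∞ :=
  Cardinal.toENat (Module.rank ℂ
    (Module.End.eigenspace ((ContinuousLinearMap.adjoint A ∘L A : H₁ →L[ℂ] H₁) : Module.End ℂ H₁)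
      ((σ ^ 2 : ℝ) : ℂ)))

/-- The distribution function `n(s, A)`: the number of singular numbers of `A` greater than `s`,
counted with multiplicity. -/
noncomputable def singularCount (s : ℝ) (A : H₁ →L[ℂ] H₂) : ℝ≥0∞ :=
  ∑' σ : Set.Ioi s, (singularMultiplicity A (σ : ℝ) : ℝ≥0∞)

/-- The functional `‖A‖_{𝔖_{p,∞}} = sup_{s > 0} s n(s, A)^{1/p}`. -/
noncomputable def weakSchattenNorm (p : ℝ) (A : H₁ →L[ℂ] H₂) : ℝ≥0∞ :=
  ⨆ s : Set.Ioi (0 : ℝ), ENNReal.ofReal (s : ℝ) * singularCount (s : ℝ) A ^ (1 / p)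

/-- `A ∈ 𝔖_{p,∞}`. -/
def MemWeakSchatten (p : ℝ) (A : H₁ →L[ℂ] H₂) : Prop :=
  IsCompactOperator A ∧ weakSchattenNorm p A < ∞

/-- `A ∈ 𝔖⁰_{p,∞}`: `A ∈ 𝔖_{p,∞}` and `n(s, A) = o(s^{-p})` as `s → +0`. -/
def MemWeakSchattenZero (p : ℝ) (A : H₁ →L[ℂ] H₂) : Prop :=
  MemWeakSchatten p A ∧
    Tendsto (fun s : ℝ => ENNReal.ofReal (s ^ p) * singularCount s A) (𝓝[>] 0) (𝓝 0)

end Schatten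

end DiscretePDO

/-!
The commutator is approximated, at every small scale `s`, by an operator of rank `o(s^{-p})`, up to
an error which is small in operator norm or in Hilbert–Schmidt norm.

*Approximation.* `Approx A s N` says that `A = R + B + H` with `rank R ≤ N`, `‖B‖ ≤ s` and a finite
rank `H` with `‖H‖²_HS ≤ s² N`. On the span of the eigenvectors of `A* A` with singular numbers
above `2 s`, intersected with the kernel of `R`, one has `‖H x‖ ≥ s ‖x‖`; hence `n(2 s, A) ≤ 2 N`
(`Approx.singularCount_le`). The property is stable, up to constants, under sums, adjoints and
products with bounded operators. An operator with `Approx A s (δ s^{-p})` for every `δ > 0` and all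
`s` small enough is in `𝔖⁰_{p,∞}` (`NegligiblyApprox.memWeakSchattenZero`).

*The Cwikel type bound.* The symbol is written as `W = w Q`, with a dyadic weight
`w(n) = 2^{-level n}` comparable to `|n|^{-d/p}` and bounded `Q`; at most `K 2^{Lp}` lattice points
have level below `L`. For a scalar `g ∈ L_q` the operator `g Φ w` is bounded, and at the scale
`s = 2^{-L}` the levels below `L` form its finite rank part. The other levels are split where
`|g(x)|` crosses `s 2^{level n}`: the part below is bounded by a pointwise Schur test
(`LevelFunction.norm_smallOp_apply_le`) and the part above is Hilbert–Schmidt by Bessel's inequality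
at each point (`LevelFunction.hsBound_largeOp`, `LevelFunction.sum_largeMass_le`). The three cases of
the relation between `p` and `q` enter only through `exists_sum_truncated_rpow_le`. By homogeneity a
small norm of `g` in `L_q` makes the bound of order `s^{-p}` small
(`LevelFunction.exists_eventuallyApprox`).

*The commutator.* For an exponential `g` and a constant matrix `M`, multiplication by `g` becomes a
shift by a lattice vector `k`, and the commutator with `g M` is a shift followed by the lattice
multiplier `M W(n - k) - W(n) M`. The leading part of `W` is scalar, and `ω` is uniformly continuous
on the sphere, so this multiplier is `o(|n|^{-d/p})`, which is the `o`-class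
(`negligiblyApprox_scalarCommutator_fourierExp`). Trigonometric polynomials are dense in `L_q`, and
the Cwikel type bound controls the remainder (`exists_negligiblyApprox_scalarCommutator`). A matrix
function is a sum of its entries times matrix units.

*Domains.* The half `Φ W Φ* f` is unbounded in general. It is handled through the adjoint of
`conj g Φ w`, and identified on its natural domain in `weightOp_adjoint_fourier_mulTorus`.
-/

namespace DiscretePDO

/-! ### Approximation of operators up to finite rank and Hilbert–Schmidt errors -/

section Approximation

variable {E F G : Type*} [NormedAddCommGroup E] [InnerProductSpace ℂ E]
  [NormedAddCommGroup F] [InnerProductSpace ℂ F] [NormedAddCommGroup G] [InnerProductSpace ℂ G]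

/-- The squared Hilbert–Schmidt norm of `A` is at most `h`; expressed through finite orthonormal
families, so that no basis has to be chosen. -/
def HSBound (A : E →L[ℂ] F) (h : ℝ) : Prop :=
  ∀ (N : ℕ) (v : Fin N → E), Orthonormal ℂ v → ∑ i, ‖A (v i)‖ ^ 2 ≤ h

/-- The operator `A` has rank at most `N`. -/
def RankLE (A : E →L[ℂ] F) (N : ℝ) : Prop :=
  ∃ K : Submodule ℂ F, FiniteDimensional ℂ K ∧ (Module.finrank ℂ K : ℝ) ≤ N ∧ ∀ x, A x ∈ K

/-- `A` is the sum of an operator of rank at most `N`, an operator of norm at most `s`, and a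
finite rank operator of squared Hilbert–Schmidt norm at most `s² N`. -/
def Approx (A : E →L[ℂ] F) (s N : ℝ) : Prop :=
  ∃ R B H : E →L[ℂ] F, A = R + B + H ∧ RankLE R N ∧ ‖B‖ ≤ s ∧ HSBound H (s ^ 2 * N) ∧
    ∃ N', RankLE H N'

theorem HSBound.mono {A : E →L[ℂ] F} {h h' : ℝ} (hA : HSBound A h) (hh : h ≤ h') :
    HSBound A h' := fun N v hv => (hA N v hv).trans hh

theorem RankLE.mono {A : E →L[ℂ] F} {h h' : ℝ} (hA : RankLE A h) (hh : h ≤ h') :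
    RankLE A h' := by
  obtain ⟨K, h1, h2, h3⟩ := hA
  exact ⟨K, h1, h2.trans hh, h3⟩

theorem RankLE.nonneg {A : E →L[ℂ] F} {h : ℝ} (hA : RankLE A h) : 0 ≤ h := by
  obtain ⟨K, h1, h2, h3⟩ := hA
  exact (Nat.cast_nonneg _).trans h2

theorem HSBound.add {A B : E →L[ℂ] F} {a b : ℝ} (hA : HSBound A a) (hB : HSBound B b) :
    HSBound (A + B) (2 * (a + b)) := by
  intro N v hv
  calc ∑ i, ‖(A + B) (v i)‖ ^ 2 ≤ ∑ i, 2 * (‖A (v i)‖ ^ 2 + ‖B (v i)‖ ^ 2) := by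
        refine Finset.sum_le_sum fun i _ => ?_
        have h1 : ‖(A + B) (v i)‖ ≤ ‖A (v i)‖ + ‖B (v i)‖ := norm_add_le _ _
        nlinarith [sq_nonneg (‖A (v i)‖ - ‖B (v i)‖), norm_nonneg ((A + B) (v i)),
          norm_nonneg (A (v i)), norm_nonneg (B (v i))]
    _ ≤ _ := by
        rw [← Finset.mul_sum, Finset.sum_add_distrib]
        have := hA N v hv
        have := hB N v hv
        linarith

theorem HSBound.norm_apply_le {A : E →L[ℂ] F} {h : ℝ} (hA : HSBound A h) (x : E) :
    ‖A x‖ ≤ √h * ‖x‖ := by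
  rcases eq_or_ne x 0 with rfl | hx
  · simp
  have hx' : 0 < ‖x‖ := norm_pos_iff.mpr hx
  have h1 := hA 1 (fun _ => ((‖x‖⁻¹ : ℝ) : ℂ) • x) (by
    rw [orthonormal_iff_ite]
    intro i j
    rw [Subsingleton.elim i j, if_pos rfl, inner_self_eq_norm_sq_to_K, norm_smul, Complex.norm_real,
      norm_inv, norm_norm, inv_mul_cancel₀ hx'.ne']
    simp)
  simp only [Finset.univ_unique, Finset.sum_const, Finset.card_singleton, one_smul, map_smul,
    norm_smul, Complex.norm_real, norm_inv, norm_norm] at h1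
  have h2 := Real.le_sqrt_of_sq_le h1
  rwa [inv_mul_le_iff₀ hx', mul_comm] at h2

theorem RankLE.add {A B : E →L[ℂ] F} {a b : ℝ} (hA : RankLE A a) (hB : RankLE B b) :
    RankLE (A + B) (a + b) := by
  obtain ⟨K, h1, h2, h3⟩ := hA
  obtain ⟨K', h1', h2', h3'⟩ := hB
  refine ⟨K ⊔ K', inferInstance, ?_, fun x => Submodule.add_mem_sup (h3 x) (h3' x)⟩
  have := Submodule.finrank_add_le_finrank_add_finrank K K'
  have : (Module.finrank ℂ ↥(K ⊔ K') : ℝ) ≤ Module.finrank ℂ K + Module.finrank ℂ K' := by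
    exact_mod_cast this
  linarith

theorem RankLE.zero : RankLE (0 : E →L[ℂ] F) 0 :=
  ⟨⊥, inferInstance, by simp, fun x => by simp⟩

theorem HSBound.zero : HSBound (0 : E →L[ℂ] F) 0 := by
  intro N v _; simp

theorem RankLE.comp_left {A : E →L[ℂ] F} {a : ℝ} (T : F →L[ℂ] G) (hA : RankLE A a) :
    RankLE (T ∘L A) a := by
  obtain ⟨K, h1, h2, h3⟩ := hA
  refine ⟨K.map (T : F →ₗ[ℂ] G), inferInstance, ?_, fun x => ⟨A x, h3 x, rfl⟩⟩
  refine le_trans ?_ h2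
  exact_mod_cast Submodule.finrank_map_le _ _

theorem RankLE.comp_right {A : F →L[ℂ] G} {a : ℝ} (T : E →L[ℂ] F) (hA : RankLE A a) :
    RankLE (A ∘L T) a := by
  obtain ⟨K, h1, h2, h3⟩ := hA
  exact ⟨K, h1, h2, fun x => h3 (T x)⟩

theorem HSBound.comp_left {A : E →L[ℂ] F} {a : ℝ} (T : F →L[ℂ] G) (hA : HSBound A a) :
    HSBound (T ∘L A) (‖T‖ ^ 2 * a) := by
  intro N v hv
  refine le_trans ?_ (mul_le_mul_of_nonneg_left (hA N v hv) (sq_nonneg _))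
  rw [Finset.mul_sum]
  refine Finset.sum_le_sum fun i _ => ?_
  rw [← mul_pow]
  exact pow_le_pow_left₀ (norm_nonneg _) (T.le_opNorm _) 2

theorem Approx.add {A B : E →L[ℂ] F} {s a b : ℝ} (hA : Approx A s a) (hB : Approx B s b) :
    Approx (A + B) (2 * s) (a + b) := by
  obtain ⟨R, S, H, rfl, hR, hS, hH, n, hn⟩ := hA
  obtain ⟨R', S', H', rfl, hR', hS', hH', n', hn'⟩ := hB
  refine ⟨R + R', S + S', H + H', by abel, hR.add hR', ?_, (hH.add hH').mono ?_, _, hn.add hn'⟩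
  · linarith [norm_add_le S S']
  · nlinarith [hR.nonneg, hR'.nonneg, mul_nonneg (sq_nonneg s) (add_nonneg hR.nonneg hR'.nonneg)]

theorem Approx.mono {A : E →L[ℂ] F} {s s' a a' : ℝ} (hA : Approx A s a) (hs : s ≤ s')
    (ha : a ≤ a') : Approx A s' a' := by
  obtain ⟨R, S, H, rfl, hR, hS, hH, n, hn⟩ := hA
  have hs0 : 0 ≤ s := (norm_nonneg _).trans hS
  refine ⟨R, S, H, rfl, hR.mono ha, hS.trans hs, hH.mono ?_, n, hn⟩
  have := hR.nonneg
  gcongr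

theorem Approx.comp_left {A : E →L[ℂ] F} {s a c : ℝ} (hA : Approx A s a) (T : F →L[ℂ] G)
    (hT : ‖T‖ ≤ c) : Approx (T ∘L A) (c * s) a := by
  obtain ⟨R, S, H, rfl, hR, hS, hH, n, hn⟩ := hA
  have hs0 : 0 ≤ s := (norm_nonneg _).trans hS
  have hc : 0 ≤ c := (norm_nonneg _).trans hT
  refine ⟨T ∘L R, T ∘L S, T ∘L H, by simp, hR.comp_left T, ?_, (hH.comp_left T).mono ?_,
    n, hn.comp_left T⟩
  · exact (T.opNorm_comp_le S).trans (mul_le_mul hT hS (norm_nonneg _) hc)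
  · have := hR.nonneg
    rw [mul_pow, mul_assoc]
    gcongr

section Adjoint

variable [CompleteSpace E] [CompleteSpace F] [CompleteSpace G]

theorem RankLE.adjoint {A : E →L[ℂ] F} {a : ℝ} (hA : RankLE A a) :
    RankLE (ContinuousLinearMap.adjoint A) a := by
  obtain ⟨K, h1, h2, h3⟩ := hA
  refine ⟨K.map ((ContinuousLinearMap.adjoint A : F →L[ℂ] E) : F →ₗ[ℂ] E), inferInstance, ?_,
    fun y => ⟨K.starProjection y, Submodule.starProjection_apply_mem _ _, ?_⟩⟩
  · refine le_trans ?_ h2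
    exact_mod_cast Submodule.finrank_map_le _ _
  · refine ext_inner_right ℂ fun x => ?_
    change ⟪ContinuousLinearMap.adjoint A (K.starProjection y), x⟫_ℂ = _
    rw [ContinuousLinearMap.adjoint_inner_left, ContinuousLinearMap.adjoint_inner_left,
      Submodule.inner_starProjection_left_eq_right,
      Submodule.starProjection_eq_self_iff.mpr (h3 x)]

/-- The Hilbert–Schmidt norm of the adjoint: both sides are compared through an orthonormal basis
of the span of the images of the given orthonormal family. -/
theorem HSBound.adjoint {A : E →L[ℂ] F} {a : ℝ} (hA : HSBound A a) :
    HSBound (ContinuousLinearMap.adjoint A) a := by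
  intro N v hv
  set K : Submodule ℂ E := Submodule.span ℂ (Set.range fun i => ContinuousLinearMap.adjoint A (v i))
  have : FiniteDimensional ℂ K := FiniteDimensional.span_of_finite ℂ (Set.finite_range _)
  let b := stdOrthonormalBasis ℂ K
  have hb : Orthonormal ℂ fun j => (b j : E) := b.orthonormal.comp_linearIsometry K.subtypeₗᵢ
  have key : ∀ i, ‖ContinuousLinearMap.adjoint A (v i)‖ ^ 2 = ∑ j, ‖⟪v i, A (b j)⟫_ℂ‖ ^ 2 := by
    intro i
    have hi : ContinuousLinearMap.adjoint A (v i) ∈ K := Submodule.subset_span ⟨i, rfl⟩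
    have := b.sum_sq_norm_inner_right ⟨_, hi⟩
    rw [Submodule.coe_norm] at this
    rw [← this]
    refine Finset.sum_congr rfl fun j _ => ?_
    rw [Submodule.coe_inner, ContinuousLinearMap.adjoint_inner_right, norm_inner_symm]
  calc _ = ∑ j, ∑ i, ‖⟪v i, A (b j)⟫_ℂ‖ ^ 2 := by
        rw [Finset.sum_comm]; exact Finset.sum_congr rfl fun i _ => key i
    _ ≤ ∑ j, ‖A (b j)‖ ^ 2 := Finset.sum_le_sum fun j _ => hv.sum_inner_products_le _
    _ ≤ a := hA _ _ hb

theorem Approx.adjoint {A : E →L[ℂ] F} {s a : ℝ} (hA : Approx A s a) :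
    Approx (ContinuousLinearMap.adjoint A) s a := by
  obtain ⟨R, S, H, rfl, hR, hS, hH, n, hn⟩ := hA
  refine ⟨_, _, _, by rw [map_add, map_add], hR.adjoint, ?_, hH.adjoint, n, hn.adjoint⟩
  rwa [LinearIsometryEquiv.norm_map]

theorem Approx.comp_right {A : F →L[ℂ] G} {s a c : ℝ} (hA : Approx A s a) (T : E →L[ℂ] F)
    (hT : ‖T‖ ≤ c) : Approx (A ∘L T) (c * s) a := by
  have h := (hA.adjoint.comp_left (c := c) (ContinuousLinearMap.adjoint T)
    (by rwa [LinearIsometryEquiv.norm_map])).adjoint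
  rwa [ContinuousLinearMap.adjoint_comp, ContinuousLinearMap.adjoint_adjoint,
    ContinuousLinearMap.adjoint_adjoint] at h

end Adjoint

/-- A subspace on which `‖A x‖ > 2 s ‖x‖` has dimension at most `2 N`: intersect it with the kernel
of the finite rank part and compare with the Hilbert–Schmidt norm of the remaining part. -/
theorem Approx.finrank_le {A : E →L[ℂ] F} {s N : ℝ} (hs : 0 < s) (hA : Approx A s N)
    (V : Submodule ℂ E) [FiniteDimensional ℂ V]
    (hV : ∀ x ∈ V, x ≠ 0 → 2 * s * ‖x‖ < ‖A x‖) : (Module.finrank ℂ V : ℝ) ≤ 2 * N := by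
  obtain ⟨R, S, H, rfl, ⟨K, hK, hKN, hR⟩, hS, hH, -⟩ := hA
  let R' : V →ₗ[ℂ] K := ((R : E →ₗ[ℂ] F).comp V.subtype).codRestrict K fun x => hR x
  have h1 := LinearMap.finrank_range_add_finrank_ker R'
  have h2 : Module.finrank ℂ (LinearMap.range R') ≤ Module.finrank ℂ K :=
    Submodule.finrank_le _
  let b := stdOrthonormalBasis ℂ (LinearMap.ker R')
  have hb : Orthonormal ℂ fun j => ((b j : V) : E) :=
    (b.orthonormal.comp_linearIsometry (LinearMap.ker R').subtypeₗᵢ).comp_linearIsometry V.subtypeₗᵢ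
  have h3 := hH _ _ hb
  have h4 : ∀ j, s ^ 2 ≤ ‖H ((b j : V) : E)‖ ^ 2 := by
    intro j
    have hn : ‖((b j : V) : E)‖ = 1 := hb.1 j
    have hne : ((b j : V) : E) ≠ 0 := by
      intro h; rw [h, norm_zero] at hn; exact zero_ne_one hn
    have h5 := hV _ (b j : V).2 hne
    have h6 : R ((b j : V) : E) = 0 := congrArg Subtype.val (b j).2
    have h7 : ‖S ((b j : V) : E)‖ ≤ s := by
      refine (S.le_opNorm _).trans ?_
      rwa [hn, mul_one]
    have h8 : ‖(R + S + H) ((b j : V) : E)‖ ≤ ‖S ((b j : V) : E)‖ + ‖H ((b j : V) : E)‖ := by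
      simp only [add_apply, h6, zero_add]
      exact norm_add_le _ _
    rw [hn] at h5
    exact pow_le_pow_left₀ hs.le (by linarith) 2
  have h9 := (Finset.sum_le_sum fun j (_ : j ∈ Finset.univ) => h4 j).trans h3
  rw [Finset.sum_const, Finset.card_univ, Fintype.card_fin, nsmul_eq_mul, mul_comm] at h9
  have h10 := le_of_mul_le_mul_left h9 (by positivity)
  have h11 : (Module.finrank ℂ V : ℝ) ≤ Module.finrank ℂ K + Module.finrank ℂ (LinearMap.ker R') := by
    rw [← h1]; exact_mod_cast Nat.add_le_add_right h2 _
  linarith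

theorem RankLE.isCompactOperator {A : E →L[ℂ] F} {a : ℝ} (hA : RankLE A a) :
    IsCompactOperator A := by
  obtain ⟨K, h1, h2, h3⟩ := hA
  have h : IsCompactOperator (A.codRestrict K h3) := by
    have : ProperSpace K := FiniteDimensional.proper ℂ K
    exact isCompactOperator_of_locallyCompactSpace_dom (A.codRestrict K h3)
  exact h.clm_comp K.subtypeL

end Approximation

/-! ### Singular numbers and approximation -/

section Counting

variable {H₁ H₂ : Type*} [NormedAddCommGroup H₁] [InnerProductSpace ℂ H₁] [CompleteSpace H₁]
  [NormedAddCommGroup H₂] [InnerProductSpace ℂ H₂] [CompleteSpace H₂]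

/-- The space of eigenvectors of `A* A` with eigenvalue `σ²`. -/
noncomputable def singularSpace (A : H₁ →L[ℂ] H₂) (σ : ℝ) : Submodule ℂ H₁ :=
  Module.End.eigenspace ((ContinuousLinearMap.adjoint A ∘L A : H₁ →L[ℂ] H₁) : Module.End ℂ H₁)
      ((σ ^ 2 : ℝ) : ℂ)

theorem orthogonalFamily_singularSpace (A : H₁ →L[ℂ] H₂) :
    OrthogonalFamily ℂ (fun σ : Set.Ioi (0 : ℝ) => singularSpace A σ)
      fun σ => (singularSpace A σ).subtypeₗᵢ := by
  have hsym : ((ContinuousLinearMap.adjoint A ∘L A : H₁ →L[ℂ] H₁) : H₁ →ₗ[ℂ] H₁).IsSymmetric := by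
    intro x y
    change ⟪ContinuousLinearMap.adjoint A (A x), y⟫_ℂ = ⟪x, ContinuousLinearMap.adjoint A (A y)⟫_ℂ
    rw [ContinuousLinearMap.adjoint_inner_left, ContinuousLinearMap.adjoint_inner_right]
  refine hsym.orthogonalFamily_eigenspaces.comp (γ := Set.Ioi (0 : ℝ))
    (f := fun σ => (((σ : ℝ) ^ 2 : ℝ) : ℂ)) ?_
  intro σ τ h
  have h1 : (σ : ℝ) ^ 2 = (τ : ℝ) ^ 2 := Complex.ofReal_injective h
  exact Subtype.ext ((sq_eq_sq₀ (le_of_lt σ.2) (le_of_lt τ.2)).mp h1)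

/-- `‖A x‖ > s ‖x‖` on the span of the singular vectors with singular numbers above `s`, by
orthogonality of the eigenspaces. -/
theorem norm_apply_gt_of_mem_sup_singularSpace (A : H₁ →L[ℂ] H₂) {s : ℝ} (hs : 0 < s)
    (T : Finset (Set.Ioi (0 : ℝ))) (hT : ∀ σ ∈ T, s < (σ : ℝ)) (x : H₁)
    (hx : x ∈ T.sup fun σ => singularSpace A σ) (hx0 : x ≠ 0) : s * ‖x‖ < ‖A x‖ := by
  classical
  rw [Finset.sup_eq_iSup, Submodule.mem_iSup_finset_iff_exists_sum] at hx
  obtain ⟨v, hv⟩ := hx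
  have hO := orthogonalFamily_singularSpace A
  have hn : ‖x‖ ^ 2 = ∑ σ ∈ T, ‖v σ‖ ^ 2 := by
    rw [← hv]; exact hO.norm_sum v T
  have hA : ‖A x‖ ^ 2 = ∑ σ ∈ T, (σ : ℝ) ^ 2 * ‖v σ‖ ^ 2 := by
    have h1 : ContinuousLinearMap.adjoint A (A x) =
        ∑ σ ∈ T, (((((σ : ℝ) ^ 2 : ℝ) : ℂ) • v σ : singularSpace A σ) : H₁) := by
      rw [← hv, map_sum, map_sum]
      exact Finset.sum_congr rfl fun σ _ => Module.End.mem_eigenspace_iff.mp (v σ).2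
    have h2 : ⟪A x, A x⟫_ℂ = ∑ σ ∈ T, ⟪v σ, ((((σ : ℝ) ^ 2 : ℝ) : ℂ) • v σ : singularSpace A σ)⟫_ℂ := by
      rw [← ContinuousLinearMap.adjoint_inner_right, h1]
      nth_rewrite 1 [← hv]
      exact hO.inner_sum v (fun σ => (((σ : ℝ) ^ 2 : ℝ) : ℂ) • v σ) T
    simp only [inner_smul_right, inner_self_eq_norm_sq_to_K] at h2
    apply Complex.ofReal_injective
    push_cast at h2 ⊢
    exact h2
  have hlt : ∑ σ ∈ T, s ^ 2 * ‖v σ‖ ^ 2 < ∑ σ ∈ T, (σ : ℝ) ^ 2 * ‖v σ‖ ^ 2 := by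
    refine Finset.sum_lt_sum (fun σ hσ => ?_) ?_
    · have := hT σ hσ
      gcongr
    · by_contra! hcon
      apply hx0
      rw [← hv]
      refine Finset.sum_eq_zero fun σ hσ => ?_
      have h1 := hcon σ hσ
      have h2 : s ^ 2 < (σ : ℝ) ^ 2 := by have := hT σ hσ; gcongr
      have h3 : ‖v σ‖ ^ 2 ≤ 0 := by nlinarith [sq_nonneg ‖v σ‖]
      have h4 : ‖v σ‖ = 0 := by nlinarith [norm_nonneg (v σ)]
      rw [norm_eq_zero.mp h4]; rfl
  rw [← Finset.mul_sum, ← hn, ← hA, ← mul_pow] at hlt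
  exact lt_of_pow_lt_pow_left₀ 2 (norm_nonneg _) hlt

/-- `Approx.finrank_le` for the span of the singular vectors with singular numbers above `2 s`.
The count is an infinite sum, so it is bounded over finite sets of singular numbers. The eigenspaces
are not known to be finite dimensional beforehand; this follows from the bound on the dimension of
their finite dimensional subspaces. -/
theorem Approx.singularCount_le {A : H₁ →L[ℂ] H₂} {s N : ℝ} (hs : 0 < s) (hA : Approx A s N) :
    singularCount (2 * s) A ≤ ENNReal.ofReal (2 * N) := by
  classical
  have main : ∀ T : Finset (Set.Ioi (0 : ℝ)), (∀ σ ∈ T, 2 * s < (σ : ℝ)) →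
      FiniteDimensional ℂ ↥(T.sup fun σ => singularSpace A σ) ∧
      (Module.finrank ℂ ↥(T.sup fun σ => singularSpace A σ) : ℝ) ≤ 2 * N := by
    intro T hT
    set V := T.sup fun σ => singularSpace A σ with hVdef
    have hV := norm_apply_gt_of_mem_sup_singularSpace A (by positivity : 0 < 2 * s) T hT
    have hfin : FiniteDimensional ℂ V := by
      have hr : Module.rank ℂ V ≤ (⌊2 * N⌋₊ : ℕ) := by
        refine rank_le fun t ht => ?_
        let V' : Submodule ℂ H₁ := (Submodule.span ℂ (t : Set V)).map V.subtype
        have hfs : FiniteDimensional ℂ (Submodule.span ℂ (t : Set V)) :=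
          FiniteDimensional.span_finset ℂ t
        have h1 : (Module.finrank ℂ V' : ℝ) ≤ 2 * N := by
          refine hA.finrank_le hs V' fun x hx hx0 => ?_
          obtain ⟨y, -, rfl⟩ := hx
          exact hV _ y.2 hx0
        have h2 : Module.finrank ℂ V' = t.card := by
          rw [Submodule.finrank_map_subtype_eq]
          exact finrank_span_finset_eq_card ht
        rw [h2] at h1
        exact Nat.le_floor h1
      exact Module.rank_lt_aleph0_iff.mp (hr.trans_lt Cardinal.natCast_lt_aleph0)
    exact ⟨hfin, hA.finrank_le hs V hV⟩
  have hsum : ∀ T : Finset (Set.Ioi (0 : ℝ)), (∀ σ ∈ T, 2 * s < (σ : ℝ)) →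
      ∑ σ ∈ T, Module.finrank ℂ (singularSpace A σ) =
        Module.finrank ℂ ↥(T.sup fun σ => singularSpace A σ) := by
    intro T
    induction T using Finset.induction_on with
    | empty => intro _; rw [Finset.sum_empty, Finset.sup_empty, finrank_bot]
    | insert σ T hσ ih =>
      intro hT
      have hT' : ∀ τ ∈ T, 2 * s < (τ : ℝ) := fun τ hτ => hT τ (Finset.mem_insert_of_mem hτ)
      have := (main T hT').1
      have : FiniteDimensional ℂ (singularSpace A σ) := by
        have := (main {σ} (by
          intro τ hτ
          rw [Finset.mem_singleton.mp hτ]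
          exact hT σ (Finset.mem_insert_self _ _))).1
        rwa [Finset.sup_singleton] at this
      have hind := (orthogonalFamily_singularSpace A).independent
      have hdis : Disjoint (singularSpace A σ) (T.sup fun σ => singularSpace A σ) :=
        (hind.supIndep' (insert σ T)) (Finset.subset_insert σ T) (Finset.mem_insert_self _ _) hσ
      rw [Finset.sum_insert hσ, ih hT', Finset.sup_insert]
      have := Submodule.finrank_sup_add_finrank_inf_eq (singularSpace A σ)
        (T.sup fun σ => singularSpace A σ)
      rw [hdis.eq_bot, finrank_bot] at this
      omega
  refine ENNReal.summable.tsum_le_of_sum_le fun (T : Finset (Set.Ioi (2 * s))) => ?_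
  let g : Set.Ioi (2 * s) ↪ Set.Ioi (0 : ℝ) :=
    ⟨fun σ => ⟨σ, lt_trans (by positivity : 0 < 2 * s) σ.2⟩,
      fun a b h => Subtype.ext (congrArg (fun x : Set.Ioi (0 : ℝ) => (x : ℝ)) h)⟩
  have hgT : ∀ σ ∈ T.map g, 2 * s < (σ : ℝ) := by
    intro σ hσ
    obtain ⟨τ, -, rfl⟩ := Finset.mem_map.mp hσ
    exact τ.2
  have h1 := (main _ hgT).2
  rw [← hsum _ hgT, Finset.sum_map] at h1
  have h2 : ∀ σ ∈ T, ((singularMultiplicity A (σ : ℝ) : ℕ∞) : ℝ≥0∞) =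
      ((Module.finrank ℂ (singularSpace A (g σ)) : ℕ) : ℝ≥0∞) := by
    intro σ _
    have : FiniteDimensional ℂ (singularSpace A (g σ)) := by
      have := (main {g σ} (by
        intro τ hτ
        rw [Finset.mem_singleton.mp hτ]
        exact σ.2)).1
      rwa [Finset.sup_singleton] at this
    have h3 : singularMultiplicity A (σ : ℝ) =
        Cardinal.toENat (Module.rank ℂ (singularSpace A (g σ))) := rfl
    rw [h3, ← Module.finrank_eq_rank, Cardinal.toENat_nat]
    simp
  rw [Finset.sum_congr rfl h2, ← Nat.cast_sum, ← ENNReal.ofReal_natCast]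
  exact ENNReal.ofReal_le_ofReal h1

theorem singularCount_anti (A : H₁ →L[ℂ] H₂) {s t : ℝ} (h : s ≤ t) :
    singularCount t A ≤ singularCount s A :=
  ENNReal.tsum_mono_subtype (fun σ => ((singularMultiplicity A σ : ℕ∞) : ℝ≥0∞))
    (Set.Ioi_subset_Ioi h)

theorem singularCount_eq_zero (A : H₁ →L[ℂ] H₂) {s : ℝ} (h : ‖A‖ ≤ s) (hs : 0 < s) :
    singularCount s A = 0 := by
  refine ENNReal.tsum_eq_zero.mpr fun σ => ?_
  have h1 : singularSpace A σ = ⊥ := by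
    by_contra hne
    obtain ⟨x, hx, hx0⟩ := Submodule.exists_mem_ne_zero_of_ne_bot hne
    have h2 := norm_apply_gt_of_mem_sup_singularSpace A hs {⟨σ, hs.trans σ.2⟩}
      (fun τ hτ => by rw [Finset.mem_singleton.mp hτ]; exact σ.2) x
      (by rw [Finset.sup_singleton]; exact hx) hx0
    have h3 := A.le_opNorm x
    nlinarith [norm_nonneg x]
  have h3 : singularMultiplicity A (σ : ℝ) = Cardinal.toENat (Module.rank ℂ (singularSpace A σ)) :=
    rfl
  rw [h3, h1]; simp

end Counting

/-! ### The weak class in terms of approximation -/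

section Asymptotic

variable {H₁ H₂ H₃ : Type*} [NormedAddCommGroup H₁] [InnerProductSpace ℂ H₁]
  [NormedAddCommGroup H₂] [InnerProductSpace ℂ H₂]
  [NormedAddCommGroup H₃] [InnerProductSpace ℂ H₃]

/-- `limsup_{s → 0} s^p N(s) ≤ δ` for approximation numbers: `A` is approximable at every small
scale `s` with `N = δ s^{-p}`. -/
def EventuallyApprox (p : ℝ) (A : H₁ →L[ℂ] H₂) (δ : ℝ) : Prop :=
  ∀ᶠ s in 𝓝[>] (0 : ℝ), Approx A s (δ * s ^ (-p))

/-- The `o`-class in terms of `EventuallyApprox`. -/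
def NegligiblyApprox (p : ℝ) (A : H₁ →L[ℂ] H₂) : Prop :=
  ∀ δ > 0, EventuallyApprox p A δ

theorem EventuallyApprox.scale {p : ℝ} {A : H₁ →L[ℂ] H₂} {δ c : ℝ} (hc : 0 < c)
    (h : ∀ᶠ s in 𝓝[>] (0 : ℝ), Approx A (c * s) (δ * s ^ (-p))) :
    EventuallyApprox p A (c ^ p * δ) := by
  have hdiv : Tendsto (fun s : ℝ => s / c) (𝓝[>] 0) (𝓝[>] 0) := by
    refine tendsto_nhdsWithin_iff.mpr ⟨?_, ?_⟩
    · have : Tendsto (fun s : ℝ => s / c) (𝓝 0) (𝓝 (0 / c)) := tendsto_id.div_const c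
      rw [zero_div] at this
      exact this.mono_left nhdsWithin_le_nhds
    · filter_upwards [self_mem_nhdsWithin] with s hs
      exact div_pos hs hc
  filter_upwards [hdiv.eventually h, self_mem_nhdsWithin] with s hs hs0
  have hs0 : 0 < s := hs0
  rw [mul_div_cancel₀ s hc.ne'] at hs
  refine hs.mono le_rfl (le_of_eq ?_)
  rw [Real.div_rpow hs0.le hc.le, Real.rpow_neg hc.le]
  have := Real.rpow_pos_of_pos hc p
  field_simp

theorem EventuallyApprox.add {p : ℝ} {A B : H₁ →L[ℂ] H₂} {a b : ℝ}
    (hA : EventuallyApprox p A a) (hB : EventuallyApprox p B b) :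
    EventuallyApprox p (A + B) (2 ^ p * (a + b)) := by
  refine EventuallyApprox.scale two_pos ?_
  filter_upwards [hA, hB] with s h1 h2
  rw [add_mul]
  exact h1.add h2

theorem EventuallyApprox.mono {p : ℝ} {A : H₁ →L[ℂ] H₂} {a b : ℝ}
    (hA : EventuallyApprox p A a) (h : a ≤ b) : EventuallyApprox p A b := by
  filter_upwards [hA, self_mem_nhdsWithin] with s h1 hs
  have hs : 0 < s := hs
  exact h1.mono le_rfl (by gcongr)

theorem EventuallyApprox.comp_left {p : ℝ} {A : H₁ →L[ℂ] H₂} {a c : ℝ}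
    (hA : EventuallyApprox p A a) (T : H₂ →L[ℂ] H₃) (hc : 0 < c) (hT : ‖T‖ ≤ c) :
    EventuallyApprox p (T ∘L A) (c ^ p * a) :=
  EventuallyApprox.scale hc (Eventually.mono hA fun _ h => h.comp_left T hT)

theorem NegligiblyApprox.add {p : ℝ} {A B : H₁ →L[ℂ] H₂}
    (hA : NegligiblyApprox p A) (hB : NegligiblyApprox p B) : NegligiblyApprox p (A + B) := by
  intro δ hδ
  have h : 0 < δ / 2 / 2 ^ p := by positivity
  refine ((hA _ h).add (hB _ h)).mono (le_of_eq ?_)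
  have := Real.rpow_pos_of_pos (two_pos : (0 : ℝ) < 2) p
  field_simp
  norm_num

theorem NegligiblyApprox.zero {p : ℝ} : NegligiblyApprox p (0 : H₁ →L[ℂ] H₂) := by
  intro δ hδ
  filter_upwards [self_mem_nhdsWithin] with s hs
  have hs : 0 < s := hs
  have h0 : 0 ≤ δ * s ^ (-p) := by positivity
  exact ⟨0, 0, 0, by simp, RankLE.zero.mono h0, by simpa using hs.le,
    HSBound.zero.mono (by positivity), 0, RankLE.zero⟩

theorem NegligiblyApprox.sum {p : ℝ} {ι : Type*} (t : Finset ι) {A : ι → H₁ →L[ℂ] H₂}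
    (hA : ∀ i ∈ t, NegligiblyApprox p (A i)) : NegligiblyApprox p (∑ i ∈ t, A i) :=
  Finset.sum_induction _ _ (fun _ _ => NegligiblyApprox.add) NegligiblyApprox.zero hA

theorem NegligiblyApprox.comp_left {p : ℝ} {A : H₁ →L[ℂ] H₂}
    (hA : NegligiblyApprox p A) (T : H₂ →L[ℂ] H₃) : NegligiblyApprox p (T ∘L A) := by
  intro δ hδ
  have hc : 0 < ‖T‖ + 1 := by positivity
  have hc' := Real.rpow_pos_of_pos hc p
  refine ((hA (δ / (‖T‖ + 1) ^ p) (by positivity)).comp_left T hc (by linarith)).mono ?_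
  rw [mul_div_cancel₀ _ hc'.ne']

variable [CompleteSpace H₂]

theorem NegligiblyApprox.isCompactOperator {p : ℝ} {A : H₁ →L[ℂ] H₂}
    (hA : NegligiblyApprox p A) : IsCompactOperator A := by
  have h1 : A ∈ closure {T : H₁ →L[ℂ] H₂ | IsCompactOperator T} := by
    rw [Metric.mem_closure_iff]
    intro ε hε
    have h2 : ∀ᶠ s in 𝓝[>] (0 : ℝ), s < ε := nhdsWithin_le_nhds (gt_mem_nhds hε)
    obtain ⟨s, hs, hsε⟩ := ((hA 1 one_pos).and h2).exists
    obtain ⟨R, S, H, rfl, hR, hS, -, n, hn⟩ := hs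
    refine ⟨R + H, hR.isCompactOperator.add hn.isCompactOperator, ?_⟩
    rw [dist_eq_norm]
    have : R + S + H - (R + H) = S := by abel
    rw [this]; linarith
  have h2 : IsClosed {T : H₁ →L[ℂ] H₂ | IsCompactOperator T} := isClosed_setOfPred_isCompactOperator
  rwa [h2.closure_eq] at h1

variable [CompleteSpace H₁] [CompleteSpace H₃]

theorem EventuallyApprox.adjoint {p : ℝ} {A : H₁ →L[ℂ] H₂} {a : ℝ}
    (hA : EventuallyApprox p A a) : EventuallyApprox p (ContinuousLinearMap.adjoint A) a :=
  Eventually.mono hA fun _ h => h.adjoint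

theorem EventuallyApprox.comp_right {p : ℝ} {A : H₂ →L[ℂ] H₃} {a c : ℝ}
    (hA : EventuallyApprox p A a) (T : H₁ →L[ℂ] H₂) (hc : 0 < c) (hT : ‖T‖ ≤ c) :
    EventuallyApprox p (A ∘L T) (c ^ p * a) :=
  EventuallyApprox.scale hc (Eventually.mono hA fun _ h => h.comp_right T hT)

theorem NegligiblyApprox.comp_right {p : ℝ} {A : H₂ →L[ℂ] H₃}
    (hA : NegligiblyApprox p A) (T : H₁ →L[ℂ] H₂) : NegligiblyApprox p (A ∘L T) := by
  intro δ hδ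
  have hc : 0 < ‖T‖ + 1 := by positivity
  have hc' := Real.rpow_pos_of_pos hc p
  refine ((hA (δ / (‖T‖ + 1) ^ p) (by positivity)).comp_right T hc (by linarith)).mono ?_
  rw [mul_div_cancel₀ _ hc'.ne']

/-- The bound at small scales gives the `o`-condition. For the supremum defining the quasi-norm,
the counting function vanishes at scales above `‖A‖` and is monotone in between. -/
theorem NegligiblyApprox.memWeakSchattenZero {p : ℝ} (hp : 0 < p) {A : H₁ →L[ℂ] H₂}
    (hA : NegligiblyApprox p A) : MemWeakSchattenZero p A := by
  have key : ∀ δ > 0, ∀ᶠ s in 𝓝[>] (0 : ℝ),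
      ENNReal.ofReal (s ^ p) * singularCount s A ≤ ENNReal.ofReal δ := by
    intro δ hδ
    have hδ' : 0 < δ / 2 * 2 ^ (-p) := by positivity
    have hhalf : Tendsto (fun s : ℝ => s / 2) (𝓝[>] 0) (𝓝[>] 0) := by
      refine tendsto_nhdsWithin_iff.mpr ⟨?_, ?_⟩
      · have : Tendsto (fun s : ℝ => s / 2) (𝓝 0) (𝓝 (0 / 2)) :=
          tendsto_id.div_const 2
        rw [zero_div] at this
        exact this.mono_left nhdsWithin_le_nhds
      · filter_upwards [self_mem_nhdsWithin] with s hs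
        exact half_pos (show 0 < s from hs)
    filter_upwards [hhalf.eventually (hA _ hδ'), self_mem_nhdsWithin] with s hs hs0
    have hs0 : 0 < s := hs0
    have h1 := hs.singularCount_le (half_pos hs0)
    rw [mul_div_cancel₀ s two_ne_zero] at h1
    calc _ ≤ ENNReal.ofReal (s ^ p) * _ := mul_le_mul_right h1 _
      _ = _ := by
        rw [← ENNReal.ofReal_mul (by positivity)]
        congr 1
        rw [Real.div_rpow hs0.le zero_le_two, Real.rpow_neg hs0.le, Real.rpow_neg zero_le_two]
        have := Real.rpow_pos_of_pos hs0 p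
        have := Real.rpow_pos_of_pos (two_pos : (0 : ℝ) < 2) p
        field_simp
  refine ⟨⟨hA.isCompactOperator, ?_⟩, ?_⟩
  · obtain ⟨r, hr, hr'⟩ := mem_nhdsGT_iff_exists_Ioo_subset.mp (key 1 one_pos)
    have hr : 0 < r := hr
    have hcount : ∀ s, 0 < s → singularCount s A < ∞ := by
      intro s hs
      have h1 := hr' (show min s (r / 2) ∈ Set.Ioo 0 r from
        ⟨lt_min hs (half_pos hr), (min_le_right _ _).trans_lt (half_lt_self hr)⟩)
      refine (singularCount_anti A (min_le_left s (r / 2))).trans_lt ?_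
      by_contra hcon
      rw [not_lt, top_le_iff] at hcon
      rw [Set.mem_ofPred_eq, hcon, ENNReal.mul_top (by
        rw [Ne, ENNReal.ofReal_eq_zero, not_le]
        exact Real.rpow_pos_of_pos (lt_min hs (half_pos hr)) p)] at h1
      exact absurd h1 (by simp)
    set M : ℝ≥0∞ := max 1 (ENNReal.ofReal ‖A‖ * singularCount (r / 2) A ^ (1 / p)) with hM
    have hMtop : M < ∞ := by
      refine max_lt ENNReal.one_lt_top (ENNReal.mul_lt_top ENNReal.ofReal_lt_top ?_)
      exact ENNReal.rpow_lt_top_of_nonneg (by positivity) (hcount _ (half_pos hr)).ne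
    refine lt_of_le_of_lt (iSup_le fun s => ?_) hMtop
    obtain ⟨s, hs⟩ := s
    have hs : 0 < s := hs
    change ENNReal.ofReal s * singularCount s A ^ (1 / p) ≤ M
    rcases lt_or_ge s r with hsr | hsr
    · refine le_trans ?_ (le_max_left _ _)
      have h1 : ENNReal.ofReal (s ^ p) * singularCount s A ≤ ENNReal.ofReal 1 := hr' ⟨hs, hsr⟩
      rw [ENNReal.ofReal_one] at h1
      have h2 := ENNReal.rpow_le_rpow h1 (by positivity : 0 ≤ 1 / p)
      rw [ENNReal.one_rpow, ENNReal.mul_rpow_of_nonneg _ _ (by positivity),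
        ENNReal.ofReal_rpow_of_pos (Real.rpow_pos_of_pos hs p), ← Real.rpow_mul hs.le,
        mul_one_div_cancel hp.ne', Real.rpow_one] at h2
      exact h2
    · rcases le_or_gt ‖A‖ s with hAs | hAs
      · rw [singularCount_eq_zero A hAs hs, ENNReal.zero_rpow_of_pos (by positivity), mul_zero]
        exact zero_le
      · refine le_trans ?_ (le_max_right _ _)
        gcongr
        exact singularCount_anti A (by linarith)
  · rw [ENNReal.tendsto_nhds_zero]
    intro ε hε
    rcases eq_or_ne ε ∞ with rfl | hεt
    · exact Eventually.of_forall fun _ => le_top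
    · have := key ε.toReal (ENNReal.toReal_pos hε.ne' hεt)
      rwa [ENNReal.ofReal_toReal hεt] at this

end Asymptotic

/-! ### Truncated geometric sums -/

/-- The nonzero terms are the tail of a geometric series whose first term is at most `t`; the
remainder `2 y / 2^J` of the series is kept for the induction. -/
theorem sum_truncated_inv_pow_le {y t : ℝ} (hy : 0 ≤ y) (J : ℕ) :
    ∑ j ∈ Finset.range J, (if y ≤ t * 2 ^ j then y * (2 ^ j)⁻¹ else 0) ≤
      max 0 (2 * t - 2 * (y * (2 ^ J)⁻¹)) := by
  induction J with
  | zero => simp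
  | succ J ih =>
    have h2 : (0 : ℝ) < 2 ^ J := by positivity
    have e : y * (2 ^ (J + 1))⁻¹ = y * (2 ^ J)⁻¹ / 2 := by rw [pow_succ]; field_simp
    have hy' : 0 ≤ y * (2 ^ J)⁻¹ := by positivity
    rw [Finset.sum_range_succ, e]
    split_ifs with h
    · have h3 : y * (2 ^ J)⁻¹ ≤ t := by rwa [← div_eq_mul_inv, div_le_iff₀ h2]
      rw [max_eq_right (by linarith)] at ih ⊢
      linarith
    · rw [add_zero]
      refine ih.trans (max_le_max le_rfl ?_)
      linarith

/-- The relation between the order `p` of the weak class and the integrability exponent `q` of the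
multiplier, for finite `q`. -/
def Admissible (p q : ℝ) : Prop :=
  (2 < p ∧ q = p) ∨ (p < 2 ∧ q = 2) ∨ (p = 2 ∧ 2 < q)

theorem Admissible.two_le {p q : ℝ} (h : Admissible p q) : 2 ≤ q := by
  rcases h with ⟨h1, rfl⟩ | ⟨_, rfl⟩ | ⟨_, h2⟩ <;> linarith

theorem geom_sum_le_inv {r : ℝ} (hr0 : 0 < r) (hr1 : r < 1) (J : ℕ) :
    ∑ j ∈ Finset.range J, r ^ j ≤ (1 - r)⁻¹ := by
  rw [geom_sum_eq hr1.ne, ← neg_div_neg_eq, neg_sub, neg_sub, div_eq_mul_inv]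
  exact mul_le_of_le_one_left (inv_nonneg.mpr (by linarith)) (by linarith [pow_pos hr0 J])

/-- For `p = q` the truncated sum is governed by its last term; for `p < q` the truncation is
absorbed into the factor `(y / 2^j)^(q - 2) ≥ 1` and the remaining series converges. -/
theorem exists_sum_truncated_rpow_le {p q : ℝ} (h : Admissible p q) :
    ∃ C : ℝ, 0 < C ∧ ∀ (y : ℝ), 0 ≤ y → ∀ J : ℕ,
      ∑ j ∈ Finset.range J, (if (2 : ℝ) ^ j < y then ((2 : ℝ) ^ j) ^ (p - 2) else 0) ≤
        C * y ^ (q - 2) := by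
  by_cases hpq : p < q
  · have hr1 : (2 : ℝ) ^ (p - q) < 1 := Real.rpow_lt_one_of_one_lt_of_neg one_lt_two (by linarith)
    have hr0 : (0 : ℝ) < 2 ^ (p - q) := by positivity
    refine ⟨(1 - 2 ^ (p - q))⁻¹, inv_pos.mpr (by linarith), fun y hy J => ?_⟩
    have h1 : ∀ j ∈ Finset.range J, (if (2 : ℝ) ^ j < y then ((2 : ℝ) ^ j) ^ (p - 2) else 0) ≤
        ((2 : ℝ) ^ (p - q)) ^ j * y ^ (q - 2) := by
      intro j _
      split_ifs with hj
      · have e : p - 2 = (p - q) + (q - 2) := by ring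
        have e' : ((2 : ℝ) ^ j) ^ (p - q) = ((2 : ℝ) ^ (p - q)) ^ j := by
          rw [← Real.rpow_natCast, ← Real.rpow_natCast, ← Real.rpow_mul zero_le_two,
            ← Real.rpow_mul zero_le_two, mul_comm]
        rw [e, Real.rpow_add (by positivity), e']
        have h2 : ((2 : ℝ) ^ j) ^ (q - 2) ≤ y ^ (q - 2) :=
          Real.rpow_le_rpow (by positivity) hj.le (by linarith [h.two_le])
        gcongr
      · positivity
    refine (Finset.sum_le_sum h1).trans ?_
    rw [← Finset.sum_mul]
    exact mul_le_mul_of_nonneg_right (geom_sum_le_inv hr0 hr1 J) (by positivity)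
  · have h2 : 2 < p ∧ q = p := by
      rcases h with h | ⟨h1, rfl⟩ | ⟨rfl, h2⟩
      · exact h
      · exact absurd h1 hpq
      · exact absurd h2 hpq
    obtain ⟨hp, rfl⟩ := h2
    set θ := q - 2 with hθ
    have hθ0 : 0 < θ := by linarith
    have ha1 : (1 : ℝ) < 2 ^ θ := Real.one_lt_rpow one_lt_two hθ0
    set C : ℝ := (1 - (2 ^ θ)⁻¹)⁻¹ with hC
    have hC0 : 0 < C := inv_pos.mpr (by have := inv_lt_one_of_one_lt₀ ha1; linarith)
    have hCe : C * (2 ^ θ)⁻¹ + 1 = C := by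
      have : (1 - (2 ^ θ)⁻¹) * C = 1 := mul_inv_cancel₀ (by
        have := inv_lt_one_of_one_lt₀ ha1; linarith)
      linarith
    refine ⟨C, hC0, fun y hy J => ?_⟩
    suffices hs : ∑ j ∈ Finset.range J, (if (2 : ℝ) ^ j < y then ((2 : ℝ) ^ j) ^ θ else 0) ≤
        C * (2 ^ θ)⁻¹ * (min (2 * y) (2 ^ J)) ^ θ by
      refine hs.trans ?_
      have h0 : (min (2 * y) ((2 : ℝ) ^ J)) ^ θ ≤ (2 * y) ^ θ :=
        Real.rpow_le_rpow (le_min (by positivity) (by positivity)) (min_le_left _ _) hθ0.le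
      calc _ ≤ C * (2 ^ θ)⁻¹ * (2 * y) ^ θ := by gcongr
        _ = _ := by
          rw [Real.mul_rpow zero_le_two hy]
          field_simp
    induction J with
    | zero =>
      rw [Finset.sum_range_zero]
      have : 0 ≤ min (2 * y) ((2 : ℝ) ^ 0) := le_min (by positivity) (by positivity)
      positivity
    | succ J ih =>
      rw [Finset.sum_range_succ]
      split_ifs with hj
      · rw [min_eq_right (by linarith)] at ih
        rw [min_eq_right (by rw [pow_succ]; linarith)]
        calc _ ≤ C * (2 ^ θ)⁻¹ * ((2 : ℝ) ^ J) ^ θ + ((2 : ℝ) ^ J) ^ θ := by gcongr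
          _ = C * ((2 : ℝ) ^ J) ^ θ := by rw [← add_one_mul, hCe]
          _ = _ := by
            rw [pow_succ, Real.mul_rpow (by positivity) zero_le_two]
            field_simp
      · rw [add_zero]
        refine ih.trans ?_
        have : 0 ≤ min (2 * y) ((2 : ℝ) ^ J) := le_min (by positivity) (by positivity)
        gcongr
        · exact one_le_two
        · exact Nat.le_succ J

/-! ### Finite rank operators with a given kernel -/

section Kernel

variable {d m : ℕ}

theorem RankLE.finset_sum {E F ι : Type*} [NormedAddCommGroup E] [InnerProductSpace ℂ E]
    [NormedAddCommGroup F] [InnerProductSpace ℂ F] (S : Finset ι) (A : ι → E →L[ℂ] F) (a : ι → ℝ)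
    (h : ∀ i ∈ S, RankLE (A i) (a i)) : RankLE (∑ i ∈ S, A i) (∑ i ∈ S, a i) := by
  classical
  induction S using Finset.induction_on with
  | empty => simpa using RankLE.zero
  | insert i S hi ih =>
    rw [Finset.sum_insert hi, Finset.sum_insert hi]
    exact (h i (Finset.mem_insert_self _ _)).add
      (ih fun j hj => h j (Finset.mem_insert_of_mem hj))

theorem memLp_smul_const {k : (Fin d → ℝ) → ℂ} (hk : MemLp k 2 (torusMeasure d))
    (c : EuclideanSpace ℂ (Fin m)) : MemLp (fun x => k x • c) 2 (torusMeasure d) :=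
  ((ContinuousLinearMap.id ℂ ℂ).smulRight c).comp_memLp' hk

/-- The map `c ↦ k(x) c` from `ℂ^m` to `L₂(𝕋^d, ℂ^m)`, for a scalar function `k ∈ L₂`. -/
noncomputable def smulMode (m : ℕ) (k : (Fin d → ℝ) → ℂ) (hk : MemLp k 2 (torusMeasure d)) :
    EuclideanSpace ℂ (Fin m) →L[ℂ] L2Torus d m :=
  LinearMap.toContinuousLinearMap
    { toFun := fun c => (memLp_smul_const hk c).toLp
      map_add' := fun c c' => by
        rw [← MemLp.toLp_add]
        exact MemLp.toLp_congr _ _ (ae_of_all _ fun x => smul_add _ _ _)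
      map_smul' := fun a c => by
        rw [RingHom.id_apply, ← MemLp.toLp_const_smul]
        exact MemLp.toLp_congr _ _ (ae_of_all _ fun x => smul_comm _ _ _) }

/-- The finite rank operator `u ↦ ∑_{n ∈ S} k(n, x) u(n)` from `ℓ₂(ℤ^d, ℂ^m)` to
`L₂(𝕋^d, ℂ^m)`. -/
noncomputable def kernelOp (m : ℕ) (k : (Fin d → ℤ) → (Fin d → ℝ) → ℂ)
    (hk : ∀ n, MemLp (k n) 2 (torusMeasure d)) (S : Finset (Fin d → ℤ)) :
    l2Lattice d m →L[ℂ] L2Torus d m :=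
  ∑ n ∈ S, smulMode m (k n) (hk n) ∘L
    lp.evalCLM ℂ (fun _ : Fin d → ℤ => EuclideanSpace ℂ (Fin m)) 2 n

variable {k : (Fin d → ℤ) → (Fin d → ℝ) → ℂ} {hk : ∀ n, MemLp (k n) 2 (torusMeasure d)}

theorem kernelOp_apply (S : Finset (Fin d → ℤ)) (u : l2Lattice d m) :
    kernelOp m k hk S u = ∑ n ∈ S, (memLp_smul_const (hk n) (u n)).toLp := by
  simp only [kernelOp, sum_apply]
  rfl

theorem ae_all_coeFn_toLp {ι X : Type*} [Countable ι] {E : Type*} [NormedAddCommGroup E]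
    [MeasurableSpace X] {μ : Measure X} {f : ι → X → E} (hf : ∀ i, MemLp (f i) 2 μ) :
    ∀ᵐ x ∂μ, ∀ i, (hf i).toLp (f i) x = f i x :=
  ae_all_iff.mpr fun i => (hf i).coeFn_toLp

theorem coeFn_kernelOp (S : Finset (Fin d → ℤ)) (u : l2Lattice d m) :
    kernelOp m k hk S u =ᵐ[torusMeasure d] fun x => ∑ n ∈ S, k n x • u n := by
  rw [kernelOp_apply]
  filter_upwards [Lp.coeFn_finsetSum S fun n => (memLp_smul_const (hk n) (u n)).toLp,
    ae_all_coeFn_toLp fun n => memLp_smul_const (hk n) (u n)] with x h1 h2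
  rw [h1]
  simp [h2]

theorem rankLE_kernelOp (S : Finset (Fin d → ℤ)) :
    RankLE (kernelOp m k hk S) (S.card * m) := by
  have h : (S.card * m : ℝ) = ∑ _n ∈ S, (m : ℝ) := by simp
  rw [h]
  refine RankLE.finset_sum S _ _ fun n _ => RankLE.comp_right _ ?_
  refine ⟨LinearMap.range (smulMode m (k n) (hk n) : EuclideanSpace ℂ (Fin m) →ₗ[ℂ] L2Torus d m),
    inferInstance, ?_, fun x => ⟨x, rfl⟩⟩
  have := LinearMap.finrank_range_le
    (smulMode m (k n) (hk n) : EuclideanSpace ℂ (Fin m) →ₗ[ℂ] L2Torus d m)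
  rw [finrank_euclideanSpace_fin] at this
  exact_mod_cast this

theorem norm_sq_eq_integral {X E : Type*} [MeasurableSpace X] {μ : Measure X}
    [NormedAddCommGroup E] [InnerProductSpace ℂ E] (f : Lp E 2 μ) :
    ‖f‖ ^ 2 = ∫ x, ‖f x‖ ^ 2 ∂μ := by
  have h : ⟪f, f⟫_ℂ = ∫ x, ⟪f x, f x⟫_ℂ ∂μ := L2.inner_def f f
  simp only [inner_self_eq_norm_sq_to_K] at h
  have h2 : ∫ x, ((‖f x‖ : ℂ)) ^ 2 ∂μ = ((∫ x, ‖f x‖ ^ 2 ∂μ : ℝ) : ℂ) := by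
    rw [← integral_complex_ofReal]; simp
  apply Complex.ofReal_injective
  rw [← h2]; push_cast; exact h

theorem integrable_norm_sq {X E : Type*} [MeasurableSpace X] {μ : Measure X}
    [NormedAddCommGroup E] {f : X → E} (hf : MemLp f 2 μ) : Integrable (fun x => ‖f x‖ ^ 2) μ :=
  (memLp_two_iff_integrable_sq_norm hf.1).mp hf

/-- Bessel's inequality at a fixed point `x` of the torus, with `a n = k(n, x)`. -/
theorem sum_norm_sq_sum_smul_le (S : Finset (Fin d → ℤ)) (a : (Fin d → ℤ) → ℂ) {N : ℕ}
    {v : Fin N → l2Lattice d m} (hv : Orthonormal ℂ v) :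
    ∑ i, ‖∑ n ∈ S, a n • v i n‖ ^ 2 ≤ m * ∑ n ∈ S, ‖a n‖ ^ 2 := by
  classical
  let z : Fin m → l2Lattice d m := fun j =>
    ∑ n ∈ S, lp.single 2 n ((starRingEnd ℂ) (a n) • EuclideanSpace.single j (1 : ℂ))
  have hz : ∀ j i, ⟪z j, v i⟫_ℂ = (∑ n ∈ S, a n • v i n) j := by
    intro j i
    rw [sum_inner]
    simp only [lp.inner_single_left, inner_smul_left, EuclideanSpace.inner_single_left]
    simp
  have hzn : ∀ j, ‖z j‖ ^ 2 = ∑ n ∈ S, ‖a n‖ ^ 2 := by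
    intro j
    have := lp.norm_sum_single (E := fun _ : Fin d → ℤ => EuclideanSpace ℂ (Fin m)) (p := 2)
      (by simp) (fun n => (starRingEnd ℂ) (a n) • EuclideanSpace.single j (1 : ℂ)) S
    simp only [ENNReal.toReal_ofNat, Real.rpow_ofNat, norm_smul, RCLike.norm_conj,
      PiLp.norm_single, norm_one, mul_one] at this
    exact this
  calc _ = ∑ i, ∑ j, ‖⟪v i, z j⟫_ℂ‖ ^ 2 := by
        refine Finset.sum_congr rfl fun i _ => ?_
        rw [EuclideanSpace.norm_sq_eq]
        refine Finset.sum_congr rfl fun j _ => ?_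
        rw [← hz, norm_inner_symm]
    _ = ∑ j, ∑ i, ‖⟪v i, z j⟫_ℂ‖ ^ 2 := Finset.sum_comm
    _ ≤ ∑ j : Fin m, ∑ n ∈ S, ‖a n‖ ^ 2 := by
        refine Finset.sum_le_sum fun j _ => ?_
        rw [← hzn j]
        exact hv.sum_inner_products_le _
    _ = _ := by simp

theorem hsBound_kernelOp (S : Finset (Fin d → ℤ)) :
    HSBound (kernelOp m k hk S) (m * ∑ n ∈ S, ∫ x, ‖k n x‖ ^ 2 ∂(torusMeasure d)) := by
  intro N v hv
  have hint : ∀ n ∈ S, Integrable (fun x => ‖k n x‖ ^ 2) (torusMeasure d) :=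
    fun n _ => integrable_norm_sq (hk n)
  simp_rw [norm_sq_eq_integral]
  rw [← integral_finsetSum _ fun i _ => integrable_norm_sq (Lp.memLp _),
    ← integral_finsetSum _ hint, ← integral_const_mul]
  refine integral_mono_ae (integrable_finsetSum _ fun i _ => integrable_norm_sq (Lp.memLp _))
    ((integrable_finsetSum _ hint).const_mul _) ?_
  filter_upwards [ae_all_iff.mpr fun i => coeFn_kernelOp (hk := hk) S (v i)] with x hx
  simp only [hx]
  exact sum_norm_sq_sum_smul_le S (fun n => k n x) hv

end Kernel

/-! ### The weighted operator with a dyadic weight -/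

/-- A partition of `ℤ^d` into finite dyadic levels: at most `K 2^{Lp}` lattice points have level
less than `L`. The associated weight `2^{-level}` belongs to the weak space `ℓ_{p,∞}`. -/
structure LevelFunction (d : ℕ) (p K : ℝ) where
  /-- the level of a lattice point -/
  level : (Fin d → ℤ) → ℕ
  /-- the lattice points of level less than `L` -/
  below : ℕ → Finset (Fin d → ℤ)
  mem_below : ∀ L n, n ∈ below L ↔ level n < L
  card_below : ∀ L, ((below L).card : ℝ) ≤ K * ((2 : ℝ) ^ L) ^ p

/-- The part of `g` where `‖g‖ ≤ c`. -/
noncomputable def smallPart {X : Type*} (g : X → ℂ) (c : ℝ) (x : X) : ℂ :=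
  if ‖g x‖ ≤ c then g x else 0

/-- The part of `g` where `‖g‖ > c`. -/
noncomputable def largePart {X : Type*} (g : X → ℂ) (c : ℝ) (x : X) : ℂ :=
  if ‖g x‖ ≤ c then 0 else g x

theorem smallPart_add_largePart {X : Type*} (g : X → ℂ) (c : ℝ) (x : X) :
    smallPart g c x + largePart g c x = g x := by
  unfold smallPart largePart
  split_ifs <;> simp

theorem memLp_smallPart {X : Type*} [MeasurableSpace X] {μ : Measure X} {g : X → ℂ}
    (hg : MemLp g 2 μ) (c : ℝ) : MemLp (smallPart g c) 2 μ := by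
  have h : NullMeasurableSet {x | ‖g x‖ ≤ c} μ :=
    nullMeasurableSet_le hg.1.norm.aemeasurable aemeasurable_const
  have e : smallPart g c = {x | ‖g x‖ ≤ c}.indicator g := by
    funext x; simp [smallPart, Set.indicator_apply]
  refine hg.mono (e ▸ hg.1.indicator₀ h) (ae_of_all _ fun x => ?_)
  unfold smallPart
  split_ifs <;> simp

theorem memLp_largePart {X : Type*} [MeasurableSpace X] {μ : Measure X} {g : X → ℂ}
    (hg : MemLp g 2 μ) (c : ℝ) : MemLp (largePart g c) 2 μ := by
  have e : largePart g c = g - smallPart g c := by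
    funext x; rw [Pi.sub_apply, ← smallPart_add_largePart g c x]; ring
  rw [e]
  exact hg.sub (memLp_smallPart hg c)

namespace LevelFunction

variable {d m : ℕ} {p K : ℝ} (ℓ : LevelFunction d p K)

theorem K_nonneg (ℓ : LevelFunction d p K) : 0 ≤ K := by
  have h := ℓ.card_below 0
  rw [pow_zero, Real.one_rpow, mul_one] at h
  exact (Nat.cast_nonneg _).trans h

/-- The lattice points whose level is in `[L, Λ)`. -/
def between (L Λ : ℕ) : Finset (Fin d → ℤ) := (ℓ.below Λ).filter fun n => L ≤ ℓ.level n

theorem mem_between {L Λ : ℕ} {n : Fin d → ℤ} :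
    n ∈ ℓ.between L Λ ↔ L ≤ ℓ.level n ∧ ℓ.level n < Λ := by
  rw [between, Finset.mem_filter, ℓ.mem_below, and_comm]

/-- The kernel `2^{-level n} G(n, x) φ_n(x)`, where `φ_n` is the normalised exponential. -/
noncomputable def kernel (G : (Fin d → ℤ) → (Fin d → ℝ) → ℂ) (n : Fin d → ℤ) (x : Fin d → ℝ) : ℂ :=
  ((2 : ℂ) ^ ℓ.level n)⁻¹ * (G n x * fourierExp n x)

theorem memLp_kernel {G : (Fin d → ℤ) → (Fin d → ℝ) → ℂ}
    (hG : ∀ n, MemLp (G n) 2 (torusMeasure d)) (n : Fin d → ℤ) :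
    MemLp (ℓ.kernel G n) 2 (torusMeasure d) := by
  refine MemLp.const_mul ?_ _
  refine MemLp.of_le_mul (c := (2 * Real.pi) ^ (-(d : ℝ) / 2)) (hG n)
    ((hG n).1.mul (continuous_fourierExp n).aestronglyMeasurable) (ae_of_all _ fun x => ?_)
  rw [norm_mul, norm_fourierExp, mul_comm]

/-- The operator `u ↦ ∑ 2^{-level n} g(x) φ_n(x) u(n)`, the sum being over `n ∈ S`. -/
noncomputable def partialOp (m : ℕ) {g : (Fin d → ℝ) → ℂ} (hg : MemLp g 2 (torusMeasure d))
    (S : Finset (Fin d → ℤ)) : l2Lattice d m →L[ℂ] L2Torus d m :=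
  kernelOp m (ℓ.kernel fun _ => g) (ℓ.memLp_kernel fun _ => hg) S

/-- The part of `partialOp` where `‖g(x)‖ ≤ t 2^{level n}`. -/
noncomputable def smallOp (m : ℕ) {g : (Fin d → ℝ) → ℂ} (hg : MemLp g 2 (torusMeasure d)) (t : ℝ)
    (S : Finset (Fin d → ℤ)) : l2Lattice d m →L[ℂ] L2Torus d m :=
  kernelOp m (ℓ.kernel fun n => smallPart g (t * 2 ^ ℓ.level n))
    (ℓ.memLp_kernel fun _ => memLp_smallPart hg _) S

/-- The part of `partialOp` where `‖g(x)‖ > t 2^{level n}`. -/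
noncomputable def largeOp (m : ℕ) {g : (Fin d → ℝ) → ℂ} (hg : MemLp g 2 (torusMeasure d)) (t : ℝ)
    (S : Finset (Fin d → ℤ)) : l2Lattice d m →L[ℂ] L2Torus d m :=
  kernelOp m (ℓ.kernel fun n => largePart g (t * 2 ^ ℓ.level n))
    (ℓ.memLp_kernel fun _ => memLp_largePart hg _) S

theorem partialOp_eq {g : (Fin d → ℝ) → ℂ} (hg : MemLp g 2 (torusMeasure d)) (t : ℝ)
    (S : Finset (Fin d → ℤ)) :
    ℓ.partialOp m hg S = ℓ.smallOp m hg t S + ℓ.largeOp m hg t S := by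
  ext1 u
  apply Lp.ext
  rw [add_apply]
  unfold partialOp smallOp largeOp
  filter_upwards [Lp.coeFn_add (kernelOp m (ℓ.kernel fun n => smallPart g (t * 2 ^ ℓ.level n))
      (ℓ.memLp_kernel fun _ => memLp_smallPart hg _) S u)
      (kernelOp m (ℓ.kernel fun n => largePart g (t * 2 ^ ℓ.level n))
      (ℓ.memLp_kernel fun _ => memLp_largePart hg _) S u),
    coeFn_kernelOp (hk := ℓ.memLp_kernel fun _ => hg) S u,
    coeFn_kernelOp (hk := ℓ.memLp_kernel fun n => memLp_smallPart hg (t * 2 ^ ℓ.level n)) S u,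
    coeFn_kernelOp (hk := ℓ.memLp_kernel fun n => memLp_largePart hg (t * 2 ^ ℓ.level n)) S u]
    with x h1 h2 h3 h4
  rw [h1, Pi.add_apply, h2, h3, h4, ← Finset.sum_add_distrib]
  refine Finset.sum_congr rfl fun n _ => ?_
  rw [← add_smul]
  congr 1
  unfold kernel
  rw [← mul_add, ← add_mul, smallPart_add_largePart]

/-- The pointwise Schur test. With `V_l` the component of the Fourier series on the level `l`, the
Cauchy–Schwarz inequality with the weights `2^{-l} |g(x)| ≤ t`, whose sum is at most `2 t`, gives
`|B u(x)|² ≤ 2 t² ∑ |V_l(x)|²`. -/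
theorem norm_smallOp_apply_le {g : (Fin d → ℝ) → ℂ} (hg : MemLp g 2 (torusMeasure d)) {t : ℝ}
    (ht : 0 ≤ t) (L Λ : ℕ) (u : l2Lattice d m) :
    ‖ℓ.smallOp m hg t (ℓ.between L Λ) u‖ ≤ 2 * t * ‖u‖ := by
  classical
  set S := ℓ.between L Λ with hS
  let V : ℕ → L2Torus d m := fun l =>
    ∑ n ∈ S.filter (fun n => ℓ.level n = l), fourierMode m n (u n)
  have hmaps : ∀ n ∈ S, ℓ.level n ∈ Finset.range Λ := fun n hn =>
    Finset.mem_range.mpr (ℓ.mem_between.mp hn).2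
  have hVsum : ∑ l ∈ Finset.range Λ, ‖V l‖ ^ 2 ≤ ‖u‖ ^ 2 := by
    have h1 : ∀ l, ‖V l‖ ^ 2 = ∑ n ∈ S.filter (fun n => ℓ.level n = l), ‖u n‖ ^ 2 := fun l =>
      (orthogonalFamily_fourierMode d m).norm_sum (fun n => u n) _
    simp_rw [h1]
    rw [Finset.sum_fiberwise_of_maps_to hmaps]
    have := lp.sum_rpow_le_norm_rpow (p := 2) (by simp) u S
    simpa using this
  have hVx : ∀ᵐ x ∂(torusMeasure d), ∀ l, V l x =
      ∑ n ∈ S.filter (fun n => ℓ.level n = l), fourierExp n x • u n := by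
    rw [ae_all_iff]
    intro l
    filter_upwards [Lp.coeFn_finsetSum (S.filter (fun n => ℓ.level n = l))
      fun n => fourierMode m n (u n),
      ae_all_coeFn_toLp fun n => memLp_fourierExp_smul n (u n)] with x h1 h2
    rw [h1, Finset.sum_apply]
    exact Finset.sum_congr rfl fun n _ => h2 n
  have hpt : ∀ᵐ x ∂(torusMeasure d), ‖ℓ.smallOp m hg t S u x‖ ^ 2 ≤
      2 * t * t * ∑ l ∈ Finset.range Λ, ‖V l x‖ ^ 2 := by
    filter_upwards [hVx, coeFn_kernelOp
      (hk := ℓ.memLp_kernel fun n => memLp_smallPart hg (t * 2 ^ ℓ.level n)) S u] with x h1 h2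
    let a : ℕ → ℝ := fun l => if ‖g x‖ ≤ t * 2 ^ l then ‖g x‖ * (2 ^ l)⁻¹ else 0
    have ha0 : ∀ l, 0 ≤ a l := by
      intro l
      change 0 ≤ if ‖g x‖ ≤ t * 2 ^ l then ‖g x‖ * (2 ^ l)⁻¹ else 0
      split_ifs <;> positivity
    have hat : ∀ l, a l ≤ t := by
      intro l
      change (if ‖g x‖ ≤ t * 2 ^ l then ‖g x‖ * (2 ^ l)⁻¹ else 0) ≤ t
      split_ifs with h
      · rwa [← div_eq_mul_inv, div_le_iff₀ (by positivity)]
      · exact ht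
    have hasum : ∑ l ∈ Finset.range Λ, a l ≤ 2 * t := by
      refine (sum_truncated_inv_pow_le (norm_nonneg _) Λ).trans (max_le (by positivity) ?_)
      have : 0 ≤ ‖g x‖ * (2 ^ Λ)⁻¹ := by positivity
      linarith
    have hB : ℓ.smallOp m hg t S u x = ∑ l ∈ Finset.range Λ,
        (((2 : ℂ) ^ l)⁻¹ * smallPart g (t * 2 ^ l) x) • V l x := by
      refine h2.trans ?_
      rw [← Finset.sum_fiberwise_of_maps_to hmaps]
      refine Finset.sum_congr rfl fun l _ => ?_
      rw [h1, Finset.smul_sum]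
      refine Finset.sum_congr rfl fun n hn => ?_
      rw [smul_smul, kernel, (Finset.mem_filter.mp hn).2, mul_assoc]
    have hna : ∀ l, ‖((2 : ℂ) ^ l)⁻¹ * smallPart g (t * 2 ^ l) x‖ = a l := by
      intro l
      change _ = if ‖g x‖ ≤ t * 2 ^ l then ‖g x‖ * (2 ^ l)⁻¹ else 0
      rw [norm_mul, norm_inv, norm_pow, Complex.norm_ofNat]
      unfold smallPart
      split_ifs
      · rw [mul_comm]
      · simp
    have h3 : ‖ℓ.smallOp m hg t S u x‖ ≤ ∑ l ∈ Finset.range Λ, a l * ‖V l x‖ := by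
      rw [hB]
      refine (norm_sum_le _ _).trans (Finset.sum_le_sum fun l _ => ?_)
      rw [norm_smul, hna]
    calc ‖ℓ.smallOp m hg t S u x‖ ^ 2 ≤ (∑ l ∈ Finset.range Λ, a l * ‖V l x‖) ^ 2 :=
          pow_le_pow_left₀ (norm_nonneg _) h3 2
      _ ≤ (∑ l ∈ Finset.range Λ, a l) * ∑ l ∈ Finset.range Λ, a l * ‖V l x‖ ^ 2 :=
          Finset.sum_sq_le_sum_mul_sum_of_sq_le_mul _ (fun l _ => ha0 l)
            (fun l _ => mul_nonneg (ha0 l) (sq_nonneg _)) (fun l _ => le_of_eq (by ring))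
      _ ≤ (2 * t) * ∑ l ∈ Finset.range Λ, t * ‖V l x‖ ^ 2 := by
          refine mul_le_mul hasum (Finset.sum_le_sum fun l _ => ?_)
            (Finset.sum_nonneg fun l _ => mul_nonneg (ha0 l) (sq_nonneg _)) (by positivity)
          exact mul_le_mul_of_nonneg_right (hat l) (sq_nonneg _)
      _ = _ := by rw [← Finset.mul_sum]; ring
  have hsq : ‖ℓ.smallOp m hg t S u‖ ^ 2 ≤ 2 * t * t * ‖u‖ ^ 2 := by
    have hint : ∀ l ∈ Finset.range Λ, Integrable (fun x => ‖V l x‖ ^ 2) (torusMeasure d) :=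
      fun l _ => integrable_norm_sq (Lp.memLp _)
    rw [norm_sq_eq_integral]
    refine (integral_mono_ae (integrable_norm_sq (Lp.memLp _))
      ((integrable_finsetSum _ hint).const_mul (2 * t * t)) hpt).trans ?_
    rw [integral_const_mul, integral_finsetSum _ hint]
    simp_rw [← norm_sq_eq_integral]
    gcongr
  refine le_of_sq_le_sq ?_ (by positivity)
  nlinarith [mul_nonneg (mul_nonneg ht ht) (sq_nonneg ‖u‖)]

/-- The contribution of the level `l` to the Hilbert–Schmidt norm of `largeOp`, up to a constant. -/
noncomputable def largeMass (p : ℝ) (g : (Fin d → ℝ) → ℂ) (t : ℝ) (l : ℕ) : ℝ :=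
  ((2 : ℝ) ^ l) ^ (p - 2) * ∫ x, ‖largePart g (t * 2 ^ l) x‖ ^ 2 ∂(torusMeasure d)

theorem largeMass_nonneg (g : (Fin d → ℝ) → ℂ) (t : ℝ) (l : ℕ) : 0 ≤ largeMass p g t l :=
  mul_nonneg (by positivity) (integral_nonneg fun x => sq_nonneg _)

theorem hsBound_largeOp {g : (Fin d → ℝ) → ℂ} (hg : MemLp g 2 (torusMeasure d)) (t : ℝ)
    (L Λ : ℕ) :
    HSBound (ℓ.largeOp m hg t (ℓ.between L Λ))
      (m * K * 2 ^ p * ((2 * Real.pi) ^ (-(d : ℝ) / 2)) ^ 2 *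
        ∑ l ∈ Finset.Ico L Λ, largeMass p g t l) := by
  classical
  set κ : ℝ := (2 * Real.pi) ^ (-(d : ℝ) / 2) with hκ
  refine HSBound.mono (hsBound_kernelOp _) ?_
  have hmaps : ∀ n ∈ ℓ.between L Λ, ℓ.level n ∈ Finset.Ico L Λ := fun n hn =>
    Finset.mem_Ico.mpr (ℓ.mem_between.mp hn)
  rw [← Finset.sum_fiberwise_of_maps_to hmaps, mul_assoc, mul_assoc, mul_assoc]
  refine mul_le_mul_of_nonneg_left ?_ (Nat.cast_nonneg m)
  rw [← mul_assoc, ← mul_assoc, Finset.mul_sum]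
  refine Finset.sum_le_sum fun l _ => ?_
  set I := ∫ x, ‖largePart g (t * 2 ^ l) x‖ ^ 2 ∂(torusMeasure d) with hI
  have hI0 : 0 ≤ I := integral_nonneg fun x => sq_nonneg _
  have h1 : ∀ n ∈ (ℓ.between L Λ).filter (fun n => ℓ.level n = l),
      ∫ x, ‖ℓ.kernel (fun n => largePart g (t * 2 ^ ℓ.level n)) n x‖ ^ 2 ∂(torusMeasure d) =
        ((2 ^ l)⁻¹) ^ 2 * κ ^ 2 * I := by
    intro n hn
    rw [hI, ← integral_const_mul]
    congr 1
    funext x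
    rw [kernel, (Finset.mem_filter.mp hn).2, norm_mul, norm_mul, norm_fourierExp, norm_inv,
      norm_pow, Complex.norm_ofNat]
    ring
  rw [Finset.sum_congr rfl h1, Finset.sum_const, nsmul_eq_mul]
  have h2 : ((((ℓ.between L Λ).filter (fun n => ℓ.level n = l)).card : ℕ) : ℝ) ≤
      K * ((2 : ℝ) ^ (l + 1)) ^ p := by
    refine le_trans ?_ (ℓ.card_below (l + 1))
    have : (ℓ.between L Λ).filter (fun n => ℓ.level n = l) ⊆ ℓ.below (l + 1) := by
      intro n hn
      rw [ℓ.mem_below, (Finset.mem_filter.mp hn).2]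
      exact Nat.lt_succ_self l
    exact_mod_cast Finset.card_le_card this
  refine (mul_le_mul_of_nonneg_right h2 (by positivity)).trans (le_of_eq ?_)
  have e1 : ((2 : ℝ) ^ (l + 1)) ^ p = ((2 : ℝ) ^ l) ^ p * 2 ^ p := by
    rw [pow_succ, Real.mul_rpow (by positivity) zero_le_two]
  have e2 : ((2 : ℝ) ^ l) ^ (p - 2) = ((2 : ℝ) ^ l) ^ p * ((2 ^ l)⁻¹) ^ 2 := by
    rw [Real.rpow_sub (by positivity), Real.rpow_two]
    field_simp
  rw [largeMass, ← hI, e1, e2]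
  ring

theorem sum_largeMass_le {q C : ℝ} (hpq : Admissible p q)
    (hC : ∀ (y : ℝ), 0 ≤ y → ∀ J : ℕ,
      ∑ j ∈ Finset.range J, (if (2 : ℝ) ^ j < y then ((2 : ℝ) ^ j) ^ (p - 2) else 0) ≤
        C * y ^ (q - 2))
    {g : (Fin d → ℝ) → ℂ} (hg : MemLp g 2 (torusMeasure d))
    (hgq : Integrable (fun x => ‖g x‖ ^ q) (torusMeasure d)) {t : ℝ} (ht : 0 < t) (L Λ : ℕ) :
    ∑ l ∈ Finset.Ico L Λ, largeMass p g t l ≤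
      C * ((2 : ℝ) ^ L) ^ (p - 2) * (t * 2 ^ L) ^ (2 - q) * ∫ x, ‖g x‖ ^ q ∂(torusMeasure d) := by
  have hint : ∀ l, Integrable (fun x => ((2 : ℝ) ^ l) ^ (p - 2) * ‖largePart g (t * 2 ^ l) x‖ ^ 2)
      (torusMeasure d) := fun l => (integrable_norm_sq (memLp_largePart hg _)).const_mul _
  simp only [largeMass, ← integral_const_mul]
  rw [← integral_finsetSum _ fun l _ => hint l]
  refine integral_mono (integrable_finsetSum _ fun l _ => hint l) (hgq.const_mul _) fun x => ?_
  dsimp only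
  set y := ‖g x‖ with hy
  have hy0 : 0 ≤ y := norm_nonneg _
  set r : ℝ := t * 2 ^ L with hr
  have hr0 : 0 < r := by positivity
  rw [Finset.sum_Ico_eq_sum_range]
  have h1 : ∀ j ∈ Finset.range (Λ - L),
      ((2 : ℝ) ^ (L + j)) ^ (p - 2) * ‖largePart g (t * 2 ^ (L + j)) x‖ ^ 2 =
      ((2 : ℝ) ^ L) ^ (p - 2) * y ^ 2 *
        (if (2 : ℝ) ^ j < y / r then ((2 : ℝ) ^ j) ^ (p - 2) else 0) := by
    intro j _
    have e : t * 2 ^ (L + j) = r * 2 ^ j := by rw [hr, pow_add]; ring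
    have e2 : (2 : ℝ) ^ j < y / r ↔ ¬ y ≤ r * 2 ^ j := by
      rw [lt_div_iff₀ hr0, not_le, mul_comm]
    rw [e, pow_add, Real.mul_rpow (by positivity) (by positivity)]
    unfold largePart
    by_cases h : y ≤ r * 2 ^ j
    · rw [if_pos h, if_neg (by rwa [e2, not_not])]
      simp
    · rw [if_neg h, if_pos (e2.mpr h)]
      ring
  rw [Finset.sum_congr rfl h1, ← Finset.mul_sum]
  refine (mul_le_mul_of_nonneg_left (hC (y / r) (by positivity) _) (by positivity)).trans
    (le_of_eq ?_)
  have e3 : y ^ 2 * y ^ (q - 2) = y ^ q := by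
    rcases hy0.eq_or_lt with h0 | h0
    · rw [← h0, Real.zero_rpow (by linarith [hpq.two_le] : q ≠ 0)]
      simp
    · rw [← Real.rpow_two, ← Real.rpow_add h0]
      congr 1; ring
  have e4 : r ^ (2 - q) = (r ^ (q - 2))⁻¹ := by
    rw [← Real.rpow_neg hr0.le]; congr 1; ring
  rw [Real.div_rpow hy0 hr0.le, ← e3, e4]
  ring

theorem norm_weight_le (n : Fin d → ℤ) :
    ‖((2 : ℂ) ^ ℓ.level n)⁻¹ • ContinuousLinearMap.id ℂ (EuclideanSpace ℂ (Fin m))‖ ≤ 1 := by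
  rw [norm_smul, norm_inv, norm_pow, Complex.norm_ofNat]
  refine mul_le_one₀ ?_ (norm_nonneg _) ContinuousLinearMap.norm_id_le
  exact inv_le_one_of_one_le₀ (one_le_pow₀ one_le_two)

/-- Multiplication by the weight `2^{-level}` in `ℓ₂(ℤ^d, ℂ^m)`. -/
noncomputable def weightOp (m : ℕ) : l2Lattice d m →L[ℂ] l2Lattice d m :=
  lp.mapCLM 2 (fun n => ((2 : ℂ) ^ ℓ.level n)⁻¹ •
    ContinuousLinearMap.id ℂ (EuclideanSpace ℂ (Fin m))) zero_le_one ℓ.norm_weight_le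

theorem weightOp_apply (u : l2Lattice d m) (n : Fin d → ℤ) :
    ℓ.weightOp m u n = ((2 : ℂ) ^ ℓ.level n)⁻¹ • u n := rfl

/-- `T` is the product of the multiplication by the scalar function `g`, the Fourier transform and
the multiplication by the weight `2^{-level}`. For unbounded `g` this product is an everywhere
defined operator only by virtue of the decay of the weight. -/
def IsWeightedMul (g : (Fin d → ℝ) → ℂ) (T : l2Lattice d m →L[ℂ] L2Torus d m) : Prop :=
  ∀ u, T u =ᵐ[torusMeasure d] fun x => g x • fourier d m (ℓ.weightOp m u) x

theorem tendsto_sum_fourierMode_below (u : l2Lattice d m) :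
    Tendsto (fun Λ => ∑ n ∈ ℓ.below Λ, fourierMode m n (u n)) atTop (𝓝 (fourier d m u)) := by
  have h : Tendsto ℓ.below atTop atTop := by
    refine tendsto_atTop_finset_of_monotone ?_ fun n => ⟨ℓ.level n + 1, ?_⟩
    · intro a b hab n hn
      rw [ℓ.mem_below] at hn ⊢
      omega
    · rw [ℓ.mem_below]; omega
  exact ((orthogonalFamily_fourierMode d m).hasSum_linearIsometry u).comp h

/-- A norm limit of the truncated operators is the full product: both sides are a.e. limits along a
subsequence. -/
theorem isWeightedMul_of_tendsto {g : (Fin d → ℝ) → ℂ} (hg : MemLp g 2 (torusMeasure d))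
    {T : l2Lattice d m →L[ℂ] L2Torus d m}
    (hT : Tendsto (fun Λ => ℓ.partialOp m hg (ℓ.below Λ)) atTop (𝓝 T)) : ℓ.IsWeightedMul g T := by
  intro u
  have h1 : Tendsto (fun Λ => ℓ.partialOp m hg (ℓ.below Λ) u) atTop (𝓝 (T u)) :=
    ((ContinuousLinearMap.apply ℂ (L2Torus d m) u).continuous.tendsto T).comp hT
  obtain ⟨ns, hns, h2⟩ := (tendstoInMeasure_of_tendsto_Lp h1).exists_seq_tendsto_ae
  have h3 := (ℓ.tendsto_sum_fourierMode_below (ℓ.weightOp m u)).comp hns.tendsto_atTop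
  obtain ⟨ns', hns', h4⟩ := (tendstoInMeasure_of_tendsto_Lp h3).exists_seq_tendsto_ae
  have h5 : ∀ᵐ x ∂(torusMeasure d), ∀ Λ, ℓ.partialOp m hg (ℓ.below Λ) u x =
      g x • (∑ n ∈ ℓ.below Λ, fourierMode m n (ℓ.weightOp m u n) : L2Torus d m) x := by
    rw [ae_all_iff]
    intro Λ
    filter_upwards [coeFn_kernelOp (hk := ℓ.memLp_kernel fun _ => hg) (ℓ.below Λ) u,
      Lp.coeFn_finsetSum (ℓ.below Λ) fun n => fourierMode m n (ℓ.weightOp m u n),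
      ae_all_coeFn_toLp fun n => memLp_fourierExp_smul n (ℓ.weightOp m u n)] with x h6 h7 h8
    rw [h7, Finset.sum_apply, Finset.smul_sum]
    refine h6.trans (Finset.sum_congr rfl fun n _ => ?_)
    have h9 : (fourierMode m n (ℓ.weightOp m u n)) x = fourierExp n x • ℓ.weightOp m u n := h8 n
    rw [h9, weightOp_apply, smul_smul, smul_smul, kernel]
    congr 1
    ring
  filter_upwards [h2, h4, h5] with x h2 h4 h5
  have h6 := h2.comp hns'.tendsto_atTop
  refine tendsto_nhds_unique h6 ?_
  have h7 := h4.const_smul (g x)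
  refine h7.congr fun i => ?_
  simp only [Function.comp_apply]
  rw [h5]

theorem partialOp_sub_partialOp {g : (Fin d → ℝ) → ℂ} (hg : MemLp g 2 (torusMeasure d))
    {L Λ : ℕ} (h : L ≤ Λ) :
    ℓ.partialOp m hg (ℓ.below Λ) - ℓ.partialOp m hg (ℓ.below L) =
      ℓ.partialOp m hg (ℓ.between L Λ) := by
  classical
  have e : ℓ.between L Λ = ℓ.below Λ \ ℓ.below L := by
    ext n
    rw [ℓ.mem_between, Finset.mem_sdiff, ℓ.mem_below, ℓ.mem_below]
    omega
  have hsub : ℓ.below L ⊆ ℓ.below Λ := by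
    intro n hn
    rw [ℓ.mem_below] at hn ⊢
    omega
  rw [e, sub_eq_iff_eq_add]
  exact (Finset.sum_sdiff hsub).symm

theorem cauchySeq_partialOp {q : ℝ} (hpq : Admissible p q) {g : (Fin d → ℝ) → ℂ}
    (hg : MemLp g 2 (torusMeasure d))
    (hgq : Integrable (fun x => ‖g x‖ ^ q) (torusMeasure d)) :
    CauchySeq fun Λ => ℓ.partialOp m hg (ℓ.below Λ) := by
  obtain ⟨C, hC0, hC⟩ := exists_sum_truncated_rpow_le hpq
  rw [Metric.cauchySeq_iff']
  intro ε hε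
  set t := ε / 8 with ht
  have ht0 : 0 < t := by positivity
  set c : ℝ := m * K * 2 ^ p * ((2 * Real.pi) ^ (-(d : ℝ) / 2)) ^ 2 with hc
  have hc0 : 0 ≤ c := by
    have := ℓ.K_nonneg
    positivity
  have hsum : Summable (largeMass p g t) := by
    refine summable_of_sum_range_le (c := C * ((2 : ℝ) ^ 0) ^ (p - 2) * (t * 2 ^ 0) ^ (2 - q) *
      ∫ x, ‖g x‖ ^ q ∂(torusMeasure d)) (largeMass_nonneg g t) fun J => ?_
    rw [Finset.range_eq_Ico]
    exact sum_largeMass_le hpq hC hg hgq ht0 0 J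
  have hcs := hsum.hasSum.tendsto_sum_nat.cauchySeq
  obtain ⟨N, hN⟩ := Metric.cauchySeq_iff'.mp hcs ((ε / 4) ^ 2 / (c + 1)) (by positivity)
  refine ⟨N, fun Λ hΛ => ?_⟩
  rw [dist_eq_norm, ℓ.partialOp_sub_partialOp hg hΛ, ℓ.partialOp_eq hg t]
  have hN' := hN Λ hΛ
  rw [Real.dist_eq, ← Finset.sum_Ico_eq_sub _ hΛ,
    abs_of_nonneg (Finset.sum_nonneg fun l _ => largeMass_nonneg g t l),
    lt_div_iff₀ (by positivity)] at hN'
  have hH : √(c * ∑ l ∈ Finset.Ico N Λ, largeMass p g t l) ≤ ε / 4 := by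
    refine Real.sqrt_le_iff.mpr ⟨by positivity, ?_⟩
    have : 0 ≤ ∑ l ∈ Finset.Ico N Λ, largeMass p g t l :=
      Finset.sum_nonneg fun l _ => largeMass_nonneg g t l
    nlinarith
  refine lt_of_le_of_lt (ContinuousLinearMap.opNorm_le_bound _ (M := ε / 2) (by positivity)
    fun u => ?_) (half_lt_self hε)
  rw [add_apply]
  refine (norm_add_le _ _).trans ?_
  have h1 := ℓ.norm_smallOp_apply_le hg ht0.le N Λ u
  have h2 := (ℓ.hsBound_largeOp (m := m) hg t N Λ).norm_apply_le u
  have h3 : √(c * ∑ l ∈ Finset.Ico N Λ, largeMass p g t l) * ‖u‖ ≤ ε / 4 * ‖u‖ := by gcongr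
  have h4 : 2 * t * ‖u‖ = ε / 4 * ‖u‖ := by rw [ht]; ring
  linarith

/-- The weighted operator is defined for `g ∈ L_q`. At the scale `s = 2^{-L}` the levels below `L`
form the finite rank part, and the remaining levels are split at the threshold
`‖g(x)‖ = s 2^{level n}`. -/
theorem exists_isWeightedMul {q : ℝ} (hpq : Admissible p q) :
    ∃ c : ℝ, 0 < c ∧ ∀ g : (Fin d → ℝ) → ℂ, MemLp g 2 (torusMeasure d) →
      Integrable (fun x => ‖g x‖ ^ q) (torusMeasure d) →
      ∃ T : l2Lattice d m →L[ℂ] L2Torus d m, ℓ.IsWeightedMul g T ∧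
        ∀ L : ℕ, Approx T (4 * (2 ^ L)⁻¹)
          (c * (1 + ∫ x, ‖g x‖ ^ q ∂(torusMeasure d)) * ((2 : ℝ) ^ L) ^ p) := by
  obtain ⟨C, hC0, hC⟩ := exists_sum_truncated_rpow_le hpq
  set c₀ : ℝ := m * K * 2 ^ p * ((2 * Real.pi) ^ (-(d : ℝ) / 2)) ^ 2 with hc
  have hK := ℓ.K_nonneg
  have hc0 : 0 ≤ c₀ := by positivity
  refine ⟨m * K + c₀ * C + 1, by positivity, fun g hg hgq => ?_⟩
  obtain ⟨T, hT⟩ := cauchySeq_tendsto_of_complete (ℓ.cauchySeq_partialOp (m := m) hpq hg hgq)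
  refine ⟨T, ℓ.isWeightedMul_of_tendsto hg hT, fun L => ?_⟩
  set s : ℝ := (2 ^ L)⁻¹ with hs
  have hs0 : 0 < s := by positivity
  set I : ℝ := ∫ x, ‖g x‖ ^ q ∂(torusMeasure d) with hI
  have hI0 : 0 ≤ I := integral_nonneg fun x => by positivity
  obtain ⟨Λ, hΛ⟩ := ((Metric.tendsto_atTop.mp hT) s hs0)
  set Λ' := max Λ L with hΛ'
  have h1 := hΛ Λ' (le_max_left _ _)
  rw [dist_eq_norm, norm_sub_rev] at h1
  have hP : 0 < ((2 : ℝ) ^ L) ^ p := by positivity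
  refine ⟨ℓ.partialOp m hg (ℓ.below L),
    ℓ.smallOp m hg s (ℓ.between L Λ') + (T - ℓ.partialOp m hg (ℓ.below Λ')),
    ℓ.largeOp m hg s (ℓ.between L Λ'), ?_, ?_, ?_, ?_, _, rankLE_kernelOp _⟩
  · have h2 := ℓ.partialOp_sub_partialOp (m := m) hg (le_max_right Λ L)
    rw [ℓ.partialOp_eq hg s (ℓ.between L Λ')] at h2
    rw [sub_eq_iff_eq_add] at h2
    rw [← hΛ'] at h2
    rw [h2]
    abel
  · refine (rankLE_kernelOp _).mono ?_
    have h2 := ℓ.card_below L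
    calc ((ℓ.below L).card : ℝ) * m ≤ K * ((2 : ℝ) ^ L) ^ p * m := by gcongr
      _ = m * K * 1 * ((2 : ℝ) ^ L) ^ p := by ring
      _ ≤ _ := by
        gcongr
        · nlinarith
        · linarith
  · refine (norm_add_le _ _).trans ?_
    have h2 : ‖ℓ.smallOp m hg s (ℓ.between L Λ')‖ ≤ 2 * s :=
      ContinuousLinearMap.opNorm_le_bound _ (by positivity)
        fun u => ℓ.norm_smallOp_apply_le hg hs0.le L Λ' u
    linarith
  · refine (ℓ.hsBound_largeOp hg s L Λ').mono ?_
    have h2 := sum_largeMass_le hpq hC hg hgq hs0 L Λ'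
    have e1 : s * 2 ^ L = 1 := inv_mul_cancel₀ (by positivity)
    have e2 : ((2 : ℝ) ^ L) ^ (p - 2) = ((2 : ℝ) ^ L) ^ p * s ^ 2 := by
      rw [Real.rpow_sub (by positivity), Real.rpow_two, hs]
      field_simp
    rw [e1, Real.one_rpow, mul_one, ← hI, e2] at h2
    calc _ ≤ c₀ * (C * (((2 : ℝ) ^ L) ^ p * s ^ 2) * I) := by gcongr
      _ = s ^ 2 * ((c₀ * C) * I * ((2 : ℝ) ^ L) ^ p) := by ring
      _ ≤ (4 * s) ^ 2 * ((m * K + c₀ * C + 1) * (1 + I) * ((2 : ℝ) ^ L) ^ p) := by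
        gcongr
        · linarith
        · have : 0 ≤ m * K := by positivity
          linarith
        · linarith

end LevelFunction

theorem exists_two_pow_near {x : ℝ} (hx : 1 ≤ x) : ∃ L : ℕ, x ≤ 2 ^ L ∧ (2 : ℝ) ^ L ≤ 2 * x := by
  obtain ⟨n, h1, h2⟩ := exists_nat_pow_near hx one_lt_two
  refine ⟨n + 1, h2.le, ?_⟩
  rw [pow_succ]; linarith

namespace LevelFunction

variable {d m : ℕ} {p K : ℝ} (ℓ : LevelFunction d p K)

namespace IsWeightedMul

variable {ℓ} {g g' : (Fin d → ℝ) → ℂ} {T T' : l2Lattice d m →L[ℂ] L2Torus d m}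

theorem add (h : ℓ.IsWeightedMul g T) (h' : ℓ.IsWeightedMul g' T') :
    ℓ.IsWeightedMul (fun x => g x + g' x) (T + T') := by
  intro u
  rw [add_apply]
  filter_upwards [Lp.coeFn_add (T u) (T' u), h u, h' u] with x h1 h2 h3
  rw [h1, Pi.add_apply, h2, h3, add_smul]

theorem smul (h : ℓ.IsWeightedMul g T) (c : ℂ) :
    ℓ.IsWeightedMul (fun x => c * g x) (c • T) := by
  intro u
  rw [smul_apply]
  filter_upwards [Lp.coeFn_smul c (T u), h u] with x h1 h2
  rw [h1, Pi.smul_apply, h2, mul_smul]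

theorem zero : ℓ.IsWeightedMul (fun _ => 0) (0 : l2Lattice d m →L[ℂ] L2Torus d m) := by
  intro u
  rw [zero_apply]
  filter_upwards [Lp.coeFn_zero (EuclideanSpace ℂ (Fin m)) 2 (torusMeasure d)] with x h1
  rw [h1, Pi.zero_apply, zero_smul]

theorem unique (h : ℓ.IsWeightedMul g T) (h' : ℓ.IsWeightedMul g T') : T = T' := by
  ext1 u
  exact Lp.ext ((h u).trans (h' u).symm)

end IsWeightedMul

/-- A multiplier of small `L_q` norm gives an operator that is small in the weak class; this follows
from the estimate for multipliers of norm at most one by homogeneity. -/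
theorem exists_eventuallyApprox {q : ℝ} (hp : 0 < p) (hpq : Admissible p q) :
    ∃ c : ℝ, 0 < c ∧ ∀ ε : ℝ, 0 < ε → ∀ g : (Fin d → ℝ) → ℂ, MemLp g 2 (torusMeasure d) →
      Integrable (fun x => ‖g x‖ ^ q) (torusMeasure d) →
      ∫ x, ‖g x‖ ^ q ∂(torusMeasure d) ≤ ε ^ q →
      ∃ T : l2Lattice d m →L[ℂ] L2Torus d m, ℓ.IsWeightedMul g T ∧
        EventuallyApprox p T (c * ε ^ p) := by
  obtain ⟨c, hc, h⟩ := ℓ.exists_isWeightedMul (m := m) hpq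
  refine ⟨c * 2 * 8 ^ p, by positivity, fun ε hε g hg hgq hle => ?_⟩
  have hεC : (ε : ℂ) ≠ 0 := by exact_mod_cast hε.ne'
  have e1 : ∀ x, ‖(ε : ℂ)⁻¹ * g x‖ ^ q = (ε ^ q)⁻¹ * ‖g x‖ ^ q := by
    intro x
    rw [norm_mul, norm_inv, Complex.norm_real, Real.norm_of_nonneg hε.le,
      Real.mul_rpow (by positivity) (norm_nonneg _), Real.inv_rpow hε.le]
  obtain ⟨T, hT, hA⟩ := h (fun x => (ε : ℂ)⁻¹ * g x) (hg.const_mul _) (by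
    simp_rw [e1]; exact hgq.const_mul _)
  simp_rw [e1, integral_const_mul] at hA
  have hI : (ε ^ q)⁻¹ * ∫ x, ‖g x‖ ^ q ∂(torusMeasure d) ≤ 1 := by
    rw [inv_mul_le_iff₀ (by positivity), mul_one]; exact hle
  refine ⟨(ε : ℂ) • T, ?_, ?_⟩
  · have := hT.smul (ε : ℂ)
    simp_rw [mul_inv_cancel_left₀ hεC] at this
    exact this
  · have h1 : ∀ᶠ s in 𝓝[>] (0 : ℝ), s < 4 * ε :=
      nhdsWithin_le_nhds (gt_mem_nhds (by positivity))
    filter_upwards [h1, self_mem_nhdsWithin] with s hs hs0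
    have hs0 : 0 < s := hs0
    -- `L` is chosen so that the scale `4 * 2^{-L}`, multiplied by `ε`, is at most `s`
    obtain ⟨L, hL, hL'⟩ := exists_two_pow_near (x := 4 * ε / s) (by rw [le_div_iff₀ hs0]; linarith)
    have h2 := (hA L).comp_left ((ε : ℂ) • ContinuousLinearMap.id ℂ (L2Torus d m)) (c := ε) (by
      rw [norm_smul, Complex.norm_real, Real.norm_of_nonneg hε.le]
      exact mul_le_of_le_one_right hε.le ContinuousLinearMap.norm_id_le)
    rw [ContinuousLinearMap.smul_comp, ContinuousLinearMap.id_comp] at h2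
    have h2L : (0 : ℝ) < 2 ^ L := by positivity
    refine h2.mono ?_ ?_
    · rw [div_le_iff₀ hs0] at hL
      rw [← mul_assoc, ← div_eq_mul_inv, div_le_iff₀ h2L]
      linarith
    · calc _ ≤ c * (1 + 1) * (2 * (4 * ε / s)) ^ p := by gcongr
        _ = _ := by
          rw [show 2 * (4 * ε / s) = 8 * ε / s by ring, Real.div_rpow (by positivity) hs0.le,
            Real.mul_rpow (by norm_num) hε.le, Real.rpow_neg hs0.le]
          ring

end LevelFunction

/-! ### Operators on the lattice -/

section Lattice

variable {d m : ℕ}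

/-- Multiplication by a bounded operator-valued function in `ℓ₂(ℤ^d, ℂ^m)`. -/
noncomputable def diagOp (D : (Fin d → ℤ) → EuclideanSpace ℂ (Fin m) →L[ℂ] EuclideanSpace ℂ (Fin m))
    {C : ℝ} (hC : 0 ≤ C) (hD : ∀ n, ‖D n‖ ≤ C) : l2Lattice d m →L[ℂ] l2Lattice d m :=
  lp.mapCLM 2 D hC hD

variable {D : (Fin d → ℤ) → EuclideanSpace ℂ (Fin m) →L[ℂ] EuclideanSpace ℂ (Fin m)}
  {C : ℝ} {hC : 0 ≤ C} {hD : ∀ n, ‖D n‖ ≤ C}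

theorem diagOp_apply (u : l2Lattice d m) (n : Fin d → ℤ) : diagOp D hC hD u n = D n (u n) := rfl

theorem norm_diagOp_le : ‖diagOp D hC hD‖ ≤ C := lp.norm_mapCLM_le 2 D hC hD

/-- A multiplier that is `o(2^{-level})` belongs to the `o`-class: outside finitely many points it is
at most `ε 2^{-level}`, and the levels with `ε 2^{-level} > s` are few. -/
theorem LevelFunction.negligiblyApprox_diagOp {p K : ℝ} (hp : 0 < p) (ℓ : LevelFunction d p K)
    (hDo : ∀ ε : ℝ, 0 < ε → {n | ε * ((2 : ℝ) ^ ℓ.level n)⁻¹ < ‖D n‖}.Finite) :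
    NegligiblyApprox p (diagOp D hC hD) := by
  classical
  intro δ hδ
  have hK := ℓ.K_nonneg
  obtain ⟨ε, hε, hεδ⟩ : ∃ ε : ℝ, 0 < ε ∧ m * K * 2 ^ p * ε ^ p ≤ δ / 2 := by
    refine ⟨(δ / 2 / (m * K * 2 ^ p + 1)) ^ (1 / p), by positivity, ?_⟩
    rw [← Real.rpow_mul (by positivity), one_div_mul_cancel hp.ne', Real.rpow_one]
    rw [← mul_div_assoc, div_le_iff₀ (by positivity)]
    have : 0 ≤ (m : ℝ) * K * 2 ^ p := by positivity
    nlinarith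
  set X := (hDo ε hε).toFinset with hX
  have h1 : ∀ᶠ s in 𝓝[>] (0 : ℝ), s < ε := nhdsWithin_le_nhds (gt_mem_nhds hε)
  have h2 : ∀ᶠ s in 𝓝[>] (0 : ℝ), m * X.card * s ^ p < δ / 2 := by
    have : Tendsto (fun s : ℝ => m * X.card * s ^ p) (𝓝 0) (𝓝 (m * X.card * 0 ^ p)) :=
      (Real.continuousAt_rpow_const _ _ (Or.inr hp.le)).tendsto.const_mul _
    rw [Real.zero_rpow hp.ne', mul_zero] at this
    exact nhdsWithin_le_nhds (this.eventually (gt_mem_nhds (half_pos hδ)))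
  filter_upwards [h1, h2, self_mem_nhdsWithin] with s hs hs2 hs0
  have hs0 : 0 < s := hs0
  -- for levels at least `L` one has `ε 2^{-level} ≤ s`
  obtain ⟨L, hL, hL'⟩ := exists_two_pow_near (x := ε / s) (by rw [le_div_iff₀ hs0]; linarith)
  have h2L : (0 : ℝ) < 2 ^ L := by positivity
  set S := ℓ.below L ∪ X with hS
  let R : l2Lattice d m →L[ℂ] l2Lattice d m := ∑ n ∈ S,
    (lp.singleContinuousLinearMap ℂ (fun _ : Fin d → ℤ => EuclideanSpace ℂ (Fin m)) 2 n) ∘L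
      (D n ∘L lp.evalCLM ℂ (fun _ : Fin d → ℤ => EuclideanSpace ℂ (Fin m)) 2 n)
  have hRapp : ∀ u n, R u n = if n ∈ S then D n (u n) else 0 := by
    intro u n
    simp only [R, sum_apply]
    rw [lp.coeFn_sum, Finset.sum_apply]
    simp only [ContinuousLinearMap.comp_apply, lp.singleContinuousLinearMap_apply, lp.single_apply]
    have e : ∀ k : Fin d → ℤ, (Pi.single k (D k ((lp.evalCLM ℂ
        (fun _ : Fin d → ℤ => EuclideanSpace ℂ (Fin m)) 2 k) u)) :
          (Fin d → ℤ) → EuclideanSpace ℂ (Fin m)) n = if n = k then D n (u n) else 0 := by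
      intro k
      rw [Pi.single_apply]
      split_ifs with h
      · subst h; rfl
      · rfl
    simp only [e]
    rw [Finset.sum_ite_eq]
  have hBn : ∀ n, ‖if n ∈ S then (0 : EuclideanSpace ℂ (Fin m) →L[ℂ] EuclideanSpace ℂ (Fin m))
      else D n‖ ≤ s := by
    intro n
    split_ifs with h
    · simpa using hs0.le
    · rw [hS, Finset.mem_union, not_or, ℓ.mem_below, not_lt, hX, Set.Finite.mem_toFinset,
        Set.mem_ofPred_eq, not_lt] at h
      refine h.2.trans ?_
      have h3 : (2 : ℝ) ^ L ≤ 2 ^ ℓ.level n := pow_le_pow_right₀ one_le_two h.1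
      rw [div_le_iff₀ hs0] at hL
      rw [← div_eq_mul_inv, div_le_iff₀ (by positivity)]
      nlinarith
  refine ⟨R, diagOp (fun n => if n ∈ S then 0 else D n) hs0.le hBn, 0, ?_, ?_, norm_diagOp_le,
    HSBound.zero.mono (by positivity), 0, RankLE.zero⟩
  · rw [add_zero]
    ext1 u
    apply lp.ext
    funext n
    rw [add_apply, lp.coeFn_add, Pi.add_apply, hRapp, diagOp_apply, diagOp_apply]
    split_ifs <;> simp
  · have h3 : RankLE R (∑ _n ∈ S, (m : ℝ)) := by
      refine RankLE.finset_sum S _ _ fun n _ => RankLE.comp_left _ (RankLE.comp_right _ ?_)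
      refine ⟨⊤, inferInstance, ?_, fun x => trivial⟩
      rw [finrank_top, finrank_euclideanSpace_fin]
    refine h3.mono ?_
    rw [Finset.sum_const, nsmul_eq_mul]
    have h4 : (S.card : ℝ) ≤ K * ((2 : ℝ) ^ L) ^ p + X.card := by
      have h5 : (S.card : ℝ) ≤ (ℓ.below L).card + X.card := by
        exact_mod_cast Finset.card_union_le _ _
      linarith [ℓ.card_below L]
    have h6 : ((2 : ℝ) ^ L) ^ p ≤ 2 ^ p * ε ^ p * s ^ (-p) := by
      refine (Real.rpow_le_rpow h2L.le hL' hp.le).trans (le_of_eq ?_)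
      rw [Real.mul_rpow zero_le_two (by positivity), Real.div_rpow hε.le hs0.le,
        Real.rpow_neg hs0.le]
      ring
    have h7 : 0 < s ^ (-p) := by positivity
    have h8 : s ^ p * s ^ (-p) = 1 := by
      rw [← Real.rpow_add hs0, add_neg_cancel, Real.rpow_zero]
    calc (S.card : ℝ) * m ≤ (K * (2 ^ p * ε ^ p * s ^ (-p)) + X.card) * m := by
          gcongr
          exact h4.trans (by gcongr)
      _ = (m * K * 2 ^ p * ε ^ p) * s ^ (-p) + (m * X.card) * (s ^ p * s ^ (-p)) := by
          rw [h8]; ring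
      _ = (m * K * 2 ^ p * ε ^ p + m * X.card * s ^ p) * s ^ (-p) := by ring
      _ ≤ δ * s ^ (-p) := by
          gcongr
          linarith

theorem memℓp_shift (k : Fin d → ℤ) (u : l2Lattice d m) : Memℓp (fun n => u (n - k)) 2 := by
  have h := (memℓp_gen_iff (p := 2) (by simp)).mp (lp.memℓp u)
  exact memℓp_gen ((Equiv.subRight k).summable_iff.mpr h)

/-- The shift `(S_k u)(n) = u(n - k)`. -/
noncomputable def shiftOp (m : ℕ) (k : Fin d → ℤ) : l2Lattice d m →L[ℂ] l2Lattice d m :=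
  LinearMap.mkContinuous
    { toFun := fun u => ⟨fun n => u (n - k), memℓp_shift k u⟩
      map_add' := fun _ _ => rfl
      map_smul' := fun _ _ => rfl } 1 (by
    intro u
    rw [one_mul, lp.norm_eq_tsum_rpow (by simp), lp.norm_eq_tsum_rpow (by simp)]
    refine le_of_eq (congrArg (· ^ (1 / (2 : ℝ≥0∞).toReal)) ?_)
    exact (Equiv.subRight k).tsum_eq fun n => ‖u n‖ ^ (2 : ℝ≥0∞).toReal)

theorem shiftOp_apply (k : Fin d → ℤ) (u : l2Lattice d m) (n : Fin d → ℤ) :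
    shiftOp m k u n = u (n - k) := rfl

theorem adjoint_shiftOp_neg (k : Fin d → ℤ) :
    ContinuousLinearMap.adjoint (shiftOp m (-k)) = shiftOp m k := by
  refine ((ContinuousLinearMap.eq_adjoint_iff _ _).mpr fun u v => ?_).symm
  rw [lp.inner_eq_tsum, lp.inner_eq_tsum,
    ← (Equiv.subRight k).tsum_eq fun n => ⟪u n, shiftOp m (-k) v n⟫_ℂ]
  refine tsum_congr fun n => ?_
  rw [shiftOp_apply, shiftOp_apply, Equiv.subRight_apply, sub_neg_eq_add, sub_add_cancel]

theorem fourier_single (n : Fin d → ℤ) (c : EuclideanSpace ℂ (Fin m)) :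
    fourier d m (lp.single 2 n c) = fourierMode m n c :=
  (orthogonalFamily_fourierMode d m).linearIsometry_apply_single c

end Lattice

/-! ### Multiplication by exponentials and by constant matrices -/

section Torus

variable {d m : ℕ}

theorem fourierExp_mul (k n : Fin d → ℤ) (x : Fin d → ℝ) :
    fourierExp k x * fourierExp n x =
      (((2 * Real.pi) ^ (-(d : ℝ) / 2) : ℝ) : ℂ) * fourierExp (n + k) x := by
  unfold fourierExp
  rw [mul_mul_mul_comm, ← Complex.exp_add, ← mul_assoc]
  congr 2
  push_cast
  rw [← mul_add, ← Finset.sum_add_distrib]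
  congr 1
  refine Finset.sum_congr rfl fun i _ => ?_
  simp only [Pi.add_apply]
  push_cast
  ring

theorem conj_fourierExp (k : Fin d → ℤ) (x : Fin d → ℝ) :
    (starRingEnd ℂ) (fourierExp k x) = fourierExp (-k) x := by
  unfold fourierExp
  rw [map_mul, Complex.conj_ofReal, ← Complex.exp_conj, map_mul, map_neg, Complex.conj_I,
    Complex.conj_ofReal]
  congr 2
  push_cast
  simp only [Pi.neg_apply, Int.cast_neg, neg_mul, Finset.sum_neg_distrib]
  ring

theorem memLp_fourierExp_mul (k : Fin d → ℤ) (u : L2Torus d m) :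
    MemLp (fun x => fourierExp k x • u x) 2 (torusMeasure d) := by
  refine MemLp.of_le_mul (c := (2 * Real.pi) ^ (-(d : ℝ) / 2)) (Lp.memLp u)
    ((continuous_fourierExp k).aestronglyMeasurable.smul (Lp.aestronglyMeasurable u))
    (ae_of_all _ fun x => ?_)
  rw [norm_smul, norm_fourierExp]

/-- Multiplication by the normalised exponential in `L₂(𝕋^d, ℂ^m)`. -/
noncomputable def mulExp (m : ℕ) (k : Fin d → ℤ) : L2Torus d m →L[ℂ] L2Torus d m :=
  LinearMap.mkContinuous
    { toFun := fun u => (memLp_fourierExp_mul k u).toLp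
      map_add' := by
        intro u v
        rw [← MemLp.toLp_add]
        refine MemLp.toLp_congr _ _ ?_
        filter_upwards [Lp.coeFn_add u v] with x hx
        rw [hx, Pi.add_apply, smul_add]
        rfl
      map_smul' := by
        intro c u
        rw [RingHom.id_apply, ← MemLp.toLp_const_smul]
        refine MemLp.toLp_congr _ _ ?_
        filter_upwards [Lp.coeFn_smul c u] with x hx
        rw [hx, Pi.smul_apply, smul_comm]
        rfl } ((2 * Real.pi) ^ (-(d : ℝ) / 2)) (by
    intro u
    refine Lp.norm_le_mul_norm_of_ae_le_mul ?_
    filter_upwards [(memLp_fourierExp_mul k u).coeFn_toLp] with x hx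
    change ‖(memLp_fourierExp_mul k u).toLp _ x‖ ≤ _
    rw [hx, norm_smul, norm_fourierExp])

theorem coeFn_mulExp (k : Fin d → ℤ) (u : L2Torus d m) :
    mulExp m k u =ᵐ[torusMeasure d] fun x => fourierExp k x • u x :=
  (memLp_fourierExp_mul k u).coeFn_toLp

theorem coeFn_fourierMode (n : Fin d → ℤ) (c : EuclideanSpace ℂ (Fin m)) :
    fourierMode m n c =ᵐ[torusMeasure d] fun x => fourierExp n x • c :=
  (memLp_fourierExp_smul n c).coeFn_toLp

theorem shiftOp_single [DecidableEq (Fin d → ℤ)] (k n : Fin d → ℤ) (c : EuclideanSpace ℂ (Fin m)) :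
    shiftOp m k (lp.single 2 n c) = lp.single 2 (n + k) c := by
  apply lp.ext
  funext j
  rw [shiftOp_apply, lp.single_apply, lp.single_apply, Pi.single_apply, Pi.single_apply]
  simp only [sub_eq_iff_eq_add]

theorem mulExp_comp_fourier (k : Fin d → ℤ) :
    mulExp m k ∘L fourier d m =
      (((2 * Real.pi) ^ (-(d : ℝ) / 2) : ℝ) : ℂ) • (fourier d m ∘L shiftOp m k) := by
  refine lp.ext_continuousLinearMap ENNReal.ofNat_ne_top fun n => ?_
  ext1 c
  simp only [ContinuousLinearMap.comp_apply, smul_apply, lp.singleContinuousLinearMap_apply]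
  rw [shiftOp_single, fourier_single, fourier_single]
  apply Lp.ext
  filter_upwards [coeFn_mulExp k (fourierMode m n c), coeFn_fourierMode n c,
    coeFn_fourierMode (n + k) c, Lp.coeFn_smul (((2 * Real.pi) ^ (-(d : ℝ) / 2) : ℝ) : ℂ)
      (fourierMode m (n + k) c)] with x h1 h2 h3 h4
  rw [h1, h2, h4, Pi.smul_apply, h3, smul_smul, smul_smul, fourierExp_mul]

/-- Pointwise application of a constant linear map in `L₂(𝕋^d, ℂ^m)`. -/
noncomputable def constOp (d : ℕ) (M : EuclideanSpace ℂ (Fin m) →L[ℂ] EuclideanSpace ℂ (Fin m)) :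
    L2Torus d m →L[ℂ] L2Torus d m :=
  M.compLpL 2 (torusMeasure d)

theorem coeFn_constOp (M : EuclideanSpace ℂ (Fin m) →L[ℂ] EuclideanSpace ℂ (Fin m))
    (u : L2Torus d m) : constOp d M u =ᵐ[torusMeasure d] fun x => M (u x) :=
  ContinuousLinearMap.coeFn_compLpL M u

theorem adjoint_constOp (M : EuclideanSpace ℂ (Fin m) →L[ℂ] EuclideanSpace ℂ (Fin m)) :
    ContinuousLinearMap.adjoint (constOp d M) = constOp d (ContinuousLinearMap.adjoint M) := by
  refine ((ContinuousLinearMap.eq_adjoint_iff _ _).mpr fun u v => ?_).symm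
  rw [L2.inner_def, L2.inner_def]
  refine integral_congr_ae ?_
  filter_upwards [coeFn_constOp M v, coeFn_constOp (ContinuousLinearMap.adjoint M) u] with x h1 h2
  rw [h1, h2, ContinuousLinearMap.adjoint_inner_left]

/-- Pointwise application of a constant linear map in `ℓ₂(ℤ^d, ℂ^m)`. -/
noncomputable def latticeConstOp (d : ℕ)
    (M : EuclideanSpace ℂ (Fin m) →L[ℂ] EuclideanSpace ℂ (Fin m)) :
    l2Lattice d m →L[ℂ] l2Lattice d m :=
  diagOp (fun _ => M) (norm_nonneg M) fun _ => le_rfl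

theorem latticeConstOp_apply (M : EuclideanSpace ℂ (Fin m) →L[ℂ] EuclideanSpace ℂ (Fin m))
    (u : l2Lattice d m) (n : Fin d → ℤ) : latticeConstOp d M u n = M (u n) := rfl

theorem adjoint_latticeConstOp (M : EuclideanSpace ℂ (Fin m) →L[ℂ] EuclideanSpace ℂ (Fin m)) :
    ContinuousLinearMap.adjoint (latticeConstOp d M) =
      latticeConstOp d (ContinuousLinearMap.adjoint M) := by
  refine ((ContinuousLinearMap.eq_adjoint_iff _ _).mpr fun u v => ?_).symm
  rw [lp.inner_eq_tsum, lp.inner_eq_tsum]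
  refine tsum_congr fun n => ?_
  rw [latticeConstOp_apply, latticeConstOp_apply, ContinuousLinearMap.adjoint_inner_left]

theorem constOp_comp_fourier (M : EuclideanSpace ℂ (Fin m) →L[ℂ] EuclideanSpace ℂ (Fin m)) :
    constOp d M ∘L fourier d m = fourier d m ∘L latticeConstOp d M := by
  refine lp.ext_continuousLinearMap ENNReal.ofNat_ne_top fun n => ?_
  ext1 c
  simp only [ContinuousLinearMap.comp_apply, lp.singleContinuousLinearMap_apply]
  have h : latticeConstOp d M (lp.single 2 n c) = lp.single 2 n (M c) := by
    apply lp.ext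
    funext j
    rw [latticeConstOp_apply, lp.single_apply, lp.single_apply, Pi.single_apply, Pi.single_apply]
    split_ifs <;> simp
  rw [h, fourier_single, fourier_single]
  apply Lp.ext
  filter_upwards [coeFn_constOp M (fourierMode m n c), coeFn_fourierMode n c,
    coeFn_fourierMode n (M c)] with x h1 h2 h3
  rw [h1, h2, h3, map_smul]

theorem adjoint_fourier_comp_constOp
    (M : EuclideanSpace ℂ (Fin m) →L[ℂ] EuclideanSpace ℂ (Fin m)) :
    ContinuousLinearMap.adjoint (fourier d m) ∘L constOp d M =
      latticeConstOp d M ∘L ContinuousLinearMap.adjoint (fourier d m) := by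
  have h := congrArg ContinuousLinearMap.adjoint
    (constOp_comp_fourier (d := d) (ContinuousLinearMap.adjoint M))
  rwa [ContinuousLinearMap.adjoint_comp, ContinuousLinearMap.adjoint_comp, adjoint_constOp,
    adjoint_latticeConstOp, ContinuousLinearMap.adjoint_adjoint] at h

end Torus

/-! ### Asymptotics of the symbol on the lattice -/

section Lattice

variable {d m : ℕ}

/-- The lattice points of the cube with half-side `R`. -/
noncomputable def latticeBox (d : ℕ) (R : ℝ) : Finset (Fin d → ℤ) :=
  Fintype.piFinset fun _ => Finset.Icc (-⌊R⌋) ⌊R⌋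

theorem mem_latticeBox {R : ℝ} {n : Fin d → ℤ} (h : ∀ i, |(n i : ℝ)| ≤ R) : n ∈ latticeBox d R := by
  rw [latticeBox, Fintype.mem_piFinset]
  intro i
  have h1 := abs_le.mp (h i)
  rw [Finset.mem_Icc, neg_le, Int.le_floor, Int.le_floor]
  push_cast
  exact ⟨by linarith, h1.2⟩

theorem abs_le_norm_latticeVec (n : Fin d → ℤ) (i : Fin d) : |(n i : ℝ)| ≤ ‖latticeVec n‖ :=
  PiLp.norm_apply_le (latticeVec n) i

theorem card_latticeBox_le {R : ℝ} (hR : 1 ≤ R) : ((latticeBox d R).card : ℝ) ≤ (3 * R) ^ d := by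
  have h0 : 0 ≤ ⌊R⌋ := Int.floor_nonneg.mpr (by linarith)
  rw [latticeBox, Fintype.card_piFinset, Finset.prod_const, Finset.card_univ, Fintype.card_fin,
    Int.card_Icc, Nat.cast_pow]
  refine pow_le_pow_left₀ (Nat.cast_nonneg _) ?_ d
  have h1 : (((⌊R⌋ + 1 - -⌊R⌋).toNat : ℤ) : ℝ) = 2 * ⌊R⌋ + 1 := by
    rw [Int.toNat_of_nonneg (by omega)]
    push_cast; ring
  rw [Int.cast_natCast] at h1
  rw [h1]
  linarith [Int.floor_le R]

theorem tendsto_norm_latticeVec :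
    Tendsto (fun n : Fin d → ℤ => ‖latticeVec n‖) cofinite atTop := by
  rw [tendsto_atTop]
  intro R
  rw [eventually_cofinite]
  refine (latticeBox d R).finite_toSet.subset fun n hn => ?_
  have hn : ¬ R ≤ ‖latticeVec n‖ := hn
  exact mem_latticeBox fun i => (abs_le_norm_latticeVec n i).trans (not_le.mp hn).le

theorem one_le_norm_latticeVec {n : Fin d → ℤ} (hn : n ≠ 0) : 1 ≤ ‖latticeVec n‖ := by
  obtain ⟨i, hi⟩ := Function.ne_iff.mp hn
  refine le_trans ?_ (abs_le_norm_latticeVec n i)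
  exact_mod_cast Int.one_le_abs hi

/-- A level function whose weight `2^{-level}` is comparable to `|n|^{-d/p}`. -/
theorem exists_levelFunction (d : ℕ) {p : ℝ} (hp : 0 < p) :
    ∃ (K : ℝ) (ℓ : LevelFunction d p K), ∀ n : Fin d → ℤ, n ≠ 0 →
      ‖latticeVec n‖ ^ (-(d : ℝ) / p) ≤ 2 * ((2 : ℝ) ^ ℓ.level n)⁻¹ := by
  have hx : ∀ n : Fin d → ℤ, 1 ≤ (max 1 ‖latticeVec n‖) ^ ((d : ℝ) / p) := fun n =>
    Real.one_le_rpow (le_max_left _ _) (by positivity)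
  choose lev h1 h2 using fun n => exists_two_pow_near (hx n)
  have hsub : ∀ (L : ℕ) (n : Fin d → ℤ), lev n < L →
      n ∈ latticeBox d (((2 : ℝ) ^ L) ^ (p / d)) := by
    intro L n hn
    refine mem_latticeBox fun i => ?_
    have hd : (0 : ℝ) < d := by exact_mod_cast i.pos
    have h3 : (max 1 ‖latticeVec n‖) ^ ((d : ℝ) / p) ≤ 2 ^ L :=
      (h1 n).trans (pow_le_pow_right₀ one_le_two hn.le)
    have h4 := Real.rpow_le_rpow (by positivity) h3 (by positivity : 0 ≤ p / d)
    have h5 : (d : ℝ) / p * (p / d) = 1 := by field_simp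
    rw [← Real.rpow_mul (by positivity), h5, Real.rpow_one] at h4
    exact ((abs_le_norm_latticeVec n i).trans (le_max_right _ _)).trans h4
  refine ⟨3 ^ d, ⟨lev, fun L => (latticeBox d (((2 : ℝ) ^ L) ^ (p / d))).filter
    fun n => lev n < L, fun L n => ?_, fun L => ?_⟩, fun n hn => ?_⟩
  · rw [Finset.mem_filter]
    exact ⟨fun h => h.2, fun h => ⟨hsub L n h, h⟩⟩
  · have h2L : (1 : ℝ) ≤ 2 ^ L := one_le_pow₀ one_le_two
    have h3 : (1 : ℝ) ≤ ((2 : ℝ) ^ L) ^ (p / d) := Real.one_le_rpow h2L (by positivity)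
    have h4 : ((((latticeBox d (((2 : ℝ) ^ L) ^ (p / d))).filter fun n => lev n < L).card : ℕ) : ℝ)
        ≤ (latticeBox d (((2 : ℝ) ^ L) ^ (p / d))).card := by
      exact_mod_cast Finset.card_filter_le _ _
    refine (h4.trans (card_latticeBox_le h3)).trans ?_
    rw [mul_pow]
    refine mul_le_mul_of_nonneg_left ?_ (by positivity)
    rw [← Real.rpow_natCast, ← Real.rpow_mul (by positivity)]
    refine Real.rpow_le_rpow_of_exponent_le h2L ?_
    -- for `d = 0` the exponent `p / d` is zero
    rcases Nat.eq_zero_or_pos d with rfl | hd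
    · simpa using hp.le
    · have hd : (0 : ℝ) < d := by exact_mod_cast hd
      rw [div_mul_cancel₀ _ hd.ne']
  · have h3 := h2 n
    rw [max_eq_right (one_le_norm_latticeVec hn)] at h3
    have h4 : 0 < ‖latticeVec n‖ := one_pos.trans_le (one_le_norm_latticeVec hn)
    rw [neg_div, Real.rpow_neg h4.le, ← div_eq_mul_inv, le_div_iff₀ (by positivity),
      inv_mul_le_iff₀ (by positivity)]
    linarith

theorem tendsto_sub_cofinite (k : Fin d → ℤ) :
    Tendsto (fun n : Fin d → ℤ => n - k) cofinite cofinite :=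
  (Equiv.subRight k).injective.tendsto_cofinite

theorem norm_latticeVec_sub_sub_le (n k : Fin d → ℤ) :
    |‖latticeVec (n - k)‖ - ‖latticeVec n‖| ≤ ‖latticeVec k‖ := by
  have h : latticeVec (n - k) = latticeVec n - latticeVec k := by
    ext i; simp [latticeVec]
  refine (abs_norm_sub_norm_le _ _).trans (le_of_eq ?_)
  rw [h, sub_sub_cancel_left, norm_neg]

theorem tendsto_norm_latticeVec_ratio (k : Fin d → ℤ) :
    Tendsto (fun n : Fin d → ℤ => ‖latticeVec (n - k)‖ / ‖latticeVec n‖) cofinite (𝓝 1) := by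
  have h0 : Tendsto (fun n : Fin d → ℤ => ‖latticeVec k‖ / ‖latticeVec n‖) cofinite (𝓝 0) :=
    tendsto_norm_latticeVec.const_div_atTop _
  rw [tendsto_iff_norm_sub_tendsto_zero]
  refine squeeze_zero' (Eventually.of_forall fun n => norm_nonneg _) ?_ h0
  filter_upwards [tendsto_norm_latticeVec.eventually_gt_atTop 0] with n hn
  rw [Real.norm_eq_abs, ← div_self hn.ne', ← sub_div, abs_div, abs_of_pos hn]
  exact div_le_div_of_nonneg_right (norm_latticeVec_sub_sub_le n k) hn.le

theorem isEquivalent_rpow_norm_latticeVec_sub (k : Fin d → ℤ) (s : ℝ) :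
    (fun n : Fin d → ℤ => ‖latticeVec (n - k)‖ ^ s) ~[cofinite] fun n => ‖latticeVec n‖ ^ s := by
  refine isEquivalent_of_tendsto_one ?_
  have h := (tendsto_norm_latticeVec_ratio k).rpow_const (p := s) (Or.inl one_ne_zero)
  rw [Real.one_rpow] at h
  refine h.congr fun n => ?_
  rw [Pi.div_apply, Real.div_rpow (norm_nonneg _) (norm_nonneg _)]

/-- The direction of `n - k` is asymptotically that of `n`. -/
theorem tendsto_direction_sub (k : Fin d → ℤ) :
    Tendsto (fun n : Fin d → ℤ => dist (‖latticeVec (n - k)‖⁻¹ • latticeVec (n - k))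
      (‖latticeVec n‖⁻¹ • latticeVec n)) cofinite (𝓝 0) := by
  have h0 : Tendsto (fun n : Fin d → ℤ => 2 * ‖latticeVec k‖ / ‖latticeVec n‖) cofinite (𝓝 0) :=
    tendsto_norm_latticeVec.const_div_atTop _
  refine squeeze_zero' (Eventually.of_forall fun n => dist_nonneg) ?_ h0
  have hpos := (tendsto_norm_latticeVec (d := d)).eventually_gt_atTop (0 : ℝ)
  filter_upwards [hpos, (tendsto_sub_cofinite k).eventually hpos] with n hn hnk
  set x := latticeVec n
  set y := latticeVec (n - k) with hy
  have hxy : y - x = -latticeVec k := by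
    rw [hy]; ext i; simp [latticeVec, x]
  have e : ‖y‖⁻¹ • y - ‖x‖⁻¹ • x = ‖x‖⁻¹ • (y - x) + ((‖x‖ - ‖y‖) * ‖x‖⁻¹ * ‖y‖⁻¹) • y := by
    have : ‖y‖⁻¹ = ‖x‖⁻¹ + (‖x‖ - ‖y‖) * ‖x‖⁻¹ * ‖y‖⁻¹ := by field_simp; ring
    nth_rewrite 1 [this]
    rw [add_smul, smul_sub]
    abel
  rw [dist_eq_norm, e]
  refine (norm_add_le _ _).trans ?_
  rw [norm_smul, norm_smul, hxy, norm_neg, norm_mul, norm_mul, norm_inv, norm_inv, norm_norm,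
    norm_norm, mul_assoc, inv_mul_cancel₀ hnk.ne', mul_one]
  have h1 : ‖‖x‖ - ‖y‖‖ ≤ ‖latticeVec k‖ := by
    rw [Real.norm_eq_abs, abs_sub_comm]; exact norm_latticeVec_sub_sub_le n k
  calc _ ≤ ‖x‖⁻¹ * ‖latticeVec k‖ + ‖latticeVec k‖ * ‖x‖⁻¹ := by gcongr
    _ = _ := by ring

theorem direction_mem_sphere {n : Fin d → ℤ} (hn : 0 < ‖latticeVec n‖) :
    ‖latticeVec n‖⁻¹ • latticeVec n ∈ Metric.sphere (0 : EuclideanSpace ℝ (Fin d)) 1 := by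
  rw [mem_sphere_zero_iff_norm, norm_smul, norm_inv, norm_norm, inv_mul_cancel₀ hn.ne']

variable {ω : EuclideanSpace ℝ (Fin d) → ℂ} {s : ℝ}

/-- The leading homogeneous part `|n|^s ω(n/|n|)` of the symbol. -/
noncomputable def leadingPart (ω : EuclideanSpace ℝ (Fin d) → ℂ) (s : ℝ) (n : Fin d → ℤ) : ℂ :=
  ((‖latticeVec n‖ ^ s : ℝ) : ℂ) * ω (‖latticeVec n‖⁻¹ • latticeVec n)

theorem isBigO_angular (hω : ContinuousOn ω (Metric.sphere 0 1)) :
    (fun n : Fin d → ℤ => ω (‖latticeVec n‖⁻¹ • latticeVec n)) =O[cofinite]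
      fun _ => (1 : ℝ) := by
  obtain ⟨C, hC⟩ := (isCompact_sphere (0 : EuclideanSpace ℝ (Fin d)) 1).exists_bound_of_continuousOn
    hω
  refine IsBigO.of_bound C ?_
  filter_upwards [tendsto_norm_latticeVec.eventually_gt_atTop 0] with n hn
  rw [norm_one, mul_one]
  exact hC _ (direction_mem_sphere hn)

theorem isBigO_leadingPart (hω : ContinuousOn ω (Metric.sphere 0 1)) :
    leadingPart ω s =O[cofinite] fun n => ‖latticeVec n‖ ^ s := by
  have h1 : (fun n : Fin d → ℤ => ((‖latticeVec n‖ ^ s : ℝ) : ℂ)) =O[cofinite]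
      fun n => ‖latticeVec n‖ ^ s :=
    IsBigO.of_bound 1 (Eventually.of_forall fun n => by rw [Complex.norm_real, one_mul])
  have h := h1.mul (isBigO_angular hω)
  simp only [mul_one] at h
  exact h

theorem isLittleO_leadingPart_sub (hω : ContinuousOn ω (Metric.sphere 0 1)) (k : Fin d → ℤ) :
    (fun n => leadingPart ω s (n - k) - leadingPart ω s n) =o[cofinite]
      fun n => ‖latticeVec n‖ ^ s := by
  have hE := isEquivalent_rpow_norm_latticeVec_sub k s
  have hpos := (tendsto_norm_latticeVec (d := d)).eventually_gt_atTop (0 : ℝ)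
  have hΔ : (fun n : Fin d → ℤ => ω (‖latticeVec (n - k)‖⁻¹ • latticeVec (n - k)) -
      ω (‖latticeVec n‖⁻¹ • latticeVec n)) =o[cofinite] fun _ => (1 : ℝ) := by
    rw [isLittleO_one_iff, Metric.tendsto_nhds]
    intro ε hε
    have hu := (isCompact_sphere (0 : EuclideanSpace ℝ (Fin d)) 1).uniformContinuousOn_of_continuous
      hω
    obtain ⟨δ, hδ, hδ'⟩ := Metric.uniformContinuousOn_iff.mp hu ε hε
    filter_upwards [hpos, (tendsto_sub_cofinite k).eventually hpos,
      (tendsto_direction_sub k).eventually (gt_mem_nhds hδ)] with n h1 h2 h3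
    rw [dist_zero_right, ← dist_eq_norm]
    exact hδ' _ (direction_mem_sphere h2) _ (direction_mem_sphere h1) h3
  have h1 : (fun n : Fin d → ℤ => ((‖latticeVec (n - k)‖ ^ s : ℝ) : ℂ)) =O[cofinite]
      fun n => ‖latticeVec n‖ ^ s :=
    (IsBigO.of_bound 1 (Eventually.of_forall fun n => by
      rw [Complex.norm_real, one_mul])).trans hE.isBigO
  have h2 : (fun n : Fin d → ℤ => ((‖latticeVec (n - k)‖ ^ s - ‖latticeVec n‖ ^ s : ℝ) : ℂ))
      =o[cofinite] fun n => ‖latticeVec n‖ ^ s :=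
    IsBigO.trans_isLittleO (IsBigO.of_bound 1 (Eventually.of_forall fun n => by
      rw [Complex.norm_real, one_mul]; rfl)) hE.isLittleO
  have h3 := (h1.mul_isLittleO hΔ).add (h2.mul_isBigO (isBigO_angular hω))
  simp only [mul_one] at h3
  refine h3.congr_left fun n => ?_
  unfold leadingPart
  push_cast
  ring

/-- The matrix `A` as an operator in `ℂ^m`. -/
noncomputable abbrev matCLM (A : Matrix (Fin m) (Fin m) ℂ) :
    EuclideanSpace ℂ (Fin m) →L[ℂ] EuclideanSpace ℂ (Fin m) :=
  Matrix.toEuclideanCLM (n := Fin m) (𝕜 := ℂ) A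

theorem matCLM_eq_sum (A : Matrix (Fin m) (Fin m) ℂ) :
    matCLM A = ∑ i, ∑ j, A i j • matCLM (Matrix.single i j 1) := by
  conv_lhs => rw [Matrix.matrix_eq_sum_single A]
  simp only [matCLM, map_sum, ← map_smul, Matrix.smul_single, smul_eq_mul, mul_one]

theorem isLittleO_matCLM {Z : (Fin d → ℤ) → Matrix (Fin m) (Fin m) ℂ} {r : (Fin d → ℤ) → ℝ}
    {F : Filter (Fin d → ℤ)} (hZ : ∀ i j, (fun n => Z n i j) =o[F] r) :
    (fun n => matCLM (Z n)) =o[F] r := by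
  have key : ∀ i j, (fun n => Z n i j • matCLM (Matrix.single i j (1 : ℂ))) =o[F] r := by
    intro i j
    have h1 : (fun _ : Fin d → ℤ => matCLM (Matrix.single i j (1 : ℂ))) =O[F] fun _ => (1 : ℝ) :=
      isBigO_const_const _ one_ne_zero F
    have h := (hZ i j).smul_isBigO h1
    simpa only [smul_eq_mul, mul_one] using h
  have h : (fun n => ∑ i, ∑ j, Z n i j • matCLM (Matrix.single i j (1 : ℂ))) =o[F] r :=
    IsLittleO.fun_sum fun i _ => IsLittleO.fun_sum fun j _ => key i j
  exact h.congr_left fun n => (matCLM_eq_sum (Z n)).symm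

variable {W : (Fin d → ℤ) → Matrix (Fin m) (Fin m) ℂ}

/-- `W(n)` differs from the scalar matrix `leadingPart n` by a lower order remainder. -/
theorem isLittleO_symbol_sub
    (hW : ∀ i j : Fin m,
      (fun n : Fin d → ℤ => W n i j - ((‖latticeVec n‖ ^ s : ℝ) : ℂ) *
          (ω (‖latticeVec n‖⁻¹ • latticeVec n) * (1 : Matrix (Fin m) (Fin m) ℂ) i j))
        =o[comap (fun n : Fin d → ℤ => ‖latticeVec n‖) atTop] fun n => ‖latticeVec n‖ ^ s) :
    (fun n => matCLM (W n) - leadingPart ω s n • ContinuousLinearMap.id ℂ _) =o[cofinite]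
      fun n => ‖latticeVec n‖ ^ s := by
  have hle : (cofinite : Filter (Fin d → ℤ)) ≤ comap (fun n : Fin d → ℤ => ‖latticeVec n‖) atTop :=
    tendsto_iff_comap.mp tendsto_norm_latticeVec
  have h := isLittleO_matCLM (Z := fun n => W n - leadingPart ω s n • 1)
    (r := fun n => ‖latticeVec n‖ ^ s) (F := cofinite) fun i j => by
      refine ((hW i j).mono hle).congr_left fun n => ?_
      rw [Matrix.sub_apply, Matrix.smul_apply, smul_eq_mul, leadingPart, mul_assoc]
  refine h.congr_left fun n => ?_
  have h1 : matCLM (1 : Matrix (Fin m) (Fin m) ℂ) = ContinuousLinearMap.id ℂ _ :=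
    map_one (Matrix.toEuclideanCLM (n := Fin m) (𝕜 := ℂ))
  rw [← h1]
  exact (map_sub (Matrix.toEuclideanCLM (n := Fin m) (𝕜 := ℂ)) _ _).trans
    (congrArg _ (map_smul (Matrix.toEuclideanCLM (n := Fin m) (𝕜 := ℂ)) _ _))

/-- The key cancellation: the scalar leading part commutes with `M` and is slowly varying, so the
shifted symbol commutes with `M` up to `o(|n|^s)`. -/
theorem isLittleO_symbol_commutator (hω : ContinuousOn ω (Metric.sphere 0 1))
    (hZ : (fun n => matCLM (W n) - leadingPart ω s n • ContinuousLinearMap.id ℂ _) =o[cofinite]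
      fun n => ‖latticeVec n‖ ^ s) (k : Fin d → ℤ)
    (M : EuclideanSpace ℂ (Fin m) →L[ℂ] EuclideanSpace ℂ (Fin m)) :
    (fun n => M ∘L matCLM (W (n - k)) - matCLM (W n) ∘L M) =o[cofinite]
      fun n => ‖latticeVec n‖ ^ s := by
  have hE := isEquivalent_rpow_norm_latticeVec_sub k s
  have h1 : (fun n => M ∘L (matCLM (W (n - k)) - leadingPart ω s (n - k) •
      ContinuousLinearMap.id ℂ _)) =o[cofinite] fun n => ‖latticeVec n‖ ^ s :=
    IsBigO.trans_isLittleO (IsBigO.of_bound ‖M‖ (Eventually.of_forall fun n =>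
      ContinuousLinearMap.opNorm_comp_le _ _))
      ((hZ.comp_tendsto (tendsto_sub_cofinite k)).trans_isBigO hE.isBigO)
  have h2 : (fun n => (matCLM (W n) - leadingPart ω s n • ContinuousLinearMap.id ℂ _) ∘L M)
      =o[cofinite] fun n => ‖latticeVec n‖ ^ s :=
    IsBigO.trans_isLittleO (IsBigO.of_bound ‖M‖ (Eventually.of_forall fun n => by
      rw [mul_comm]; exact ContinuousLinearMap.opNorm_comp_le _ _)) hZ
  have h3 : (fun n => (leadingPart ω s (n - k) - leadingPart ω s n) • M) =o[cofinite]
      fun n => ‖latticeVec n‖ ^ s := by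
    have h4 : (fun _ : Fin d → ℤ => M) =O[cofinite] fun _ => (1 : ℝ) :=
      isBigO_const_const _ one_ne_zero _
    have h := (isLittleO_leadingPart_sub (s := s) hω k).smul_isBigO h4
    simpa only [smul_eq_mul, mul_one] using h
  refine ((h1.sub h2).add h3).congr_left fun n => ?_
  simp only [ContinuousLinearMap.comp_sub, ContinuousLinearMap.sub_comp,
    ContinuousLinearMap.comp_smul, ContinuousLinearMap.smul_comp, ContinuousLinearMap.comp_id,
    ContinuousLinearMap.id_comp]
  rw [sub_smul (leadingPart ω s (n - k)) (leadingPart ω s n) M]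
  abel

/-- Estimates relative to `|n|^{-d/p}` are estimates relative to the dyadic weight. -/
theorem isBigO_weight {p K : ℝ} (ℓ : LevelFunction d p K)
    (hℓ : ∀ n : Fin d → ℤ, n ≠ 0 →
      ‖latticeVec n‖ ^ (-(d : ℝ) / p) ≤ 2 * ((2 : ℝ) ^ ℓ.level n)⁻¹) :
    (fun n : Fin d → ℤ => ‖latticeVec n‖ ^ (-(d : ℝ) / p)) =O[cofinite]
      fun n => ((2 : ℝ) ^ ℓ.level n)⁻¹ := by
  refine IsBigO.of_bound 2 ?_
  filter_upwards [(Set.finite_singleton (0 : Fin d → ℤ)).compl_mem_cofinite] with n hn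
  rw [Real.norm_of_nonneg (by positivity), Real.norm_of_nonneg (by positivity)]
  exact hℓ n hn

theorem finite_setOf_lt_norm_of_isLittleO {V : Type*} [NormedAddCommGroup V] {p K : ℝ}
    (ℓ : LevelFunction d p K) {D : (Fin d → ℤ) → V}
    (hD : D =o[cofinite] fun n => ((2 : ℝ) ^ ℓ.level n)⁻¹) (ε : ℝ) (hε : 0 < ε) :
    {n | ε * ((2 : ℝ) ^ ℓ.level n)⁻¹ < ‖D n‖}.Finite := by
  have h := eventually_cofinite.mp (hD.bound hε)
  refine h.subset fun n hn => ?_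
  have hn : ε * ((2 : ℝ) ^ ℓ.level n)⁻¹ < ‖D n‖ := hn
  rw [Set.mem_ofPred_eq, Real.norm_of_nonneg (by positivity)]
  exact not_le.mpr hn

theorem exists_bound_of_isBigO {V : Type*} [NormedAddCommGroup V] {p K : ℝ}
    (ℓ : LevelFunction d p K) {D : (Fin d → ℤ) → V}
    (hD : D =O[cofinite] fun n => ((2 : ℝ) ^ ℓ.level n)⁻¹) :
    ∃ C : ℝ, 0 ≤ C ∧ ∀ n, ‖D n‖ ≤ C * ((2 : ℝ) ^ ℓ.level n)⁻¹ := by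
  obtain ⟨C, hC0, hC⟩ := bound_of_isBigO_cofinite hD
  refine ⟨C, hC0.le, fun n => ?_⟩
  have h := hC (x := n) (by positivity)
  rwa [Real.norm_of_nonneg (by positivity)] at h

end Lattice

/-! ### Density of trigonometric polynomials -/

section Density

variable {d : ℕ}

/-- The quotient map of `ℝ^d` onto `(ℝ/ℤ)^d` that rescales the period `2π` to `1`. -/
noncomputable def toUnitTorus (x : Fin d → ℝ) : UnitAddTorus (Fin d) :=
  fun i => ((x i / (2 * Real.pi) : ℝ) : UnitAddCircle)

/-- The inverse of `toUnitTorus` on the half-open cube. -/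
noncomputable def ofUnitTorus (z : UnitAddTorus (Fin d)) (i : Fin d) : ℝ :=
  2 * Real.pi * (AddCircle.equivIoc (1 : ℝ) (-(1 / 2)) (z i) : ℝ)

theorem measurable_toUnitTorus : Measurable (toUnitTorus (d := d)) := by
  refine measurable_pi_lambda _ fun i => ?_
  exact (AddCircle.measurable_mk' (a := (1 : ℝ))).comp ((measurable_pi_apply i).div_const _)

theorem measurable_ofUnitTorus : Measurable (ofUnitTorus (d := d)) := by
  refine measurable_pi_lambda _ fun i => Measurable.const_mul ?_ _
  exact measurable_subtype_coe.comp
    ((AddCircle.measurableEquivIoc (1 : ℝ) (-(1 / 2))).measurable.comp (measurable_pi_apply i))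

theorem ae_ofUnitTorus_toUnitTorus :
    ∀ᵐ x ∂(torusMeasure d), ofUnitTorus (toUnitTorus x) = x := by
  have h1 : (Set.univ.pi fun _ : Fin d => Set.Ioc (-Real.pi) Real.pi) =ᵐ[volume] torus d := by
    rw [volume_pi]; exact Measure.univ_pi_Ioc_ae_eq_Icc
  have h2 : ∀ᵐ x ∂(torusMeasure d), x ∈ Set.univ.pi fun _ : Fin d => Set.Ioc (-Real.pi) Real.pi := by
    rw [torusMeasure, ← Measure.restrict_congr_set h1]
    exact ae_restrict_mem (MeasurableSet.univ_pi fun _ => measurableSet_Ioc)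
  filter_upwards [h2] with x hx
  funext i
  have hpi := Real.pi_pos
  have h3 := hx i trivial
  have h4 : x i / (2 * Real.pi) ∈ Set.Ioc (-(1 / 2) : ℝ) (-(1 / 2) + 1) := by
    constructor
    · rw [lt_div_iff₀ (by positivity)]; linarith [h3.1]
    · rw [div_le_iff₀ (by positivity)]; linarith [h3.2]
  rw [ofUnitTorus, toUnitTorus, AddCircle.equivIoc_coe_eq h4]
  field_simp

theorem mFourier_toUnitTorus (n : Fin d → ℤ) (x : Fin d → ℝ) :
    UnitAddTorus.mFourier n (toUnitTorus x) =
      (((2 * Real.pi) ^ (-(d : ℝ) / 2) : ℝ) : ℂ)⁻¹ * fourierExp (-n) x := by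
  have h0 : (((2 * Real.pi) ^ (-(d : ℝ) / 2) : ℝ) : ℂ) ≠ 0 := by
    exact_mod_cast (Real.rpow_pos_of_pos (by positivity) _).ne'
  rw [fourierExp, inv_mul_cancel_left₀ h0]
  change ∏ i, _root_.fourier (n i) (toUnitTorus x i) = _
  simp only [toUnitTorus, fourier_coe_apply, ← Complex.exp_sum]
  congr 1
  push_cast
  rw [Finset.mul_sum]
  refine Finset.sum_congr rfl fun i _ => ?_
  have hpi : (Real.pi : ℂ) ≠ 0 := by exact_mod_cast Real.pi_ne_zero
  simp only [Pi.neg_apply, Int.cast_neg]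
  field_simp

theorem comp_toUnitTorus_mem_span_fourierExp {F : C(UnitAddTorus (Fin d), ℂ)}
    (hF : F ∈ Submodule.span ℂ (Set.range (UnitAddTorus.mFourier (d := Fin d)))) :
    (fun x : Fin d → ℝ => F (toUnitTorus x)) ∈
      Submodule.span ℂ (Set.range (fourierExp (d := d))) := by
  induction hF using Submodule.span_induction with
  | mem F hF =>
    obtain ⟨n, rfl⟩ := hF
    have e : (fun x : Fin d → ℝ => UnitAddTorus.mFourier n (toUnitTorus x)) =
        (((2 * Real.pi) ^ (-(d : ℝ) / 2) : ℝ) : ℂ)⁻¹ • fourierExp (-n) := by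
      funext x
      rw [mFourier_toUnitTorus, Pi.smul_apply, smul_eq_mul]
    rw [e]
    exact Submodule.smul_mem _ _ (Submodule.subset_span ⟨_, rfl⟩)
  | zero => exact Submodule.zero_mem _
  | add F G _ _ hF hG => exact Submodule.add_mem _ hF hG
  | smul c F _ hF => exact Submodule.smul_mem _ c hF

/-- Trigonometric polynomials are dense in `L_q(𝕋^d)` for finite `q`. The Stone–Weierstrass theorem
is used on `(ℝ/ℤ)^d` with the image measure. -/
theorem exists_trigonometric_eLpNorm_sub_lt {q : ℝ≥0∞} (hq1 : 1 ≤ q) (hq : q ≠ ∞)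
    {g : (Fin d → ℝ) → ℂ} (hg : MemLp g q (torusMeasure d)) {ε : ℝ≥0∞} (hε : 0 < ε) :
    ∃ P ∈ Submodule.span ℂ (Set.range (fourierExp (d := d))),
      eLpNorm (fun x => g x - P x) q (torusMeasure d) < ε := by
  have : Fact (1 ≤ q) := ⟨hq1⟩
  set ν : Measure (UnitAddTorus (Fin d)) := Measure.map toUnitTorus (torusMeasure d) with hν
  have : IsFiniteMeasure ν := inferInstance
  let G : UnitAddTorus (Fin d) → ℂ := fun z => hg.1.mk g (ofUnitTorus z)
  have hGm : StronglyMeasurable G :=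
    hg.1.stronglyMeasurable_mk.comp_measurable measurable_ofUnitTorus
  have hGg : ∀ᵐ x ∂(torusMeasure d), G (toUnitTorus x) = g x := by
    filter_upwards [ae_ofUnitTorus_toUnitTorus, hg.1.ae_eq_mk] with x h1 h2
    change hg.1.mk g (ofUnitTorus (toUnitTorus x)) = _
    rw [h1, ← h2]
  have hG : MemLp G q ν := by
    rw [hν, memLp_map_measure_iff hGm.aestronglyMeasurable measurable_toUnitTorus.aemeasurable]
    exact (memLp_congr_ae hGg).mpr hg
  have hdense : Dense ((Submodule.span ℂ (Set.range (UnitAddTorus.mFourier (d := Fin d))) :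
      Submodule ℂ C(UnitAddTorus (Fin d), ℂ)) : Set C(UnitAddTorus (Fin d), ℂ)) := by
    rw [Submodule.dense_iff_topologicalClosure_eq_top]
    exact UnitAddTorus.span_mFourier_closure_eq_top
  have hd2 := (ContinuousMap.toLp_denseRange ℂ ν ℂ hq).dense_image
    (ContinuousMap.toLp q ν ℂ).continuous hdense
  have hopen : {y : Lp ℂ q ν | edist y hG.toLp < ε} ∈ 𝓝 hG.toLp := Metric.eball_mem_nhds _ hε
  obtain ⟨y, hy, F, hF, rfl⟩ := mem_closure_iff_nhds.mp (hd2 hG.toLp) _ hopen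
  refine ⟨_, comp_toUnitTorus_mem_span_fourierExp hF, ?_⟩
  have hy : edist (ContinuousMap.toLp q ν ℂ F) hG.toLp < ε := hy
  rw [edist_comm, Lp.edist_def] at hy
  refine lt_of_le_of_lt (le_of_eq ?_) hy
  have e1 : (⇑hG.toLp - ⇑(ContinuousMap.toLp q ν ℂ F)) =ᵐ[ν] fun z => G z - F z := by
    filter_upwards [hG.coeFn_toLp, ContinuousMap.coeFn_toLp (p := q) (𝕜 := ℂ) ν F] with z h1 h2
    rw [Pi.sub_apply, h1, h2]
  rw [eLpNorm_congr_ae e1, hν]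
  refine Eq.trans ?_ (eLpNorm_map_measure (g := fun z => G z - F z) (f := toUnitTorus)
    (hGm.aestronglyMeasurable.sub F.continuous.aestronglyMeasurable)
    measurable_toUnitTorus.aemeasurable).symm
  refine eLpNorm_congr_ae ?_
  filter_upwards [hGg] with x hx
  rw [Function.comp_apply, hx]

end Density

/-! ### The commutator with a scalar multiplier -/

section ScalarCommutator

variable {d m : ℕ} {p K : ℝ}

theorem LevelFunction.adjoint_weightOp (ℓ : LevelFunction d p K) :
    ContinuousLinearMap.adjoint (ℓ.weightOp m) = ℓ.weightOp m := by
  refine ((ContinuousLinearMap.eq_adjoint_iff _ _).mpr fun u v => ?_).symm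
  rw [lp.inner_eq_tsum, lp.inner_eq_tsum]
  refine tsum_congr fun n => ?_
  rw [ℓ.weightOp_apply, ℓ.weightOp_apply, inner_smul_left, inner_smul_right,
    map_inv₀, map_pow, Complex.conj_ofNat]

/-- With `T = g Φ w`, `T' = conj g Φ w` and the lattice multiplier `Q`, this is the commutator of
the multiplication by the matrix function `g M` with `Φ w Q Φ*`. -/
noncomputable def scalarCommutator (Q : l2Lattice d m →L[ℂ] l2Lattice d m)
    (M : EuclideanSpace ℂ (Fin m) →L[ℂ] EuclideanSpace ℂ (Fin m))
    (T T' : l2Lattice d m →L[ℂ] L2Torus d m) : L2Torus d m →L[ℂ] L2Torus d m :=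
  constOp d M ∘L (T ∘L (Q ∘L ContinuousLinearMap.adjoint (fourier d m))) -
    (fourier d m ∘L Q) ∘L (ContinuousLinearMap.adjoint T' ∘L constOp d M)

theorem scalarCommutator_add (Q : l2Lattice d m →L[ℂ] l2Lattice d m)
    (M : EuclideanSpace ℂ (Fin m) →L[ℂ] EuclideanSpace ℂ (Fin m))
    (T₁ T₁' T₂ T₂' : l2Lattice d m →L[ℂ] L2Torus d m) :
    scalarCommutator Q M (T₁ + T₂) (T₁' + T₂') =
      scalarCommutator Q M T₁ T₁' + scalarCommutator Q M T₂ T₂' := by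
  unfold scalarCommutator
  rw [map_add]
  simp only [ContinuousLinearMap.add_comp, ContinuousLinearMap.comp_add]
  abel

theorem scalarCommutator_smul (Q : l2Lattice d m →L[ℂ] l2Lattice d m)
    (M : EuclideanSpace ℂ (Fin m) →L[ℂ] EuclideanSpace ℂ (Fin m))
    (T T' : l2Lattice d m →L[ℂ] L2Torus d m) (c : ℂ) :
    scalarCommutator Q M (c • T) ((starRingEnd ℂ) c • T') =
      (c • ContinuousLinearMap.id ℂ _) ∘L scalarCommutator Q M T T' := by
  unfold scalarCommutator
  rw [map_smulₛₗ, Complex.conj_conj]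
  ext1 u
  simp

theorem scalarCommutator_zero (Q : l2Lattice d m →L[ℂ] l2Lattice d m)
    (M : EuclideanSpace ℂ (Fin m) →L[ℂ] EuclideanSpace ℂ (Fin m)) :
    scalarCommutator Q M 0 0 = 0 := by
  unfold scalarCommutator
  rw [map_zero]
  simp

theorem LevelFunction.isWeightedMul_fourierExp (ℓ : LevelFunction d p K) (k : Fin d → ℤ) :
    ℓ.IsWeightedMul (fourierExp k) ((((2 * Real.pi) ^ (-(d : ℝ) / 2) : ℝ) : ℂ) •
      ((fourier d m ∘L shiftOp m k) ∘L ℓ.weightOp m)) := by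
  intro u
  have h := congrArg (fun A => A (ℓ.weightOp m u)) (mulExp_comp_fourier (m := m) k)
  refine EventuallyEq.trans (EventuallyEq.of_eq ?_)
    (coeFn_mulExp k (fourier d m (ℓ.weightOp m u)))
  exact congrArg (fun v : L2Torus d m => (v : (Fin d → ℝ) → EuclideanSpace ℂ (Fin m))) h.symm

variable {D Q : (Fin d → ℤ) → EuclideanSpace ℂ (Fin m) →L[ℂ] EuclideanSpace ℂ (Fin m)}
  {C : ℝ} {hC : 0 ≤ C} {hQ : ∀ n, ‖Q n‖ ≤ C}

/-- For an exponential `g`, which acts on the Fourier side as a shift, the commutator is a lattice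
multiplier followed by a shift. -/
theorem negligiblyApprox_scalarCommutator_fourierExp (hp : 0 < p) (ℓ : LevelFunction d p K)
    (hcomm : ∀ (k : Fin d → ℤ) (M : EuclideanSpace ℂ (Fin m) →L[ℂ] EuclideanSpace ℂ (Fin m))
      (ε : ℝ), 0 < ε → {n | ε * ((2 : ℝ) ^ ℓ.level n)⁻¹ <
        ‖M ∘L (((2 : ℂ) ^ ℓ.level (n - k))⁻¹ • Q (n - k)) -
          (((2 : ℂ) ^ ℓ.level n)⁻¹ • Q n) ∘L M‖}.Finite) (k : Fin d → ℤ)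
    (M : EuclideanSpace ℂ (Fin m) →L[ℂ] EuclideanSpace ℂ (Fin m)) :
    NegligiblyApprox p (scalarCommutator (diagOp Q hC hQ) M
      ((((2 * Real.pi) ^ (-(d : ℝ) / 2) : ℝ) : ℂ) •
        ((fourier d m ∘L shiftOp m k) ∘L ℓ.weightOp m))
      ((((2 * Real.pi) ^ (-(d : ℝ) / 2) : ℝ) : ℂ) •
        ((fourier d m ∘L shiftOp m (-k)) ∘L ℓ.weightOp m))) := by
  set κ : ℂ := (((2 * Real.pi) ^ (-(d : ℝ) / 2) : ℝ) : ℂ) with hκ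
  have hw : ∀ n, ‖((2 : ℂ) ^ ℓ.level n)⁻¹ • Q n‖ ≤ C := by
    intro n
    rw [norm_smul, norm_inv, norm_pow, Complex.norm_ofNat]
    exact (mul_le_of_le_one_left (norm_nonneg _)
      (inv_le_one_of_one_le₀ (one_le_pow₀ one_le_two))).trans (hQ n)
  have hD : ∀ n, ‖M ∘L (((2 : ℂ) ^ ℓ.level (n - k))⁻¹ • Q (n - k)) -
      (((2 : ℂ) ^ ℓ.level n)⁻¹ • Q n) ∘L M‖ ≤ ‖M‖ * C + C * ‖M‖ := by
    intro n
    refine (norm_sub_le _ _).trans (add_le_add ?_ ?_)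
    · exact (ContinuousLinearMap.opNorm_comp_le _ _).trans
        (mul_le_mul_of_nonneg_left (hw _) (norm_nonneg _))
    · exact (ContinuousLinearMap.opNorm_comp_le _ _).trans
        (mul_le_mul_of_nonneg_right (hw _) (norm_nonneg _))
  have hDn := ℓ.negligiblyApprox_diagOp hp (hC := by positivity) (hD := hD) (hcomm k M)
  have hfin := ((hDn.comp_right (shiftOp m k)).comp_right
    (ContinuousLinearMap.adjoint (fourier d m))).comp_left (κ • fourier d m)
  refine (congrArg (NegligiblyApprox p) ?_).mp hfin
  have hadj : ContinuousLinearMap.adjoint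
      (κ • ((fourier d m ∘L shiftOp m (-k)) ∘L ℓ.weightOp m)) =
      κ • (ℓ.weightOp m ∘L (shiftOp m k ∘L ContinuousLinearMap.adjoint (fourier d m))) := by
    rw [map_smulₛₗ, ContinuousLinearMap.adjoint_comp, ContinuousLinearMap.adjoint_comp,
      ℓ.adjoint_weightOp, adjoint_shiftOp_neg, hκ, Complex.conj_ofReal]
  unfold scalarCommutator
  rw [hadj]
  ext1 u
  have h1 : ∀ v, constOp d M (fourier d m v) = fourier d m (latticeConstOp d M v) := fun v =>
    congrArg (fun A => A v) (constOp_comp_fourier M)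
  have h2 : ∀ v, ContinuousLinearMap.adjoint (fourier d m) (constOp d M v) =
      latticeConstOp d M (ContinuousLinearMap.adjoint (fourier d m) v) := fun v =>
    congrArg (fun A => A v) (adjoint_fourier_comp_constOp M)
  simp only [sub_apply, smul_apply, ContinuousLinearMap.comp_apply, map_smul]
  rw [h1, h2, ← smul_sub, ← map_sub]
  congr 2
  apply lp.ext
  funext n
  set v := ContinuousLinearMap.adjoint (fourier d m) u
  rw [diagOp_apply, lp.coeFn_sub, Pi.sub_apply, latticeConstOp_apply, shiftOp_apply, shiftOp_apply,
    ℓ.weightOp_apply, diagOp_apply, diagOp_apply, ℓ.weightOp_apply, shiftOp_apply,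
    latticeConstOp_apply]
  simp

theorem continuous_of_mem_span_fourierExp {P : (Fin d → ℝ) → ℂ}
    (hP : P ∈ Submodule.span ℂ (Set.range (fourierExp (d := d)))) : Continuous P := by
  induction hP using Submodule.span_induction with
  | mem P hP =>
    obtain ⟨k, rfl⟩ := hP
    exact continuous_fourierExp k
  | zero => exact continuous_const
  | add P R _ _ hP hR => exact hP.add hR
  | smul c P _ hP => exact hP.const_smul c

theorem exists_negligiblyApprox_of_mem_span (hp : 0 < p) (ℓ : LevelFunction d p K)
    (hcomm : ∀ (k : Fin d → ℤ) (M : EuclideanSpace ℂ (Fin m) →L[ℂ] EuclideanSpace ℂ (Fin m))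
      (ε : ℝ), 0 < ε → {n | ε * ((2 : ℝ) ^ ℓ.level n)⁻¹ <
        ‖M ∘L (((2 : ℂ) ^ ℓ.level (n - k))⁻¹ • Q (n - k)) -
          (((2 : ℂ) ^ ℓ.level n)⁻¹ • Q n) ∘L M‖}.Finite)
    {P : (Fin d → ℝ) → ℂ} (hP : P ∈ Submodule.span ℂ (Set.range (fourierExp (d := d)))) :
    ∃ T T' : l2Lattice d m →L[ℂ] L2Torus d m, ℓ.IsWeightedMul P T ∧
      ℓ.IsWeightedMul (fun x => (starRingEnd ℂ) (P x)) T' ∧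
      ∀ M, NegligiblyApprox p (scalarCommutator (diagOp Q hC hQ) M T T') := by
  induction hP using Submodule.span_induction with
  | mem P hP =>
    obtain ⟨k, rfl⟩ := hP
    refine ⟨_, _, ℓ.isWeightedMul_fourierExp k, ?_,
      negligiblyApprox_scalarCommutator_fourierExp hp ℓ hcomm k⟩
    simp_rw [conj_fourierExp]
    exact ℓ.isWeightedMul_fourierExp (-k)
  | zero =>
    refine ⟨0, 0, LevelFunction.IsWeightedMul.zero, ?_, fun M => ?_⟩
    · simp only [Pi.zero_apply, map_zero]
      exact LevelFunction.IsWeightedMul.zero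
    · rw [scalarCommutator_zero]
      exact NegligiblyApprox.zero
  | add P R _ _ hP hR =>
    obtain ⟨T₁, T₁', h1, h1', hN⟩ := hP
    obtain ⟨T₂, T₂', h2, h2', hN'⟩ := hR
    refine ⟨T₁ + T₂, T₁' + T₂', h1.add h2, ?_, fun M => ?_⟩
    · simp only [Pi.add_apply, map_add]
      exact h1'.add h2'
    · rw [scalarCommutator_add]
      exact (hN M).add (hN' M)
  | smul c P _ hP =>
    obtain ⟨T₁, T₁', h1, h1', hN⟩ := hP
    refine ⟨c • T₁, (starRingEnd ℂ) c • T₁', h1.smul c, ?_, fun M => ?_⟩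
    · simp only [Pi.smul_apply, smul_eq_mul, map_mul]
      exact h1'.smul _
    · rw [scalarCommutator_smul]
      exact (hN M).comp_left _

/-- The commutator is controlled in the weak class by the `L_q` norm of the multiplier. -/
theorem exists_eventuallyApprox_scalarCommutator {q : ℝ} (hp : 0 < p) (hpq : Admissible p q)
    (ℓ : LevelFunction d p K) (B : l2Lattice d m →L[ℂ] l2Lattice d m)
    (M : EuclideanSpace ℂ (Fin m) →L[ℂ] EuclideanSpace ℂ (Fin m)) :
    ∃ c : ℝ, 0 < c ∧ ∀ ε : ℝ, 0 < ε → ∀ g : (Fin d → ℝ) → ℂ, MemLp g 2 (torusMeasure d) →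
      Integrable (fun x => ‖g x‖ ^ q) (torusMeasure d) →
      ∫ x, ‖g x‖ ^ q ∂(torusMeasure d) ≤ ε ^ q →
      ∃ T T' : l2Lattice d m →L[ℂ] L2Torus d m, ℓ.IsWeightedMul g T ∧
        ℓ.IsWeightedMul (fun x => (starRingEnd ℂ) (g x)) T' ∧
        EventuallyApprox p (scalarCommutator B M T T') (c * ε ^ p) := by
  obtain ⟨c, hc, h⟩ := ℓ.exists_eventuallyApprox (m := m) hp hpq
  set Φ := fourier d m
  set a₁ := ‖constOp d M‖ + 1 with ha₁
  set a₂ := ‖B ∘L ContinuousLinearMap.adjoint Φ‖ + 1 with ha₂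
  set a₃ := ‖-(Φ ∘L B)‖ + 1 with ha₃
  have h1 : 0 < a₁ := by positivity
  have h2 : 0 < a₂ := by positivity
  have h3 : 0 < a₃ := by positivity
  refine ⟨2 ^ p * (a₁ ^ p * (a₂ ^ p * c) + a₃ ^ p * (a₁ ^ p * c)), by positivity,
    fun ε hε g hg hgq hle => ?_⟩
  obtain ⟨T, hT, hA⟩ := h ε hε g hg hgq hle
  obtain ⟨T', hT', hA'⟩ := h ε hε (fun x => (starRingEnd ℂ) (g x)) hg.star
    (by simpa only [RCLike.norm_conj] using hgq) (by simpa only [RCLike.norm_conj] using hle)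
  refine ⟨T, T', hT, hT', ?_⟩
  have e1 := (hA.comp_right (B ∘L ContinuousLinearMap.adjoint Φ) h2 (by linarith)).comp_left
    (constOp d M) h1 (by linarith)
  have e2 := (hA'.adjoint.comp_right (constOp d M) h1 (by linarith)).comp_left (-(Φ ∘L B)) h3
    (by linarith)
  have e3 : scalarCommutator B M T T' =
      constOp d M ∘L (T ∘L (B ∘L ContinuousLinearMap.adjoint Φ)) +
        (-(Φ ∘L B)) ∘L (ContinuousLinearMap.adjoint T' ∘L constOp d M) := by
    unfold scalarCommutator
    rw [ContinuousLinearMap.neg_comp, ← sub_eq_add_neg]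
  rw [e3]
  refine (e1.add e2).mono (le_of_eq ?_)
  ring

/-- Approximation of the multiplier by trigonometric polynomials in `L_q`: the `o`-class is closed
with respect to the bound of `exists_eventuallyApprox_scalarCommutator`. -/
theorem exists_negligiblyApprox_scalarCommutator {q : ℝ} (hp : 0 < p) (hpq : Admissible p q)
    (ℓ : LevelFunction d p K)
    (hcomm : ∀ (k : Fin d → ℤ) (M : EuclideanSpace ℂ (Fin m) →L[ℂ] EuclideanSpace ℂ (Fin m))
      (ε : ℝ), 0 < ε → {n | ε * ((2 : ℝ) ^ ℓ.level n)⁻¹ <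
        ‖M ∘L (((2 : ℂ) ^ ℓ.level (n - k))⁻¹ • Q (n - k)) -
          (((2 : ℂ) ^ ℓ.level n)⁻¹ • Q n) ∘L M‖}.Finite)
    {g : (Fin d → ℝ) → ℂ} (hg : MemLp g (ENNReal.ofReal q) (torusMeasure d)) :
    ∃ T T' : l2Lattice d m →L[ℂ] L2Torus d m, ℓ.IsWeightedMul g T ∧
      ℓ.IsWeightedMul (fun x => (starRingEnd ℂ) (g x)) T' ∧
      ∀ M, NegligiblyApprox p (scalarCommutator (diagOp Q hC hQ) M T T') := by
  have hq2 : 2 ≤ q := hpq.two_le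
  have hq0 : 0 < q := by linarith
  have hqE : (2 : ℝ≥0∞) ≤ ENNReal.ofReal q := by
    rw [← ENNReal.ofReal_ofNat]; exact ENNReal.ofReal_le_ofReal hq2
  have hqE0 : ENNReal.ofReal q ≠ 0 := (zero_lt_two.trans_le hqE).ne'
  have hint : ∀ h : (Fin d → ℝ) → ℂ, MemLp h (ENNReal.ofReal q) (torusMeasure d) →
      Integrable (fun x => ‖h x‖ ^ q) (torusMeasure d) := by
    intro h hh
    have := hh.integrable_norm_rpow hqE0 ENNReal.ofReal_ne_top
    rwa [ENNReal.toReal_ofReal hq0.le] at this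
  obtain ⟨T, hT, -⟩ := (ℓ.exists_isWeightedMul (m := m) hpq).choose_spec.2 g
    (hg.mono_exponent hqE) (hint g hg)
  obtain ⟨T', hT', -⟩ := (ℓ.exists_isWeightedMul (m := m) hpq).choose_spec.2
    (fun x => (starRingEnd ℂ) (g x)) (hg.star.mono_exponent hqE) (hint _ hg.star)
  refine ⟨T, T', hT, hT', fun M δ hδ => ?_⟩
  obtain ⟨c, hc, h⟩ := exists_eventuallyApprox_scalarCommutator hp hpq ℓ (diagOp Q hC hQ) M
  have h2p : (0 : ℝ) < 2 ^ p := by positivity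
  -- the accuracy in `L_q` for which the remainder contributes at most `δ / 2`
  set ε : ℝ := (δ / 2 / (2 ^ p * c)) ^ (1 / p) with hε
  have hε0 : 0 < ε := by positivity
  have hεp : 2 ^ p * (c * ε ^ p) = δ / 2 := by
    rw [hε, ← Real.rpow_mul (by positivity), one_div_mul_cancel hp.ne', Real.rpow_one]
    field_simp
  obtain ⟨P, hP, hgP⟩ := exists_trigonometric_eLpNorm_sub_lt (one_le_two.trans hqE)
    ENNReal.ofReal_ne_top hg (ENNReal.ofReal_pos.mpr hε0)
  obtain ⟨T₁, T₁', h1, h1', hN⟩ :=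
    exists_negligiblyApprox_of_mem_span (hC := hC) (hQ := hQ) hp ℓ hcomm hP
  have hPc := continuous_of_mem_span_fourierExp hP
  have hr : MemLp (fun x => g x - P x) (ENNReal.ofReal q) (torusMeasure d) :=
    ⟨hg.1.sub hPc.aestronglyMeasurable, hgP.trans ENNReal.ofReal_lt_top⟩
  have hle : ∫ x, ‖g x - P x‖ ^ q ∂(torusMeasure d) ≤ ε ^ q := by
    have h5 := hr.eLpNorm_eq_integral_rpow_norm hqE0 ENNReal.ofReal_ne_top
    rw [ENNReal.toReal_ofReal hq0.le] at h5
    rw [h5, ENNReal.ofReal_lt_ofReal_iff hε0] at hgP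
    have h6 : 0 ≤ ∫ x, ‖g x - P x‖ ^ q ∂(torusMeasure d) :=
      integral_nonneg fun x => by positivity
    have h7 := Real.rpow_le_rpow (by positivity) hgP.le hq0.le
    rwa [← Real.rpow_mul h6, inv_mul_cancel₀ hq0.ne', Real.rpow_one] at h7
  obtain ⟨T₂, T₂', h2, h2', hA⟩ := h ε hε0 _ (hr.mono_exponent hqE) (hint _ hr) hle
  have e1 : T = T₁ + T₂ := by
    refine hT.unique ?_
    have := h1.add h2
    simpa only [add_sub_cancel] using this
  have e2 : T' = T₁' + T₂' := by
    refine hT'.unique ?_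
    have := h1'.add h2'
    simpa only [map_sub, add_sub_cancel] using this
  rw [e1, e2, scalarCommutator_add]
  refine ((hN M (δ / 2 / 2 ^ p) (by positivity)).add hA).mono (le_of_eq ?_)
  rw [mul_add, hεp]
  field_simp
  norm_num

end ScalarCommutator

/-! ### The unbounded operators -/

section Unbounded

variable {d m : ℕ}

theorem toEuclideanLin_eq_sum (A : Matrix (Fin m) (Fin m) ℂ) (v : EuclideanSpace ℂ (Fin m)) :
    A.toEuclideanLin v = ∑ i, ∑ j, A i j • matCLM (Matrix.single i j 1) v := by
  have h := congrArg (fun B => B v) (matCLM_eq_sum A)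
  simp only [sum_apply, smul_apply] at h
  exact h

theorem mem_domain_conjFourier {W : (Fin d → ℤ) → Matrix (Fin m) (Fin m) ℂ} {C : ℝ} (hC : 0 ≤ C)
    (hW : ∀ n, ‖matCLM (W n)‖ ≤ C) (u : L2Torus d m) : u ∈ (conjFourier W).domain :=
  ⟨⟨trivial, lp.memℓp (diagOp (fun n => matCLM (W n)) hC hW
    (ContinuousLinearMap.adjoint (fourier d m) u))⟩, trivial⟩

/-- The domain of the multiplication by an `L₂` function contains the simple functions. -/
theorem dense_mulTorusDomain {f : (Fin d → ℝ) → Matrix (Fin m) (Fin m) ℂ}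
    (hf : ∀ i j, MemLp (fun k => f k i j) 2 (torusMeasure d)) :
    Dense (mulTorusDomain f : Set (L2Torus d m)) := by
  refine (Lp.simpleFunc.denseRange (E := EuclideanSpace ℂ (Fin m)) (μ := torusMeasure d)
    (p := 2) ENNReal.ofNat_ne_top).mono ?_
  rintro _ ⟨s, rfl⟩
  obtain ⟨C, hC⟩ := (Lp.simpleFunc.toSimpleFunc s).exists_forall_norm_le
  have hs := Lp.simpleFunc.toSimpleFunc_eq_toFun s
  have h1 : MemLp (fun k => ∑ i, ∑ j, f k i j •
      matCLM (Matrix.single i j (1 : ℂ)) (Lp.simpleFunc.toSimpleFunc s k)) 2 (torusMeasure d) := by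
    refine memLp_finsetSum _ fun i _ => memLp_finsetSum _ fun j _ => ?_
    refine MemLp.of_le_mul (c := ‖matCLM (m := m) (Matrix.single i j (1 : ℂ))‖ * C) (hf i j)
      ((hf i j).1.smul ((ContinuousLinearMap.continuous _).comp_aestronglyMeasurable
        (SimpleFunc.aestronglyMeasurable _))) (ae_of_all _ fun k => ?_)
    rw [norm_smul, mul_comm]
    refine mul_le_mul_of_nonneg_right ?_ (norm_nonneg _)
    exact (ContinuousLinearMap.le_opNorm _ _).trans
      (mul_le_mul_of_nonneg_left (hC k) (norm_nonneg _))
  refine (memLp_congr_ae ?_).mp h1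
  filter_upwards [hs] with k hk
  rw [hk]
  exact (toEuclideanLin_eq_sum _ _).symm

variable {p K : ℝ} {f : (Fin d → ℝ) → Matrix (Fin m) (Fin m) ℂ} {ℓ : LevelFunction d p K}
  {T : Fin m → Fin m → l2Lattice d m →L[ℂ] L2Torus d m}

/-- The bounded operator `f Φ w` as a sum over the matrix entries of `f`. -/
theorem coeFn_sum_constOp (hT : ∀ i j, ℓ.IsWeightedMul (fun x => f x i j) (T i j))
    (v : l2Lattice d m) :
    (∑ i, ∑ j, constOp d (matCLM (Matrix.single i j 1)) (T i j v) : L2Torus d m)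
      =ᵐ[torusMeasure d] fun x => (f x).toEuclideanLin (fourier d m (ℓ.weightOp m v) x) := by
  have h1 : ∀ᵐ x ∂(torusMeasure d), ∀ i j, constOp d (matCLM (Matrix.single i j 1)) (T i j v) x =
      f x i j • matCLM (Matrix.single i j 1) (fourier d m (ℓ.weightOp m v) x) := by
    rw [ae_all_iff]; intro i
    rw [ae_all_iff]; intro j
    filter_upwards [coeFn_constOp (matCLM (Matrix.single i j 1)) (T i j v), hT i j v] with x h2 h3
    rw [h2, h3, map_smul]
  filter_upwards [h1, Lp.coeFn_finsetSum Finset.univ fun i =>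
      ∑ j, constOp d (matCLM (Matrix.single i j 1)) (T i j v),
    ae_all_iff.mpr fun i => Lp.coeFn_finsetSum Finset.univ fun j =>
      constOp d (matCLM (Matrix.single i j 1)) (T i j v)] with x h1 h2 h3
  rw [h2, Finset.sum_apply, toEuclideanLin_eq_sum]
  refine Finset.sum_congr rfl fun i _ => ?_
  rw [h3, Finset.sum_apply]
  exact Finset.sum_congr rfl fun j _ => h1 i j

/-- On the domain of `f` the operator `w Φ* f` is the sum over the matrix entries. The individual
products `f_{ij} E_{ij} u` need not be square integrable, so the identity is tested against
lattice vectors. -/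
theorem weightOp_adjoint_fourier_mulTorus
    (hT : ∀ i j, ℓ.IsWeightedMul (fun x => (starRingEnd ℂ) (f x i j)) (T i j))
    (u : (mulTorus f).domain) :
    ℓ.weightOp m (ContinuousLinearMap.adjoint (fourier d m) (mulTorus f u)) =
      ∑ i, ∑ j, ContinuousLinearMap.adjoint (T i j)
        (constOp d (matCLM (Matrix.single i j 1)) (u : L2Torus d m)) := by
  refine ext_inner_right ℂ fun v => ?_
  rw [← ℓ.adjoint_weightOp, ContinuousLinearMap.adjoint_inner_left,
    ContinuousLinearMap.adjoint_inner_left]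
  simp only [sum_inner, ContinuousLinearMap.adjoint_inner_left]
  simp only [L2.inner_def]
  have hint : ∀ i j, Integrable (fun x => ⟪constOp d (matCLM (Matrix.single i j 1))
      (u : L2Torus d m) x, T i j v x⟫_ℂ) (torusMeasure d) := fun i j => L2.integrable_inner _ _
  have e : ∀ i, ∑ j, ∫ x, ⟪constOp d (matCLM (Matrix.single i j 1))
      (u : L2Torus d m) x, T i j v x⟫_ℂ ∂(torusMeasure d) =
      ∫ x, ∑ j, ⟪constOp d (matCLM (Matrix.single i j 1))
      (u : L2Torus d m) x, T i j v x⟫_ℂ ∂(torusMeasure d) := fun i =>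
    (integral_finsetSum _ fun j _ => hint i j).symm
  simp only [e]
  rw [← integral_finsetSum _ fun i _ => integrable_finsetSum _ fun j _ => hint i j]
  refine integral_congr_ae ?_
  have h1 : ∀ᵐ x ∂(torusMeasure d), ∀ i j, ⟪constOp d (matCLM (Matrix.single i j 1))
      (u : L2Torus d m) x, T i j v x⟫_ℂ = ⟪f x i j • matCLM (Matrix.single i j 1)
        ((u : L2Torus d m) x), fourier d m (ℓ.weightOp m v) x⟫_ℂ := by
    rw [ae_all_iff]; intro i
    rw [ae_all_iff]; intro j
    filter_upwards [coeFn_constOp (matCLM (Matrix.single i j 1)) (u : L2Torus d m),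
      hT i j v] with x h2 h3
    rw [h2, h3, inner_smul_left, inner_smul_right]
  filter_upwards [h1, (memLp_of_mem_mulTorusDomain u.2).coeFn_toLp] with x h1 h2
  have h3 : mulTorus f u x = (f x).toEuclideanLin ((u : L2Torus d m) x) := h2
  rw [h3, toEuclideanLin_eq_sum, sum_inner]
  refine Finset.sum_congr rfl fun i _ => ?_
  rw [sum_inner]
  exact Finset.sum_congr rfl fun j _ => (h1 i j).symm

end Unbounded

theorem exists_admissible {p : ℝ} {q : ℝ≥0∞}
    (hq : (2 < p ∧ q = ENNReal.ofReal p) ∨ (p < 2 ∧ q = 2) ∨ (p = 2 ∧ 2 < q)) :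
    ∃ r : ℝ, Admissible p r ∧ ENNReal.ofReal r ≤ q := by
  rcases hq with ⟨h1, rfl⟩ | ⟨h1, rfl⟩ | ⟨rfl, h2⟩
  · exact ⟨p, Or.inl ⟨h1, rfl⟩, le_rfl⟩
  · exact ⟨2, Or.inr (Or.inl ⟨h1, rfl⟩), by simp⟩
  · obtain ⟨r, hr, hrq⟩ := exists_between h2
    have hrt : r ≠ ∞ := (hrq.trans_le le_top).ne
    refine ⟨r.toReal, Or.inr (Or.inr ⟨rfl, ?_⟩), ?_⟩
    · have := (ENNReal.toReal_lt_toReal ENNReal.ofNat_ne_top hrt).mpr hr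
      simpa using this
    · rw [ENNReal.ofReal_toReal hrt]; exact hrq.le

end DiscretePDO

theorem mainTheorem10 {d m : ℕ} {p : ℝ} (hp : 0 < p) {q : ℝ≥0∞}
    (hq : (2 < p ∧ q = ENNReal.ofReal p) ∨ (p < 2 ∧ q = 2) ∨ (p = 2 ∧ 2 < q))
    (W : (Fin d → ℤ) → Matrix (Fin m) (Fin m) ℂ)
    (ω : EuclideanSpace ℝ (Fin d) → ℂ)
    (hω : ContinuousOn ω (Metric.sphere 0 1))
    (hW : ∀ i j : Fin m,
      (fun n : Fin d → ℤ => W n i j -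
        ((‖DiscretePDO.latticeVec n‖ ^ (-(d : ℝ) / p) : ℝ) : ℂ) *
          (ω (‖DiscretePDO.latticeVec n‖⁻¹ • DiscretePDO.latticeVec n) *
            (1 : Matrix (Fin m) (Fin m) ℂ) i j))
        =o[comap (fun n : Fin d → ℤ => ‖DiscretePDO.latticeVec n‖) atTop]
      fun n : Fin d → ℤ => ‖DiscretePDO.latticeVec n‖ ^ (-(d : ℝ) / p))
    (f : (Fin d → ℝ) → Matrix (Fin m) (Fin m) ℂ)
    (hf : ∀ i j : Fin m, MemLp (fun k => f k i j) q (DiscretePDO.torusMeasure d)) :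
    (DiscretePDO.pcomp (DiscretePDO.mulTorus f) (DiscretePDO.conjFourier W)).domain = ⊤ ∧
    Dense ((DiscretePDO.pcomp (DiscretePDO.conjFourier W) (DiscretePDO.mulTorus f)).domain :
      Set (DiscretePDO.L2Torus d m)) ∧
    ∃ C : DiscretePDO.L2Torus d m →L[ℂ] DiscretePDO.L2Torus d m,
      (∀ u : (DiscretePDO.commutator f W).domain,
        DiscretePDO.commutator f W u = C (u : DiscretePDO.L2Torus d m)) ∧
      DiscretePDO.MemWeakSchattenZero p C := by
  obtain ⟨r, hpr, hrq⟩ := DiscretePDO.exists_admissible hq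
  have hfr : ∀ i j, MemLp (fun k => f k i j) (ENNReal.ofReal r) (DiscretePDO.torusMeasure d) :=
    fun i j => (hf i j).mono_exponent hrq
  have hf2 : ∀ i j, MemLp (fun k => f k i j) 2 (DiscretePDO.torusMeasure d) := fun i j =>
    (hfr i j).mono_exponent (by
      rw [← ENNReal.ofReal_ofNat]; exact ENNReal.ofReal_le_ofReal hpr.two_le)
  obtain ⟨K, ℓ, hℓ⟩ := DiscretePDO.exists_levelFunction d hp
  have hw := DiscretePDO.isBigO_weight ℓ hℓ
  have hZ := DiscretePDO.isLittleO_symbol_sub hW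
  have hWO : (fun n => DiscretePDO.matCLM (W n)) =O[cofinite]
      fun n => ((2 : ℝ) ^ ℓ.level n)⁻¹ := by
    have h1 : (fun n => DiscretePDO.leadingPart ω (-(d : ℝ) / p) n •
        ContinuousLinearMap.id ℂ (EuclideanSpace ℂ (Fin m))) =O[cofinite]
        fun n => ‖DiscretePDO.latticeVec n‖ ^ (-(d : ℝ) / p) := by
      have h2 : (fun _ : Fin d → ℤ => ContinuousLinearMap.id ℂ (EuclideanSpace ℂ (Fin m)))
          =O[cofinite] fun _ => (1 : ℝ) := isBigO_const_const _ one_ne_zero _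
      simpa only [smul_eq_mul, mul_one] using
        (DiscretePDO.isBigO_leadingPart (s := -(d : ℝ) / p) hω).smul h2
    refine IsBigO.trans ((hZ.isBigO.add h1).congr_left fun n => ?_) hw
    exact sub_add_cancel _ _
  obtain ⟨C, hC, hWC⟩ := DiscretePDO.exists_bound_of_isBigO ℓ hWO
  -- the bounded quotient of the symbol by the dyadic weight
  set Q : (Fin d → ℤ) → EuclideanSpace ℂ (Fin m) →L[ℂ] EuclideanSpace ℂ (Fin m) :=
    fun n => (2 : ℂ) ^ ℓ.level n • DiscretePDO.matCLM (W n) with hQdef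
  have hwQ : ∀ n, ((2 : ℂ) ^ ℓ.level n)⁻¹ • Q n = DiscretePDO.matCLM (W n) := fun n =>
    inv_smul_smul₀ (pow_ne_zero _ two_ne_zero) _
  have hQ : ∀ n, ‖Q n‖ ≤ C := by
    intro n
    have h1 := hWC n
    rw [← div_eq_mul_inv, le_div_iff₀ (by positivity)] at h1
    rw [hQdef, norm_smul, norm_pow, Complex.norm_ofNat, mul_comm]
    exact h1
  have hWC' : ∀ n, ‖DiscretePDO.matCLM (W n)‖ ≤ C := fun n =>
    (hWC n).trans (mul_le_of_le_one_right hC (inv_le_one_of_one_le₀ (one_le_pow₀ one_le_two)))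
  have hcomm : ∀ (k : Fin d → ℤ) (M : EuclideanSpace ℂ (Fin m) →L[ℂ] EuclideanSpace ℂ (Fin m))
      (ε : ℝ), 0 < ε → {n | ε * ((2 : ℝ) ^ ℓ.level n)⁻¹ <
        ‖M ∘L (((2 : ℂ) ^ ℓ.level (n - k))⁻¹ • Q (n - k)) -
          (((2 : ℂ) ^ ℓ.level n)⁻¹ • Q n) ∘L M‖}.Finite := by
    intro k M ε hε
    simp only [hwQ]
    exact DiscretePDO.finite_setOf_lt_norm_of_isLittleO ℓ
      ((DiscretePDO.isLittleO_symbol_commutator hω hZ k M).trans_isBigO hw) ε hε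
  choose T T' hT hT' hN using fun i j =>
    DiscretePDO.exists_negligiblyApprox_scalarCommutator (hC := hC) (hQ := hQ) hp hpr ℓ hcomm
      (hfr i j)
  set Q' := DiscretePDO.diagOp Q hC hQ with hQ'
  set Φ := DiscretePDO.fourier d m with hΦ
  have hWQ : ∀ v, DiscretePDO.diagOp (fun n => DiscretePDO.matCLM (W n)) hC hWC' v =
      ℓ.weightOp m (Q' v) := by
    intro v
    apply lp.ext
    funext n
    rw [ℓ.weightOp_apply, hQ', DiscretePDO.diagOp_apply, DiscretePDO.diagOp_apply, ← hwQ]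
    rfl
  have hWQ' : ∀ v, DiscretePDO.diagOp (fun n => DiscretePDO.matCLM (W n)) hC hWC' v =
      Q' (ℓ.weightOp m v) := by
    intro v
    apply lp.ext
    funext n
    rw [hQ', DiscretePDO.diagOp_apply, DiscretePDO.diagOp_apply, ℓ.weightOp_apply, map_smul, ← hwQ]
    rfl
  have hdom : ∀ u, u ∈ (DiscretePDO.conjFourier W).domain :=
    DiscretePDO.mem_domain_conjFourier hC hWC'
  have hleft : ∀ u : (DiscretePDO.conjFourier W).domain,
      (∑ i, ∑ j, DiscretePDO.constOp d (DiscretePDO.matCLM (Matrix.single i j 1)) (T i j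
        (Q' (ContinuousLinearMap.adjoint Φ (u : DiscretePDO.L2Torus d m)))) :
          DiscretePDO.L2Torus d m) =ᵐ[DiscretePDO.torusMeasure d]
      fun x => (f x).toEuclideanLin (DiscretePDO.conjFourier W u x) := by
    intro u
    have h1 := DiscretePDO.coeFn_sum_constOp hT
      (Q' (ContinuousLinearMap.adjoint Φ (u : DiscretePDO.L2Torus d m)))
    rwa [← hWQ] at h1
  have hmem : ∀ u : (DiscretePDO.conjFourier W).domain,
      DiscretePDO.conjFourier W u ∈ (DiscretePDO.mulTorus f).domain := fun u =>
    (memLp_congr_ae (hleft u)).mp (Lp.memLp _)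
  refine ⟨?_, ?_, ∑ i, ∑ j, DiscretePDO.scalarCommutator Q'
    (DiscretePDO.matCLM (Matrix.single i j 1)) (T i j) (T' i j), ?_, ?_⟩
  · exact eq_top_iff.mpr fun u _ => ⟨hdom u, hmem ⟨u, hdom u⟩⟩
  · exact (DiscretePDO.dense_mulTorusDomain hf2).mono fun u hu => ⟨hu, hdom _⟩
  · intro u
    obtain ⟨u, ⟨h1, h1'⟩, ⟨h2, h2'⟩⟩ := u
    have e1 : DiscretePDO.pcomp (DiscretePDO.mulTorus f) (DiscretePDO.conjFourier W)
        ⟨u, h1, h1'⟩ = ∑ i, ∑ j, DiscretePDO.constOp d (DiscretePDO.matCLM (Matrix.single i j 1))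
          (T i j (Q' (ContinuousLinearMap.adjoint Φ u))) := by
      apply Lp.ext
      refine EventuallyEq.trans ?_ (hleft ⟨u, h1⟩).symm
      exact (DiscretePDO.memLp_of_mem_mulTorusDomain (hmem ⟨u, h1⟩)).coeFn_toLp
    have e2 : DiscretePDO.pcomp (DiscretePDO.conjFourier W) (DiscretePDO.mulTorus f)
        ⟨u, h2, h2'⟩ = Φ (Q' (∑ i, ∑ j, ContinuousLinearMap.adjoint (T' i j)
          (DiscretePDO.constOp d (DiscretePDO.matCLM (Matrix.single i j 1)) u))) := by
      have h3 := DiscretePDO.weightOp_adjoint_fourier_mulTorus hT' ⟨u, h2⟩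
      rw [← h3, ← hWQ']
      rfl
    have e3 : DiscretePDO.commutator f W ⟨u, ⟨h1, h1'⟩, ⟨h2, h2'⟩⟩ =
        DiscretePDO.pcomp (DiscretePDO.mulTorus f) (DiscretePDO.conjFourier W) ⟨u, h1, h1'⟩ -
        DiscretePDO.pcomp (DiscretePDO.conjFourier W) (DiscretePDO.mulTorus f) ⟨u, h2, h2'⟩ :=
      LinearPMap.sub_apply _ _ _
    rw [e3, e1, e2]
    simp only [DiscretePDO.scalarCommutator, sum_apply, sub_apply, ContinuousLinearMap.comp_apply,
      map_sum, Finset.sum_sub_distrib]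
    rfl
  · exact (DiscretePDO.NegligiblyApprox.sum _ fun i _ => DiscretePDO.NegligiblyApprox.sum _
      fun j _ => hN i j _).memWeakSchattenZero hp
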